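/- **Model.** Let $S=(-\tfrac12,\tfrac12]$ with the torus metric $d(x,y)=\min\{|x-y|,1-|x-y|\}$, let $\lambda>0$, $p,q\in[0,1]$, and let $\phi:[0,\infty)\to[0,1]$ be measurable. A sample of $\mathrm{GKBM}(\lambda n,p,q,\phi)$ consists of a number of nodes $N\sim\mathrm{Poisson}(\lambda n)$ and, given $N$, of independent community labels $\sigma(u)$, uniform in $\{-1,+1\}$, independent locations $X_u$, uniform in $S$ $(1\le u\le N)$, and a simple undirected graph on $\{1,\dots,N\}$ in which, conditionally on labels and locations, distinct nodes $u,v$ are linked, independently over unordered pairs, with probability $p\,\psi_n(X_u,X_v)$ if $\sigma(u)=\sigma(v)$ and $q\,\psi_n(X_u,X_v)$ if $\sigma(u)\ne\sigma(v)$, where $\psi_n(x,y)=\phi\big(\tfrac{n}{\log n}d(x,y)\big)$. Put $$\kappa=\sup\{x:\phi(x)\neq0\},\qquad I_\phi(p,q)=2\int_0^\infty\Big(1-\sqrt{pq}\,\phi(x)-\sqrt{(1-p\phi(x))(1-q\phi(x))}\Big)dx .$$ **Algorithms.** An algorithm is a program of a real random access machine with integer and real arrays, unit-cost integer addition and (truncated)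 subtraction, unit-cost real $+,-,\times,\div$, $\log$, comparisons and evaluations of $\phi$, and integer parts of reals at a cost of one step per binary digit. Its input is $n,\lambda,p,q,\kappa$, the locations $X_u$, and the graph as adjacency lists; its output is a vector $\tilde\sigma\in\{-1,+1\}^N$. **Theorem.** Let $\lambda>0$, $0<q<p<1$, $0<\kappa<\infty$, and assume that $\phi(x)>0$ for all $x\in[0,\kappa]$. If $\lambda\kappa>1$ and $\lambda I_\phi(p,q)>1$, then there is an algorithm that recovers the communities of $\mathrm{GKBM}(\lambda n,p,q,\phi)$ exactly, that is, $$\lim_{n\to\infty}\mathbb P\big(\tilde\sigma\in\{\sigma,-\sigma\}\big)=1,$$ and that runs in time linear in the number of edges, which is of order $n\log n$: there is a constant $C$, independent of $n$, such that with probability tending to $1$ as $n\to\infty$ the number of steps is at most $C$ times the number of edges of the graph and at most $C\,n\log n$. -/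

import Mathlib

open MeasureTheory ProbabilityTheory Filter Topology
open scoped NNReal ENNReal

noncomputable section

namespace GKBM

/-! ### The geometric kernel block model -/

/-- The one-dimensional torus, represented by the points of `(-1/2, 1/2]`. -/
def torus : Set ℝ := Set.Ioc (-(1 / 2)) (1 / 2)

/-- The torus metric. -/
def torusDist (x y : ℝ) : ℝ := min |x - y| (1 - |x - y|)

/-- The rescaled kernel `ψ_n(x, y) = φ ((n / log n) * d(x, y))`. -/
def psi (φ : ℝ≥0 → unitInterval) (n : ℕ) (x y : ℝ) : ℝ :=
  φ (Real.toNNReal ((n : ℝ) / Real.log n * torusDist x y))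

/-- The normalised interaction range `κ = sup {x : φ x ≠ 0}`, as an extended number. -/
def interactionRange (φ : ℝ≥0 → unitInterval) : ℝ≥0∞ :=
  sSup ((fun x : ℝ≥0 => (x : ℝ≥0∞)) '' {x | φ x ≠ 0})

/-- The information metric `I_φ(p, q)`. -/
def infoMetric (φ : ℝ≥0 → unitInterval) (p q : ℝ) : ℝ :=
  2 * ∫ x in Set.Ici (0 : ℝ),
    (1 - √(p * q) * (φ x.toNNReal : ℝ)
      - √((1 - p * (φ x.toNNReal : ℝ)) * (1 - q * (φ x.toNNReal : ℝ))))

/-- The discrete part of a sample: the number of nodes, the community labels (in `{-1, +1}`) and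
the graph. -/
structure Config where
  N : ℕ
  σ : Fin N → ℤˣ
  G : SimpleGraph (Fin N)

/-- A sample `(σ, X, A)`: the discrete part together with the locations of the nodes. A set of
samples is measurable iff for each value of the discrete part its set of locations is. -/
abbrev Sample : Type := Σ c : Config, Fin c.N → ℝ

namespace Sample

/-- The number of nodes. -/
abbrev N (ω : Sample) : ℕ := ω.1.N

/-- The community labels. -/
abbrev σ (ω : Sample) : Fin ω.N → ℤˣ := ω.1.σ

/-- The graph. -/
abbrev G (ω : Sample) : SimpleGraph (Fin ω.N) := ω.1.G

/-- The locations. -/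
abbrev X (ω : Sample) : Fin ω.N → ℝ := ω.2

/-- The number of edges. -/
def numEdges (ω : Sample) : ℕ := ω.G.edgeSet.ncard

end Sample

/-- The probability that nodes `u` and `v` are linked, given labels and locations. -/
def linkProb (p q : ℝ) (φ : ℝ≥0 → unitInterval) (n : ℕ) {N : ℕ} (σ : Fin N → ℤˣ)
    (x : Fin N → ℝ) (u v : Fin N) : ℝ :=
  (if σ u = σ v then p else q) * psi φ n (x u) (x v)

open Classical in
/-- The conditional probability of the graph `G` given the labels `σ` and the locations `x`: the
links of the unordered pairs of distinct nodes are independent. -/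
def graphProb (p q : ℝ) (φ : ℝ≥0 → unitInterval) (n : ℕ) {N : ℕ} (σ : Fin N → ℤˣ)
    (x : Fin N → ℝ) (G : SimpleGraph (Fin N)) : ℝ :=
  ∏ u : Fin N, ∏ v ∈ Finset.Ioi u,
    if G.Adj u v then linkProb p q φ n σ x u v else 1 - linkProb p q φ n σ x u v

/-- The law of `GKBM(λn, p, q, φ)`. On the samples with discrete part `(N, σ, G)` it is
`Poi(λn){N} * 2^(-N) * ℙ(G | σ, x) dx`, for `x` in the `N`-th power of the torus (which has
volume one). -/
def law (lam p q : ℝ) (φ : ℝ≥0 → unitInterval) (n : ℕ) : Measure Sample :=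
  Measure.sum fun c : Config =>
    ((poissonMeasure (Real.toNNReal (lam * n)) {c.N} * (1 / 2) ^ c.N) •
      (volume.restrict (Set.univ.pi fun _ : Fin c.N => torus)).withDensity
        fun x => ENNReal.ofReal (graphProb p q φ n c.σ x c.G)).map (Sigma.mk c)

/-! ### Algorithms: programs of a real random access machine with a step count -/

/-- The input of an algorithm: the model parameters, the scale `n`, the locations and the graph
(but not the community labels). -/
structure Input where
  n : ℕ
  lam : ℝ
  p : ℝ
  q : ℝ
  κ : ℝ
  φ : ℝ≥0 → unitInterval
  N : ℕ
  X : Fin N → ℝ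
  G : SimpleGraph (Fin N)

namespace Input

/-- The location of node `u`. -/
def loc (I : Input) (u : ℕ) : ℝ := if h : u < I.N then I.X ⟨u, h⟩ else 0

open Classical in
/-- The adjacency list of node `u`, in increasing order. -/
def nbrs (I : Input) (u : ℕ) : List ℕ :=
  (List.range I.N).filter fun v => ∃ (hu : u < I.N) (hv : v < I.N), I.G.Adj ⟨u, hu⟩ ⟨v, hv⟩

end Input

/-- The memory: countably many integer arrays and countably many real arrays. A program can
mention only finitely many of them; a variable is cell `0` of an array. -/
structure Memory where
  nat : ℕ → ℕ → ℕ
  real : ℕ → ℕ → ℝ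

namespace Memory

/-- Initially all cells are zero. -/
def init : Memory := ⟨fun _ _ => 0, fun _ _ => 0⟩

/-- Write into cell `i` of integer array `a`. -/
def setNat (m : Memory) (a i k : ℕ) : Memory :=
  ⟨Function.update m.nat a (Function.update (m.nat a) i k), m.real⟩

/-- Write into cell `i` of real array `a`. -/
def setReal (m : Memory) (a i : ℕ) (x : ℝ) : Memory :=
  ⟨m.nat, Function.update m.real a (Function.update (m.real a) i x)⟩

end Memory

/-- Integer expressions. -/
inductive NExpr : Type
  | const (k : ℕ)
  | read (a : ℕ) (i : NExpr)
  | add (e f : NExpr)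
  | sub (e f : NExpr)
  | scale
  | numNodes
  | degree (u : NExpr)
  | nbr (u k : NExpr)

namespace NExpr

/-- The value of an integer expression. `scale` is `n`, `numNodes` is `N`, `degree u` is the length
of the adjacency list of `u` and `nbr u k` is its `k`-th entry (`0` if there is none);
subtraction is truncated. -/
def eval (I : Input) (m : Memory) : NExpr → ℕ
  | const k => k
  | read a i => m.nat a (i.eval I m)
  | add e f => e.eval I m + f.eval I m
  | sub e f => e.eval I m - f.eval I m
  | scale => I.n
  | numNodes => I.N
  | degree u => (I.nbrs (u.eval I m)).length
  | nbr u k => (I.nbrs (u.eval I m)).getD (k.eval I m) 0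

/-- The number of operations in the evaluation of an integer expression. -/
def cost : NExpr → ℕ
  | const _ => 1
  | read _ i => i.cost + 1
  | add e f => e.cost + f.cost + 1
  | sub e f => e.cost + f.cost + 1
  | scale => 1
  | numNodes => 1
  | degree u => u.cost + 1
  | nbr u k => u.cost + k.cost + 1

end NExpr

/-- Real expressions; the numerical constants of a program are rational. -/
inductive RExpr : Type
  | const (c : ℚ)
  | ofNat (e : NExpr)
  | read (a : ℕ) (i : NExpr)
  | add (e f : RExpr)
  | sub (e f : RExpr)
  | mul (e f : RExpr)
  | div (e f : RExpr)
  | log (e : RExpr)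
  | kernel (e : RExpr)
  | loc (u : NExpr)
  | lam
  | p
  | q
  | κ

namespace RExpr

/-- The value of a real expression. `kernel` evaluates the kernel `φ`. -/
def eval (I : Input) (m : Memory) : RExpr → ℝ
  | const c => c
  | ofNat e => e.eval I m
  | read a i => m.real a (i.eval I m)
  | add e f => e.eval I m + f.eval I m
  | sub e f => e.eval I m - f.eval I m
  | mul e f => e.eval I m * f.eval I m
  | div e f => e.eval I m / f.eval I m
  | log e => Real.log (e.eval I m)
  | kernel e => I.φ (e.eval I m).toNNReal
  | loc u => I.loc (u.eval I m)
  | lam => I.lam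
  | p => I.p
  | q => I.q
  | κ => I.κ

/-- The number of operations in the evaluation of a real expression. -/
def cost : RExpr → ℕ
  | const _ => 1
  | ofNat e => e.cost + 1
  | read _ i => i.cost + 1
  | add e f => e.cost + f.cost + 1
  | sub e f => e.cost + f.cost + 1
  | mul e f => e.cost + f.cost + 1
  | div e f => e.cost + f.cost + 1
  | log e => e.cost + 1
  | kernel e => e.cost + 1
  | loc u => u.cost + 1
  | lam => 1
  | p => 1
  | q => 1
  | κ => 1

end RExpr

/-- Programs. `setNat a i e` and `setReal a i e` write `e` into cell `i` of array `a`;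
`setFloor a i e` writes the integer part of the real number `e` (`0` if `e` is negative);
`ifNatLt e f c d` and `ifRealLt e f c d` run `c` if `e < f` and `d` otherwise; `loop a e c` runs
`c` for each of the values `0, …, e - 1` of the integer variable `a`, where `e` is evaluated once,
on entry. Thus every program halts on every input. -/
inductive Program : Type
  | skip
  | setNat (a : ℕ) (i e : NExpr)
  | setReal (a : ℕ) (i : NExpr) (e : RExpr)
  | setFloor (a : ℕ) (i : NExpr) (e : RExpr)
  | seq (c d : Program)
  | ifNatLt (e f : NExpr) (c d : Program)
  | ifRealLt (e f : RExpr) (c d : Program)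
  | loop (a : ℕ) (e : NExpr) (c : Program)

namespace Program

/-- Run a program: the resulting memory and the number of steps. Every operation takes one step,
except that the integer part of a real number takes as many additional steps as it has binary
digits (it can be found by repeated doubling and bisection). -/
def exec (I : Input) : Program → Memory → Memory × ℕ
  | skip, m => (m, 1)
  | setNat a i e, m => (m.setNat a (i.eval I m) (e.eval I m), i.cost + e.cost + 1)
  | setReal a i e, m => (m.setReal a (i.eval I m) (e.eval I m), i.cost + e.cost + 1)
  | setFloor a i e, m =>
      (m.setNat a (i.eval I m) ⌊e.eval I m⌋₊, i.cost + e.cost + 1 + Nat.size ⌊e.eval I m⌋₊)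
  | seq c d, m =>
      let r := c.exec I m
      let s := d.exec I r.1
      (s.1, r.2 + s.2)
  | ifNatLt e f c d, m =>
      let r := if e.eval I m < f.eval I m then c.exec I m else d.exec I m
      (r.1, e.cost + f.cost + 1 + r.2)
  | ifRealLt e f c d, m =>
      let r := open Classical in if e.eval I m < f.eval I m then c.exec I m else d.exec I m
      (r.1, e.cost + f.cost + 1 + r.2)
  | loop a e c, m =>
      (List.range (e.eval I m)).foldl
        (fun s k =>
          let r := c.exec I (s.1.setNat a 0 k)
          (r.1, s.2 + 1 + r.2))
        (m, e.cost + 1)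

/-- The number of steps on a given input. -/
def steps (P : Program) (I : Input) : ℕ := (P.exec I Memory.init).2

/-- The estimated community labels: at the end, cell `u` of integer array `0` is nonzero if the
label of node `u` is `+1`, and zero if it is `-1`. -/
def output (P : Program) (I : Input) : Fin I.N → ℤˣ :=
  fun u => if (P.exec I Memory.init).1.nat 0 u = 0 then -1 else 1

end Program

/-- The input that an algorithm receives on a sample. -/
def toInput (lam p q : ℝ) (φ : ℝ≥0 → unitInterval) (n : ℕ) (ω : Sample) : Input where
  n := n
  lam := lam
  p := p
  q := q
  κ := (interactionRange φ).toReal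
  φ := φ
  N := ω.N
  X := ω.X
  G := ω.G

/-- The algorithm `P` recovers the community structure exactly: with probability tending to one
its output is the vector of community labels, up to a global flip. -/
def RecoversExactly (P : Program) (lam p q : ℝ) (φ : ℝ≥0 → unitInterval) : Prop :=
  Tendsto (fun n : ℕ => law lam p q φ n
    {ω | P.output (toInput lam p q φ n ω) = ω.σ ∨ P.output (toInput lam p q φ n ω) = -ω.σ})
    atTop (𝓝 1)

/-- The algorithm `P` runs in linear time in the number of edges, and in time `O(n log n)`: for
some constant `C`, with probability tending to one, its number of steps is at most `C` times the
number of edges and at most `C * n * log n`. -/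
def RunsInLinearTime (P : Program) (lam p q : ℝ) (φ : ℝ≥0 → unitInterval) : Prop :=
  ∃ C : ℝ, Tendsto (fun n : ℕ => law lam p q φ n
    {ω | (P.steps (toInput lam p q φ n ω) : ℝ) ≤ C * ω.numEdges ∧
      (P.steps (toInput lam p q φ n ω) : ℝ) ≤ C * (n * Real.log n)})
    atTop (𝓝 1)

end GKBM

end

/-! The torus is cut into about `M n / log n` blocks, so that a block has length close to `1 / M` in
the units in which the kernel has range `κ`. Since `λκ > 1`, integers `M` and `K` exist with `1/λ <
K/M` and `(K+1)/M < κ` (`exists_block_constants`). The first inequality makes every window of `K`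
consecutive blocks contain at least `δ log n` nodes with high probability, by a Chernoff bound whose
exponent beats the number of windows. The second makes each node of a window, and of the next block,
lie within the range of all nodes of the window. The kernel may be small there, but it is positive
on `[0, κ]`, so the set where it is below `ε` has small measure, and no node has more than `δ log n
/ 4` partners at such distances.

All decisions are signs of scores `∑ f v * ℓ(u, v)`, where `ℓ` is the log-likelihood ratio of a
pair. Two facts about `ℓ` carry the proof. At the tilt `1/2`, its exponential moment is `1 - hell`,
whether the labels agree or not (`exp_llr_mean`), and `hell` integrates to half the information
metric. Its mean has the sign of the product of the two labels, with modulus at least `2 * hell`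
(`llr_mean_lower`).

Seeding: a node `u` of the first `K` blocks is compared with a fixed node `s` by `∑ ℓ(s, w) ℓ(u,
w)`. Links to `s` and to `u` are independent, so each term has a mean of sign `σ s σ u`, and order
`log n` terms separate the two cases. A union bound over the `O(log² n)` pairs suffices.

Propagation: each further block is labelled from the preceding `K` blocks. It cannot be free of
mistakes at this stage, but a block has at most `η log n` of them. The bad nodes are those whose
score with the true labels is small. For a given set of `η log n` nodes to be bad costs `exp(-c log²
n)`, whereas a block has only `exp(O(log n))` subsets. As badness refers to the true labels,
mistakes do not accumulate: a mistake in the window moves a score by at most `2C`, which is absorbed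
by the margin (`few_mistakes`).

Refinement: each node is relabelled from all nodes in its range. With true labels of the others its
score fails with probability about `n^(-λI)`, and there are order `n` nodes; here `λI > 1` is used
(`law_refine_le`). The mistakes of the propagation cost only a multiple of `η log n`, and `η` is
small.

The Poisson number of nodes makes the probability easy: a bound by a product over nodes integrates
to `z^N`, and summing over `N` gives `exp(λn(z-1))`. A sum over nodes of products over the others
gives `λn exp(λn(z-1))` (`law_le_of_prod`, `law_le_of_star`).

Running time: a block has `O(log n)` nodes, so a score takes `O(log n)` steps, and there are `O(n)`
scores. The number of edges is at least a multiple of `n log n` with high probability, by another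
Chernoff bound. -/

noncomputable section

namespace GKBM

/-! ### Expectations over random graphs with independent links -/

section RandomGraph

open Classical Finset

variable {N : ℕ}

/-- The increasing pairs of nodes. -/
def incPairs (N : ℕ) : Finset (Fin N × Fin N) := Finset.univ.filter fun e => e.1 < e.2

theorem prod_prod_Ioi_eq {M : Type*} [CommMonoid M] (f : Fin N → Fin N → M) :
    ∏ u : Fin N, ∏ v ∈ Finset.Ioi u, f u v = ∏ e ∈ incPairs N, f e.1 e.2 := by
  rw [Finset.prod_sigma']
  refine Finset.prod_bij' (fun x _ => (x.1, x.2)) (fun e _ => ⟨e.1, e.2⟩) ?_ ?_ ?_ ?_ ?_ <;>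
    simp [incPairs]

/-- A sum over graphs of a product over pairs of nodes factorises. -/
theorem sum_graph_prod (a b : Fin N → Fin N → ℝ) :
    ∑ G : SimpleGraph (Fin N), ∏ e ∈ incPairs N, (if G.Adj e.1 e.2 then a e.1 e.2 else b e.1 e.2) =
      ∏ e ∈ incPairs N, (a e.1 e.2 + b e.1 e.2) := by
  rw [Finset.prod_add]
  -- The expansion of the product of sums is indexed by sets of increasing pairs, that is, by edge
  -- sets.
  refine Finset.sum_bij' (fun G _ => (incPairs N).filter fun e => G.Adj e.1 e.2)
    (fun t _ => SimpleGraph.fromRel fun u v => u < v ∧ (u, v) ∈ t) ?_ ?_ ?_ ?_ ?_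
  · intro G _
    simp [Finset.filter_subset]
  · intro t _
    simp
  · intro G _
    ext u v
    simp only [SimpleGraph.fromRel_adj, Finset.mem_filter, incPairs, Finset.mem_univ, true_and]
    constructor
    · rintro ⟨_, ⟨_, _, h⟩ | ⟨_, _, h⟩⟩
      · exact h
      · exact h.symm
    · intro h
      refine ⟨h.ne, ?_⟩
      rcases lt_or_gt_of_ne h.ne with h' | h'
      · exact Or.inl ⟨h', h', h⟩
      · exact Or.inr ⟨h', h', h.symm⟩
  · intro t ht
    rw [Finset.mem_powerset] at ht
    ext ⟨u, v⟩
    simp only [SimpleGraph.fromRel_adj, Finset.mem_filter, incPairs, Finset.mem_univ, true_and]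
    constructor
    · rintro ⟨h, _, ⟨_, h2⟩ | ⟨h1, _⟩⟩
      · exact h2
      · exact absurd h1 (not_lt.mpr h.le)
    · intro h
      have h1 : u < v := by simpa [incPairs] using ht h
      exact ⟨h1, h1.ne, Or.inl ⟨h1, h⟩⟩
  · intro G _
    rw [Finset.prod_ite]
    congr 1
    refine Finset.prod_congr ?_ fun _ _ => rfl
    ext e
    simp +contextual [Finset.mem_sdiff, Finset.mem_filter]

/-- The probability of a graph whose links are independent, with probabilities `P u v`. -/
def indepGraphProb (P : Fin N → Fin N → ℝ) (G : SimpleGraph (Fin N)) : ℝ :=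
  ∏ e ∈ incPairs N, (if G.Adj e.1 e.2 then P e.1 e.2 else 1 - P e.1 e.2)

theorem indepGraphProb_nonneg {P : Fin N → Fin N → ℝ} (h0 : ∀ u v, 0 ≤ P u v)
    (h1 : ∀ u v, P u v ≤ 1) (G : SimpleGraph (Fin N)) : 0 ≤ indepGraphProb P G := by
  refine Finset.prod_nonneg fun e _ => ?_
  split_ifs
  · exact h0 _ _
  · linarith [h1 e.1 e.2]

/-- The expectation of a function of a random graph with independent links. -/
def graphExp (P : Fin N → Fin N → ℝ) (F : SimpleGraph (Fin N) → ℝ) : ℝ :=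
  ∑ G, indepGraphProb P G * F G

theorem graphExp_mono {P : Fin N → Fin N → ℝ} (h0 : ∀ u v, 0 ≤ P u v) (h1 : ∀ u v, P u v ≤ 1)
    {F F' : SimpleGraph (Fin N) → ℝ} (h : ∀ G, F G ≤ F' G) : graphExp P F ≤ graphExp P F' :=
  Finset.sum_le_sum fun G _ => mul_le_mul_of_nonneg_left (h G) (indepGraphProb_nonneg h0 h1 G)

theorem graphExp_mul_left (P : Fin N → Fin N → ℝ) (c : ℝ) (F : SimpleGraph (Fin N) → ℝ) :
    graphExp P (fun G => c * F G) = c * graphExp P F := by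
  simp only [graphExp, Finset.mul_sum]
  exact Finset.sum_congr rfl fun _ _ => by ring

theorem graphExp_sum {ι : Type*} (P : Fin N → Fin N → ℝ) (s : Finset ι)
    (F : ι → SimpleGraph (Fin N) → ℝ) :
    graphExp P (fun G => ∑ i ∈ s, F i G) = ∑ i ∈ s, graphExp P (F i) := by
  simp only [graphExp, Finset.mul_sum]
  exact Finset.sum_comm

/-- A set of ordered pairs of distinct nodes that contains each unordered pair at most once. -/
def Oriented (Q : Finset (Fin N × Fin N)) : Prop :=
  ∀ u v, (u, v) ∈ Q → u ≠ v ∧ (v, u) ∉ Q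

/-- Each pair in `Q` is charged to the increasing pair with the same ends. This is the form of
`indepGraphProb`, so that density and integrand can be merged factor by factor. -/
theorem prod_oriented {Q : Finset (Fin N × Fin N)} (hQ : Oriented Q)
    (f : Fin N → Fin N → ℝ) :
    ∏ e ∈ Q, f e.1 e.2 = ∏ e ∈ incPairs N, ((if (e.1, e.2) ∈ Q then f e.1 e.2 else 1) *
      (if (e.2, e.1) ∈ Q then f e.2 e.1 else 1)) := by
  rw [Finset.prod_mul_distrib, ← Finset.prod_filter, ← Finset.prod_filter,
    ← Finset.prod_filter_mul_prod_filter_not Q (fun e => e.1 < e.2)]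
  congr 1
  · refine Finset.prod_congr ?_ fun _ _ => rfl
    ext e
    simp [incPairs, and_comm]
  · refine Finset.prod_bij' (fun e _ => e.swap) (fun e _ => e.swap) ?_ ?_ ?_ ?_ ?_
    · rintro ⟨u, v⟩ h
      simp only [Finset.mem_filter, not_lt] at h
      simp only [incPairs, Finset.mem_filter, Finset.mem_univ, true_and, Prod.fst_swap,
        Prod.snd_swap]
      exact ⟨lt_of_le_of_ne h.2 (hQ u v h.1).1.symm, h.1⟩
    · rintro ⟨u, v⟩ h
      simp only [incPairs, Finset.mem_filter, Finset.mem_univ, true_and] at h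
      simp only [Finset.mem_filter, Prod.swap_prod_mk, not_lt]
      exact ⟨h.2, h.1.le⟩
    · simp
    · simp
    · simp

/-- Functions of distinct links are independent. -/
theorem graphExp_prod {P : Fin N → Fin N → ℝ} (hP : ∀ u v, P u v = P v u)
    {Q : Finset (Fin N × Fin N)} (hQ : Oriented Q) (a b : Fin N → Fin N → ℝ) :
    graphExp P (fun G => ∏ e ∈ Q, (if G.Adj e.1 e.2 then a e.1 e.2 else b e.1 e.2)) =
      ∏ e ∈ Q, (P e.1 e.2 * a e.1 e.2 + (1 - P e.1 e.2) * b e.1 e.2) := by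
  have key : ∀ G : SimpleGraph (Fin N), indepGraphProb P G *
      (∏ e ∈ Q, (if G.Adj e.1 e.2 then a e.1 e.2 else b e.1 e.2)) =
      ∏ e ∈ incPairs N, (if G.Adj e.1 e.2 then
        (P e.1 e.2 * ((if (e.1, e.2) ∈ Q then a e.1 e.2 else 1) *
          (if (e.2, e.1) ∈ Q then a e.2 e.1 else 1)))
        else ((1 - P e.1 e.2) * ((if (e.1, e.2) ∈ Q then b e.1 e.2 else 1) *
          (if (e.2, e.1) ∈ Q then b e.2 e.1 else 1)))) := by
    intro G
    rw [prod_oriented hQ (fun u v => if G.Adj u v then a u v else b u v), indepGraphProb,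
      ← Finset.prod_mul_distrib]
    refine Finset.prod_congr rfl fun e _ => ?_
    rw [G.adj_comm e.2 e.1]
    split_ifs <;> ring
  rw [graphExp, Finset.sum_congr rfl fun G _ => key G,
    sum_graph_prod (fun u v => P u v * ((if (u, v) ∈ Q then a u v else 1) *
          (if (v, u) ∈ Q then a v u else 1)))
      (fun u v => (1 - P u v) * ((if (u, v) ∈ Q then b u v else 1) *
          (if (v, u) ∈ Q then b v u else 1))),
    prod_oriented hQ (fun u v => P u v * a u v + (1 - P u v) * b u v)]
  refine Finset.prod_congr rfl fun e _ => ?_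
  have h1 := hQ e.1 e.2
  rw [hP e.2 e.1]
  by_cases h2 : (e.1, e.2) ∈ Q
  · simp [h2, (h1 h2).2]
  · by_cases h3 : (e.2, e.1) ∈ Q
    · simp [h2, h3]
    · simp [h2, h3]

theorem graphExp_one {P : Fin N → Fin N → ℝ} (hP : ∀ u v, P u v = P v u) :
    graphExp P (fun _ => 1) = 1 := by
  have := graphExp_prod hP (Q := ∅) (by intro u v h; simp at h) (fun _ _ => 1) (fun _ _ => 1)
  simpa using this

theorem graphExp_const {P : Fin N → Fin N → ℝ} (hP : ∀ u v, P u v = P v u) (c : ℝ) :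
    graphExp P (fun _ => c) = c := by
  have := graphExp_mul_left P c (fun _ => 1)
  simpa [graphExp_one hP] using this

/-- Functions of disjoint pairs of links are independent. -/
theorem graphExp_prod_pairs {P : Fin N → Fin N → ℝ} (hP : ∀ u v, P u v = P v u)
    {s u : Fin N} (hsu : s ≠ u) {W : Finset (Fin N)} (hs : s ∉ W) (hu : u ∉ W)
    (f : Fin N → Bool → Bool → ℝ) :
    graphExp P (fun G => ∏ w ∈ W, f w (decide (G.Adj s w)) (decide (G.Adj u w))) =
      ∏ w ∈ W, (P s w * (P u w * f w true true + (1 - P u w) * f w true false) +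
        (1 - P s w) * (P u w * f w false true + (1 - P u w) * f w false false)) := by
  have hQ : Oriented (({s, u} : Finset (Fin N)) ×ˢ W) := by
    intro a b h
    simp only [Finset.mem_product, Finset.mem_insert, Finset.mem_singleton] at h ⊢
    refine ⟨fun hab => ?_, fun hab => ?_⟩
    · rcases h with ⟨rfl | rfl, h⟩
      · exact hs (hab ▸ h)
      · exact hu (hab ▸ h)
    · rcases h with ⟨rfl | rfl, h⟩
      · exact hs hab.2
      · exact hu hab.2
  -- The set `T` is a guess of which `w` are linked to `s`. Once it is fixed, every factor depends
  -- on a single link and `graphExp_prod` applies; summing over `T` undoes the guess.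
  have expand : ∀ G : SimpleGraph (Fin N),
      ∏ w ∈ W, f w (decide (G.Adj s w)) (decide (G.Adj u w)) =
      ∑ T ∈ W.powerset, ∏ e ∈ ({s, u} : Finset (Fin N)) ×ˢ W,
        (if G.Adj e.1 e.2 then
          (if e.1 = s then (if e.2 ∈ T then 1 else 0) else f e.2 (decide (e.2 ∈ T)) true)
        else (if e.1 = s then (if e.2 ∈ T then 0 else 1) else f e.2 (decide (e.2 ∈ T)) false)) := by
    intro G
    have h1 : ∀ w ∈ W, f w (decide (G.Adj s w)) (decide (G.Adj u w)) =
        (if G.Adj s w then 1 else 0) * f w true (decide (G.Adj u w)) +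
        (if G.Adj s w then 0 else 1) * f w false (decide (G.Adj u w)) := by
      intro w _
      by_cases h : G.Adj s w <;> simp [h]
    rw [Finset.prod_congr rfl h1, Finset.prod_add]
    refine Finset.sum_congr rfl fun T hT => ?_
    rw [Finset.mem_powerset] at hT
    rw [Finset.prod_product, Finset.prod_pair hsu, ← Finset.prod_mul_distrib,
      ← Finset.prod_sdiff hT, mul_comm]
    congr 1
    · refine Finset.prod_congr rfl fun w hw => ?_
      have : w ∉ T := (Finset.mem_sdiff.mp hw).2
      by_cases h : G.Adj s w <;> by_cases h' : G.Adj u w <;> simp [h, h', this, hsu.symm]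
    · refine Finset.prod_congr rfl fun w hw => ?_
      by_cases h : G.Adj s w <;> by_cases h' : G.Adj u w <;> simp [h, h', hw, hsu.symm]
  simp_rw [expand]
  rw [graphExp_sum, Finset.prod_add]
  refine Finset.sum_congr rfl fun T hT => ?_
  rw [Finset.mem_powerset] at hT
  rw [graphExp_prod hP hQ (fun a w => if a = s then (if w ∈ T then 1 else 0)
      else f w (decide (w ∈ T)) true)
    (fun a w => if a = s then (if w ∈ T then 0 else 1) else f w (decide (w ∈ T)) false),
    Finset.prod_product, Finset.prod_pair hsu, ← Finset.prod_mul_distrib,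
    ← Finset.prod_sdiff hT, mul_comm]
  congr 1
  · refine Finset.prod_congr rfl fun w hw => ?_
    simp [hw, hsu.symm]
  · refine Finset.prod_congr rfl fun w hw => ?_
    have : w ∉ T := (Finset.mem_sdiff.mp hw).2
    simp [this, hsu.symm]

end RandomGraph

/-! ### Probabilities of events of the model -/

section Law

open Classical

/-- The uniform distribution on the torus. -/
def unif : Measure ℝ := volume.restrict torus

theorem measurableSet_torus : MeasurableSet torus := measurableSet_Ioc

instance : IsProbabilityMeasure unif :=
  ⟨by simp only [unif, torus, Measure.restrict_apply_univ, Real.volume_Ioc]; norm_num⟩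

theorem measurable_torusDist : Measurable fun z : ℝ × ℝ => torusDist z.1 z.2 := by
  unfold torusDist
  fun_prop

theorem psi_nonneg (φ : ℝ≥0 → unitInterval) (n : ℕ) (x y : ℝ) : 0 ≤ psi φ n x y := (φ _).2.1

theorem psi_le_one (φ : ℝ≥0 → unitInterval) (n : ℕ) (x y : ℝ) : psi φ n x y ≤ 1 := (φ _).2.2

theorem torusDist_comm (x y : ℝ) : torusDist x y = torusDist y x := by
  simp only [torusDist, abs_sub_comm]

theorem psi_comm (φ : ℝ≥0 → unitInterval) (n : ℕ) (x y : ℝ) : psi φ n x y = psi φ n y x := by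
  simp only [psi, torusDist_comm]

theorem measurable_psi {φ : ℝ≥0 → unitInterval} (hφ : Measurable φ) (n : ℕ) :
    Measurable fun z : ℝ × ℝ => psi φ n z.1 z.2 := by
  have := measurable_torusDist
  unfold psi
  fun_prop

section Link

variable {p q : ℝ} (φ : ℝ≥0 → unitInterval) (n : ℕ) {N : ℕ} (σ : Fin N → ℤˣ) (x : Fin N → ℝ)

theorem linkProb_comm (u v : Fin N) : linkProb p q φ n σ x u v = linkProb p q φ n σ x v u := by
  simp only [linkProb, psi_comm φ n (x u), eq_comm]

theorem linkProb_nonneg (hp : 0 ≤ p) (hq : 0 ≤ q) (u v : Fin N) :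
    0 ≤ linkProb p q φ n σ x u v := by
  unfold linkProb
  split_ifs
  · exact mul_nonneg hp (psi_nonneg ..)
  · exact mul_nonneg hq (psi_nonneg ..)

theorem linkProb_le_one (hp1 : p ≤ 1) (hq1 : q ≤ 1) (u v : Fin N) :
    linkProb p q φ n σ x u v ≤ 1 := by
  unfold linkProb
  split_ifs
  · exact mul_le_one₀ hp1 (psi_nonneg ..) (psi_le_one ..)
  · exact mul_le_one₀ hq1 (psi_nonneg ..) (psi_le_one ..)

theorem graphProb_eq (G : SimpleGraph (Fin N)) :
    graphProb p q φ n σ x G = indepGraphProb (linkProb p q φ n σ x) G := by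
  unfold graphProb indepGraphProb
  rw [← prod_prod_Ioi_eq fun u v =>
    if G.Adj u v then linkProb p q φ n σ x u v else 1 - linkProb p q φ n σ x u v]

end Link

theorem measurable_linkProb {p q : ℝ} {φ : ℝ≥0 → unitInterval} (hφ : Measurable φ) (n : ℕ) {N : ℕ}
    (σ : Fin N → ℤˣ) (u v : Fin N) : Measurable fun x => linkProb p q φ n σ x u v := by
  have : Measurable fun x : Fin N → ℝ => psi φ n (x u) (x v) :=
    (measurable_psi hφ n).comp (f := fun x : Fin N → ℝ => (x u, x v)) (by fun_prop)
  unfold linkProb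
  fun_prop

theorem measurable_graphProb {p q : ℝ} {φ : ℝ≥0 → unitInterval} (hφ : Measurable φ) (n : ℕ) {N : ℕ}
    (σ : Fin N → ℤˣ) (G : SimpleGraph (Fin N)) : Measurable fun x => graphProb p q φ n σ x G := by
  unfold graphProb
  refine Finset.measurable_fun_prod _ fun u _ => Finset.measurable_fun_prod _ fun v _ => ?_
  have := measurable_linkProb (p := p) (q := q) hφ n σ u v
  split_ifs <;> fun_prop

/-- The configurations as triples. -/
def configEquiv : Config ≃ Σ N : ℕ, (Fin N → ℤˣ) × SimpleGraph (Fin N) where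
  toFun c := ⟨c.N, c.σ, c.G⟩
  invFun c := ⟨c.1, c.2.1, c.2.2⟩
  left_inv _ := rfl
  right_inv _ := rfl

theorem measurableSet_sample_iff {S : Set Sample} :
    MeasurableSet S ↔ ∀ c : Config, MeasurableSet {x | (⟨c, x⟩ : Sample) ∈ S} := by
  rw [show (MeasurableSet S ↔ _) ↔ _ from Iff.rfl]
  exact MeasurableSpace.measurableSet_iInf

theorem measurable_sigmaMk (c : Config) :
    Measurable fun x : Fin c.N → ℝ => (⟨c, x⟩ : Sample) := fun _ hS =>
  measurableSet_sample_iff.1 hS c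

/-- The conditional probability of an event given the labels and the locations. -/
def condProb (p q : ℝ) (φ : ℝ≥0 → unitInterval) (n : ℕ) (S : Set Sample) (N : ℕ)
    (σ : Fin N → ℤˣ) (x : Fin N → ℝ) : ℝ :=
  graphExp (linkProb p q φ n σ x) fun G => if (⟨⟨N, σ, G⟩, x⟩ : Sample) ∈ S then 1 else 0

variable {lam p q : ℝ} {φ : ℝ≥0 → unitInterval} {n : ℕ}

/-- The probability of an event, by conditioning on the labels and the locations. -/
theorem law_apply (hφ : Measurable φ) (hp : 0 ≤ p) (hq : 0 ≤ q) (hp1 : p ≤ 1) (hq1 : q ≤ 1)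
    {S : Set Sample} (hS : MeasurableSet S) :
    law lam p q φ n S = ∑' N : ℕ, poissonMeasure (Real.toNNReal (lam * n)) {N} * (1 / 2) ^ N *
      ∑ σ : Fin N → ℤˣ, ∫⁻ x, ENNReal.ofReal (condProb p q φ n S N σ x)
        ∂(Measure.pi fun _ : Fin N => unif) := by
  rw [law, Measure.sum_apply _ hS]
  rw [← configEquiv.symm.tsum_eq, ENNReal.tsum_sigma']
  refine tsum_congr fun N => ?_
  rw [tsum_fintype, Fintype.sum_prod_type, Finset.mul_sum]
  refine Finset.sum_congr rfl fun σ _ => ?_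
  -- Lebesgue measure on the product of tori is the law of independent uniform locations.
  have hpi : (volume.restrict (Set.univ.pi fun _ : Fin N => torus)) =
      Measure.pi fun _ : Fin N => unif := by
    rw [volume_pi, Measure.restrict_pi_pi]
    rfl
  have hm : ∀ G : SimpleGraph (Fin N), MeasurableSet {x | (⟨⟨N, σ, G⟩, x⟩ : Sample) ∈ S} :=
    fun G => measurableSet_sample_iff.1 hS ⟨N, σ, G⟩
  have h1 : ∀ x : Fin N → ℝ, ENNReal.ofReal (condProb p q φ n S N σ x) =
      ∑ G : SimpleGraph (Fin N), {x | (⟨⟨N, σ, G⟩, x⟩ : Sample) ∈ S}.indicator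
        (fun x => ENNReal.ofReal (graphProb p q φ n σ x G)) x := by
    intro x
    rw [condProb, graphExp, ENNReal.ofReal_sum_of_nonneg]
    · refine Finset.sum_congr rfl fun G _ => ?_
      rw [Set.indicator_apply, graphProb_eq]
      by_cases h : (⟨⟨N, σ, G⟩, x⟩ : Sample) ∈ S <;> simp [h]
    · intro G _
      refine mul_nonneg (indepGraphProb_nonneg (linkProb_nonneg φ n σ x hp hq)
        (linkProb_le_one φ n σ x hp1 hq1) G) ?_
      split_ifs <;> norm_num
  simp_rw [h1]
  rw [lintegral_finsetSum _ fun G _ =>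
    ((measurable_graphProb hφ n σ G).ennreal_ofReal.indicator (hm G)), Finset.mul_sum]
  refine Finset.sum_congr rfl fun G _ => ?_
  change (Measure.map (fun x : Fin N → ℝ => (⟨⟨N, σ, G⟩, x⟩ : Sample))
    ((poissonMeasure (Real.toNNReal (lam * n)) {N} * (1 / 2) ^ N) •
      (volume.restrict (Set.univ.pi fun _ : Fin N => torus)).withDensity
        fun x => ENNReal.ofReal (graphProb p q φ n σ x G))) S = _
  rw [Measure.map_apply (measurable_sigmaMk ⟨N, σ, G⟩) hS, Measure.smul_apply, smul_eq_mul]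
  congr 1
  change (_ : Measure (Fin N → ℝ)).withDensity _ {x | (⟨⟨N, σ, G⟩, x⟩ : Sample) ∈ S} = _
  rw [withDensity_apply _ (hm G), hpi, lintegral_indicator (hm G)]

/-- The generating function of the Poisson law. With `N` independent nodes, a factor of mean `z` per
node becomes a single exponential. -/
theorem tsum_poisson_pow {r z : ℝ} (hr : 0 ≤ r) (hz : 0 ≤ z) :
    ∑' N : ℕ, poissonMeasure (Real.toNNReal r) {N} * ENNReal.ofReal z ^ N =
      ENNReal.ofReal (Real.exp (r * (z - 1))) := by
  have hs : HasSum (fun N : ℕ => Real.exp (-r) * r ^ N / N.factorial * z ^ N)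
      (Real.exp (r * (z - 1))) := by
    have := (NormedSpace.expSeries_div_hasSum_exp (r * z)).mul_left (Real.exp (-r))
    rw [← Real.exp_eq_exp_ℝ, ← Real.exp_add] at this
    convert! this using 1
    · ext N
      rw [mul_pow]
      ring
    · congr 1
      ring
  rw [← hs.tsum_eq, ENNReal.ofReal_tsum_of_nonneg (fun N => by positivity) hs.summable]
  refine tsum_congr fun N => ?_
  rw [poissonMeasure_singleton, Real.coe_toNNReal _ hr, ENNReal.ofReal_mul (by positivity),
    ENNReal.ofReal_pow hz]

/-- The factor `N` counts the choices of a distinguished node; cancelling it against the factorial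
shifts `N` by one and brings out `r`, so the other nodes are again Poisson (Mecke's formula). -/
theorem tsum_poisson_mul_pow {r z : ℝ} (hr : 0 ≤ r) (hz : 0 ≤ z) :
    ∑' N : ℕ, poissonMeasure (Real.toNNReal r) {N} * (N * ENNReal.ofReal z ^ (N - 1)) =
      ENNReal.ofReal (r * Real.exp (r * (z - 1))) := by
  rw [tsum_eq_zero_add' ENNReal.summable]
  rw [ENNReal.ofReal_mul hr, ← tsum_poisson_pow hr hz, ← ENNReal.tsum_mul_left]
  simp only [CharP.cast_eq_zero, zero_mul, mul_zero, zero_add]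
  refine tsum_congr fun N => ?_
  rw [poissonMeasure_singleton, poissonMeasure_singleton, Real.coe_toNNReal _ hr,
    Nat.add_sub_cancel, ← mul_assoc, ← mul_assoc]
  congr 1
  rw [← ENNReal.ofReal_natCast, ← ENNReal.ofReal_mul (by positivity), ← ENNReal.ofReal_mul hr]
  congr 1
  rw [Nat.factorial_succ]
  push_cast
  field_simp
  ring

/-- This lets a bound that is uniform in the labels survive the average over them. -/
theorem card_labels (N : ℕ) : (Fintype.card (Fin N → ℤˣ) : ℝ≥0∞) * (1 / 2) ^ N = 1 := by
  rw [Fintype.card_fun, Fintype.card_fin, show Fintype.card ℤˣ = 2 from rfl]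
  push_cast
  rw [← mul_pow, one_div, ENNReal.mul_inv_cancel (by norm_num) (by norm_num), one_pow]

theorem lintegral_pi_prod {μ : Measure ℝ} [IsProbabilityMeasure μ] {f : ℝ → ℝ≥0∞}
    (hf : Measurable f) (N : ℕ) :
    ∫⁻ x : Fin N → ℝ, ∏ i, f (x i) ∂(Measure.pi fun _ => μ) = (∫⁻ y, f y ∂μ) ^ N := by
  induction N with
  | zero => simp
  | succ N ih =>
    have hmp := (measurePreserving_piFinSuccAbove (fun _ : Fin (N + 1) => μ) 0).symm
    rw [← hmp.lintegral_comp_emb (MeasurableEquiv.measurableEmbedding _)]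
    have h1 : ∀ a : ℝ × (Fin N → ℝ),
        ∏ i, f ((MeasurableEquiv.piFinSuccAbove (fun _ : Fin (N + 1) => ℝ) 0).symm a i) =
        f a.1 * ∏ i, f (a.2 i) := fun a => Fin.prod_univ_succ _
    simp only [h1]
    rw [lintegral_prod_mul (f := f) (g := fun y : Fin N → ℝ => ∏ i, f (y i)) hf.aemeasurable
      (Finset.measurable_fun_prod _ fun i _ => hf.comp (measurable_pi_apply i)).aemeasurable, ih,
      pow_succ, mul_comm]

/-- Given the location of `u`, the other `N - 1` factors are independent and each integrates to at
most `z`. -/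
theorem lintegral_pi_star_le {f : ℝ → ℝ → ℝ≥0∞} (hf : Measurable (Function.uncurry f)) {z : ℝ≥0∞}
    (hz : ∀ x ∈ torus, ∫⁻ y, f x y ∂unif ≤ z) (N : ℕ) (u : Fin N) :
    ∫⁻ x : Fin N → ℝ, ∏ v ∈ Finset.univ.erase u, f (x u) (x v) ∂(Measure.pi fun _ => unif) ≤
      z ^ (N - 1) := by
  cases N with
  | zero => exact u.elim0
  | succ N =>
    have hmp := (measurePreserving_piFinSuccAbove (fun _ : Fin (N + 1) => unif) u).symm
    rw [← hmp.lintegral_comp_emb (MeasurableEquiv.measurableEmbedding _)]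
    have h1 : ∀ x : Fin (N + 1) → ℝ, ∏ v ∈ Finset.univ.erase u, f (x u) (x v) =
        ∏ i : Fin N, f (x u) (x (u.succAbove i)) := by
      intro x
      rw [← Finset.compl_singleton, ← Fin.image_succAbove_univ,
        Finset.prod_image fun a _ b _ h => Fin.succAbove_right_injective h]
    have h3 : ∀ a : ℝ × (Fin N → ℝ), ∏ v ∈ Finset.univ.erase u,
        f ((MeasurableEquiv.piFinSuccAbove (fun _ : Fin (N + 1) => ℝ) u).symm a u)
          ((MeasurableEquiv.piFinSuccAbove (fun _ : Fin (N + 1) => ℝ) u).symm a v) =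
        ∏ i, f a.1 (a.2 i) := by
      intro a
      rw [h1]
      simp [MeasurableEquiv.piFinSuccAbove_symm_apply]
    simp only [h3]
    have hm : Measurable fun z : ℝ × (Fin N → ℝ) => ∏ i, f z.1 (z.2 i) :=
      Finset.measurable_fun_prod _ fun i _ => hf.comp
        (measurable_fst.prodMk ((measurable_pi_apply i).comp measurable_snd))
    rw [lintegral_prod _ hm.aemeasurable]
    have h2 : ∀ x, ∫⁻ y : Fin N → ℝ, ∏ i, f x (y i) ∂(Measure.pi fun _ => unif) =
        (∫⁻ y, f x y ∂unif) ^ N := fun x =>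
      lintegral_pi_prod (f := f x) (hf.comp measurable_prodMk_left) N
    simp only [h2, Nat.add_sub_cancel]
    calc ∫⁻ x, (∫⁻ y, f x y ∂unif) ^ N ∂unif ≤ ∫⁻ _, z ^ N ∂unif := by
          refine setLIntegral_mono_ae measurable_const.aemeasurable (ae_of_all _ fun x hx => ?_)
          exact pow_le_pow_left' (hz x hx) N
      _ = z ^ N := by simp

theorem ae_mem_torus (N : ℕ) :
    ∀ᵐ x ∂(Measure.pi fun _ : Fin N => unif), ∀ i, x i ∈ torus := by
  rw [ae_all_iff]
  intro i
  have h : ∀ᵐ y ∂unif, y ∈ torus := ae_restrict_mem measurableSet_torus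
  exact (measurePreserving_eval (fun _ : Fin N => unif) i).quasiMeasurePreserving.ae h

/-- An upper bound from a bound of the conditional probabilities. -/
theorem law_le_tsum (hφ : Measurable φ) (hp : 0 ≤ p) (hq : 0 ≤ q) (hp1 : p ≤ 1) (hq1 : q ≤ 1)
    {S : Set Sample} (hS : MeasurableSet S) {b : (N : ℕ) → (Fin N → ℝ) → ℝ≥0∞}
    (hb : ∀ N σ (x : Fin N → ℝ), (∀ i, x i ∈ torus) →
      ENNReal.ofReal (condProb p q φ n S N σ x) ≤ b N x) :
    law lam p q φ n S ≤ ∑' N : ℕ, poissonMeasure (Real.toNNReal (lam * n)) {N} *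
      ∫⁻ x, b N x ∂(Measure.pi fun _ : Fin N => unif) := by
  rw [law_apply hφ hp hq hp1 hq1 hS]
  refine ENNReal.tsum_le_tsum fun N => ?_
  rw [mul_assoc]
  gcongr
  calc (1 / 2 : ℝ≥0∞) ^ N * ∑ σ : Fin N → ℤˣ, ∫⁻ x, ENNReal.ofReal (condProb p q φ n S N σ x)
        ∂(Measure.pi fun _ : Fin N => unif)
      ≤ (1 / 2 : ℝ≥0∞) ^ N * ∑ σ : Fin N → ℤˣ, ∫⁻ x, b N x
        ∂(Measure.pi fun _ : Fin N => unif) := by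
        refine mul_le_mul_right (Finset.sum_le_sum fun σ _ => ?_) _
        exact lintegral_mono_ae ((ae_mem_torus N).mono fun x hx => hb N σ x hx)
    _ = (Fintype.card (Fin N → ℤˣ) : ℝ≥0∞) * (1 / 2) ^ N *
        ∫⁻ x, b N x ∂(Measure.pi fun _ : Fin N => unif) := by
        rw [Finset.sum_const, Finset.card_univ, nsmul_eq_mul]
        ring
    _ = _ := by rw [card_labels, one_mul]

theorem law_univ (hφ : Measurable φ) (hp : 0 ≤ p) (hq : 0 ≤ q) (hp1 : p ≤ 1) (hq1 : q ≤ 1) :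
    law lam p q φ n Set.univ = 1 := by
  rw [law_apply hφ hp hq hp1 hq1 MeasurableSet.univ]
  have h : ∀ N (σ : Fin N → ℤˣ) (x : Fin N → ℝ), condProb p q φ n Set.univ N σ x = 1 := by
    intro N σ x
    simp [condProb, graphExp_one (linkProb_comm φ n σ x)]
  simp only [h, ENNReal.ofReal_one, lintegral_const, measure_univ, mul_one, Finset.sum_const,
    Finset.card_univ, nsmul_eq_mul]
  calc _ = ∑' N : ℕ, poissonMeasure (Real.toNNReal (lam * n)) {N} := by
        refine tsum_congr fun N => ?_
        rw [mul_assoc, mul_comm ((1 / 2 : ℝ≥0∞) ^ N), card_labels, mul_one]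
    _ = 1 := by
        have := Measure.tsum_indicator_apply_singleton (poissonMeasure (Real.toNNReal (lam * n)))
          Set.univ MeasurableSet.univ
        simpa using this

/-- The Poisson weights sum to one, which is the generating function at `z = 1`. -/
theorem law_le_of_condProb_le (hφ : Measurable φ) (hp : 0 ≤ p) (hq : 0 ≤ q) (hp1 : p ≤ 1)
    (hq1 : q ≤ 1) (hlam : 0 ≤ lam) {S : Set Sample} (hS : MeasurableSet S) {β : ℝ}
    (hb : ∀ N σ (x : Fin N → ℝ), (∀ i, x i ∈ torus) → condProb p q φ n S N σ x ≤ β) :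
    law lam p q φ n S ≤ ENNReal.ofReal β := by
  refine (law_le_tsum hφ hp hq hp1 hq1 hS (b := fun _ _ => ENNReal.ofReal β)
    fun N σ x hx => ENNReal.ofReal_le_ofReal (hb N σ x hx)).trans ?_
  simp only [lintegral_const, measure_univ, mul_one]
  rw [ENNReal.tsum_mul_right]
  have := tsum_poisson_pow (r := lam * n) (z := 1) (by positivity) zero_le_one
  simp only [ENNReal.ofReal_one, one_pow, mul_one, sub_self, mul_zero, Real.exp_zero] at this
  rw [this, one_mul]

/-- A bound for events whose conditional probability is bounded by a product over the nodes. -/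
theorem law_le_of_prod (hφ : Measurable φ) (hp : 0 ≤ p) (hq : 0 ≤ q) (hp1 : p ≤ 1)
    (hq1 : q ≤ 1) (hlam : 0 ≤ lam) {S : Set Sample} (hS : MeasurableSet S) {c z : ℝ} (hc : 0 ≤ c)
    (hz : 0 ≤ z) {f : ℝ → ℝ} (hf : Measurable f) (hf0 : ∀ y, 0 ≤ f y)
    (hfz : ∫⁻ y, ENNReal.ofReal (f y) ∂unif ≤ ENNReal.ofReal z)
    (hb : ∀ N σ (x : Fin N → ℝ), (∀ i, x i ∈ torus) →
      condProb p q φ n S N σ x ≤ c * ∏ v, f (x v)) :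
    law lam p q φ n S ≤ ENNReal.ofReal (c * Real.exp (lam * n * (z - 1))) := by
  refine (law_le_tsum hφ hp hq hp1 hq1 hS
    (b := fun N x => ENNReal.ofReal c * ∏ v, ENNReal.ofReal (f (x v))) ?_).trans ?_
  · intro N σ x hx
    rw [← ENNReal.ofReal_prod_of_nonneg fun v _ => hf0 _, ← ENNReal.ofReal_mul hc]
    exact ENNReal.ofReal_le_ofReal (hb N σ x hx)
  · rw [ENNReal.ofReal_mul hc, ← tsum_poisson_pow (by positivity) hz, ← ENNReal.tsum_mul_left]
    refine ENNReal.tsum_le_tsum fun N => ?_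
    have hm : Measurable fun x : Fin N → ℝ => ∏ v, ENNReal.ofReal (f (x v)) := by fun_prop
    rw [lintegral_const_mul _ hm, lintegral_pi_prod (f := fun y => ENNReal.ofReal (f y))
      hf.ennreal_ofReal, mul_left_comm]
    gcongr

/-- A bound for events whose conditional probability is bounded by a sum over the nodes of
products over the other nodes. -/
theorem law_le_of_star (hφ : Measurable φ) (hp : 0 ≤ p) (hq : 0 ≤ q) (hp1 : p ≤ 1)
    (hq1 : q ≤ 1) (hlam : 0 ≤ lam) {S : Set Sample} (hS : MeasurableSet S) {c z : ℝ} (hc : 0 ≤ c)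
    (hz : 0 ≤ z) {f : ℝ → ℝ → ℝ} (hf : Measurable (Function.uncurry f)) (hf0 : ∀ x y, 0 ≤ f x y)
    (hfz : ∀ x ∈ torus, ∫⁻ y, ENNReal.ofReal (f x y) ∂unif ≤ ENNReal.ofReal z)
    (hb : ∀ N σ (x : Fin N → ℝ), (∀ i, x i ∈ torus) →
      condProb p q φ n S N σ x ≤ ∑ u, c * ∏ v ∈ Finset.univ.erase u, f (x u) (x v)) :
    law lam p q φ n S ≤ ENNReal.ofReal (c * (lam * n * Real.exp (lam * n * (z - 1)))) := by
  refine (law_le_tsum hφ hp hq hp1 hq1 hS (b := fun N x => ∑ u,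
    ENNReal.ofReal c * ∏ v ∈ Finset.univ.erase u, ENNReal.ofReal (f (x u) (x v))) ?_).trans ?_
  · intro N σ x hx
    refine (ENNReal.ofReal_le_ofReal (hb N σ x hx)).trans ?_
    rw [ENNReal.ofReal_sum_of_nonneg fun u _ => mul_nonneg hc (Finset.prod_nonneg fun v _ =>
      hf0 _ _)]
    refine Finset.sum_le_sum fun u _ => ?_
    rw [ENNReal.ofReal_mul hc, ENNReal.ofReal_prod_of_nonneg fun v _ => hf0 _ _]
  · rw [ENNReal.ofReal_mul hc, ← tsum_poisson_mul_pow (by positivity) hz, ← ENNReal.tsum_mul_left]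
    refine ENNReal.tsum_le_tsum fun N => ?_
    have hm : ∀ u : Fin N, Measurable fun x : Fin N → ℝ =>
        ∏ v ∈ Finset.univ.erase u, ENNReal.ofReal (f (x u) (x v)) := fun u =>
      Finset.measurable_fun_prod _ fun i _ =>
        (hf.comp (f := fun x : Fin N → ℝ => (x u, x i)) (by fun_prop)).ennreal_ofReal
    rw [lintegral_finsetSum _ fun u _ => (hm u).const_mul _, mul_left_comm]
    gcongr
    calc ∑ u : Fin N, ∫⁻ x, ENNReal.ofReal c *
          ∏ v ∈ Finset.univ.erase u, ENNReal.ofReal (f (x u) (x v)) ∂(Measure.pi fun _ => unif)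
        ≤ ∑ u : Fin N, ENNReal.ofReal c * ENNReal.ofReal z ^ (N - 1) := by
          refine Finset.sum_le_sum fun u _ => ?_
          rw [lintegral_const_mul _ (hm u)]
          gcongr
          exact lintegral_pi_star_le (f := fun x y => ENNReal.ofReal (f x y)) hf.ennreal_ofReal
            hfz N u
      _ = ENNReal.ofReal c * (N * ENNReal.ofReal z ^ (N - 1)) := by
          rw [Finset.sum_const, Finset.card_univ, Fintype.card_fin, nsmul_eq_mul]
          ring

end Law

/-! ### Integration over the torus -/

section TorusIntegral

/-- On the torus the distance is a `1`-periodic function of `y - x`, which gives access to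
translation invariance. -/
theorem torusDist_eq_abs_sub_round {x y : ℝ} (hx : x ∈ torus) (hy : y ∈ torus) :
    torusDist x y = |y - x - round (y - x)| := by
  obtain ⟨hx1, hx2⟩ := hx
  obtain ⟨hy1, hy2⟩ := hy
  rw [abs_sub_round_eq_min, torusDist, abs_sub_comm]
  rcases le_or_gt 0 (y - x) with h | h
  · rw [abs_of_nonneg h, Int.fract_eq_self.2 ⟨h, by linarith⟩]
  · have : Int.fract (y - x) = y - x + 1 := by
      rw [← Int.fract_add_one, Int.fract_eq_self.2 ⟨by linarith, by linarith⟩]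
    rw [abs_of_neg h, this, min_comm]
    congr 1 <;> ring

/-- Periodicity moves `x` to `0`. As `κ / a < 1/2`, the function `h (a * |·|)` vanishes outside half
a period on either side, so the integral over a period is that over the line, and symmetry gives the
factor `2`. -/
theorem integral_torusDist {h : ℝ → ℝ} {κ a x : ℝ} (ha : 0 < a) (hκ : κ / a < 1 / 2)
    (hh : ∀ t, κ < t → h t = 0) (hx : x ∈ torus) :
    ∫ y, h (a * torusDist x y) ∂unif = 2 / a * ∫ t in Set.Ici (0 : ℝ), h t := by
  set H : ℝ → ℝ := fun t => h (a * |t - round t|) with hH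
  have hper : Function.Periodic H 1 := by
    intro t
    simp [hH, round_add_one]
  have h1 : ∫ y, h (a * torusDist x y) ∂unif = ∫ y in (-(1 / 2) : ℝ)..(1 / 2), H (y - x) := by
    rw [intervalIntegral.integral_of_le (by norm_num)]
    refine setIntegral_congr_fun measurableSet_torus fun y hy => ?_
    simp only [hH, torusDist_eq_abs_sub_round hx hy]
  have h2 : ∫ y in (-(1 / 2) : ℝ)..(1 / 2), H (y - x) = ∫ y in (-(1 / 2) : ℝ)..(1 / 2), H y := by
    rw [intervalIntegral.integral_comp_sub_right]
    have := hper.intervalIntegral_add_eq (-(1 / 2) - x) (-(1 / 2))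
    rw [show -(1 / 2) - x + 1 = 1 / 2 - x by ring, show (-(1 / 2) : ℝ) + 1 = 1 / 2 by norm_num]
      at this
    exact this
  have h3 : ∫ y in (-(1 / 2) : ℝ)..(1 / 2), H y = ∫ y, h (a * |y|) := by
    rw [intervalIntegral.integral_of_le (by norm_num), integral_Ioc_eq_integral_Ioo,
      ← setIntegral_eq_integral_of_forall_compl_eq_zero (s := Set.Ioo (-(1 / 2) : ℝ) (1 / 2))
        (f := fun y => h (a * |y|))]
    · refine setIntegral_congr_fun measurableSet_Ioo fun y hy => ?_
      have : round y = 0 := by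
        rw [round_eq_zero_iff]
        exact ⟨hy.1.le, hy.2⟩
      simp [hH, this]
    · intro y hy
      apply hh
      have : 1 / 2 ≤ |y| := by
        by_contra hlt
        exact hy (abs_lt.1 (not_le.1 hlt))
      rw [div_lt_iff₀ ha] at hκ
      nlinarith
  rw [h1, h2, h3, integral_comp_abs (f := fun t => h (a * t)), integral_comp_mul_left_Ioi _ _ ha,
    mul_zero, integral_Ici_eq_integral_Ioi, smul_eq_mul]
  ring

/-- The form `1 + k` is that of an exponential moment per node: `k` is `-hell` for the scores and
`exp θ - 1` times an indicator for counts of nodes. -/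
theorem lintegral_one_add_torusDist {k : ℝ → ℝ} (hk : Measurable k) {C : ℝ} (hC : ∀ t, |k t| ≤ C)
    (hk1 : ∀ t, 0 ≤ 1 + k t) {κ a x : ℝ} (ha : 0 < a) (hκ : κ / a < 1 / 2)
    (hh : ∀ t, κ < t → k t = 0) (hx : x ∈ torus) :
    ∫⁻ y, ENNReal.ofReal (1 + k (a * torusDist x y)) ∂unif =
      ENNReal.ofReal (1 + 2 / a * ∫ t in Set.Ici (0 : ℝ), k t) := by
  have hm : Measurable fun y => k (a * torusDist x y) :=
    hk.comp ((measurable_torusDist.comp measurable_prodMk_left).const_mul a)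
  have hintf : Integrable (fun y => k (a * torusDist x y)) unif :=
    Integrable.of_bound hm.aestronglyMeasurable C (ae_of_all _ fun y => hC _)
  have hintf' : Integrable (fun y => 1 + k (a * torusDist x y)) unif :=
    (integrable_const 1).add hintf
  rw [← integral_torusDist ha hκ hh hx, ← ofReal_integral_eq_lintegral_ofReal
    hintf' (ae_of_all _ fun y => hk1 _), integral_add (integrable_const 1) hintf]
  simp

end TorusIntegral

/-! ### Likelihood ratios -/

section Likelihood

/-- The integrand of the information metric, as a function of the value of the kernel. -/
def hell (p q s : ℝ) : ℝ := 1 - √(p * q) * s - √((1 - p * s) * (1 - q * s))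

/-- The logarithm of the likelihood ratio of a link at kernel value `s`. -/
def llr (p q s : ℝ) (b : Bool) : ℝ :=
  if b then Real.log (p / q) else Real.log ((1 - p * s) / (1 - q * s))

/-- A bound for the log-likelihood ratios. -/
def llrBound (p q : ℝ) : ℝ := Real.log (p / q) - Real.log (1 - p)

variable {p q : ℝ}

/-- The tilt by `-1/2` replaces a probability `a` by the geometric mean of `a` and `b`; the next
lemma is the case in which `b` is the true probability. -/
theorem mul_exp_neg_half_log {a b : ℝ} (ha : 0 < a) (hb : 0 < b) :
    a * Real.exp (-(1 / 2) * Real.log (a / b)) = √(a * b) := by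
  rw [Real.sqrt_eq_rpow, Real.rpow_def_of_pos (mul_pos ha hb), Real.log_mul ha.ne' hb.ne',
    Real.log_div ha.ne' hb.ne']
  nth_rewrite 1 [← Real.exp_log ha]
  rw [← Real.exp_add]
  congr 1
  ring

theorem mul_exp_half_log {a b : ℝ} (ha : 0 < a) (hb : 0 < b) :
    b * Real.exp (1 / 2 * Real.log (a / b)) = √(a * b) := by
  rw [mul_comm a b, ← mul_exp_neg_half_log hb ha, ← inv_div b a, Real.log_inv]
  congr 2
  ring

theorem hell_zero : hell p q 0 = 0 := by simp [hell]

/-- Completing squares, `hell` is `1/2 (√p - √q)² s + 1/2 (√(1 - ps) - √(1 - qs))²`, and the second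
term is dropped. -/
theorem hell_lower (hq : 0 < q) (hqp : q < p) (hp : p < 1) {s : ℝ} (hs1 : s ≤ 1) :
    1 / 2 * (√p - √q) ^ 2 * s ≤ hell p q s := by
  have h1 : (0 : ℝ) ≤ 1 - p * s := by nlinarith
  have h2 : (0 : ℝ) ≤ 1 - q * s := by nlinarith
  have e1 := Real.sq_sqrt (hq.trans hqp).le
  have e2 := Real.sq_sqrt hq.le
  have e3 := Real.sq_sqrt h1
  have e4 := Real.sq_sqrt h2
  rw [hell, Real.sqrt_mul (hq.trans hqp).le, Real.sqrt_mul h1]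
  nlinarith [sq_nonneg (√(1 - p * s) - √(1 - q * s))]

theorem hell_nonneg (hq : 0 < q) (hqp : q < p) (hp : p < 1) {s : ℝ} (hs0 : 0 ≤ s) (hs1 : s ≤ 1) :
    0 ≤ hell p q s :=
  (by positivity : 0 ≤ 1 / 2 * (√p - √q) ^ 2 * s).trans (hell_lower hq hqp hp hs1)

theorem hell_le_one {s : ℝ} (hs0 : 0 ≤ s) : hell p q s ≤ 1 := by
  have : 0 ≤ √(p * q) * s := mul_nonneg (Real.sqrt_nonneg _) hs0
  have := Real.sqrt_nonneg ((1 - p * s) * (1 - q * s))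
  rw [hell]
  linarith

theorem llrBound_pos (hq : 0 < q) (hqp : q < p) (hp : p < 1) : 0 < llrBound p q := by
  have h1 : 0 < Real.log (p / q) := Real.log_pos ((one_lt_div hq).2 hqp)
  have h2 : Real.log (1 - p) ≤ 0 := Real.log_nonpos (by linarith) (by linarith)
  unfold llrBound
  linarith

/-- A link contributes `log (p / q)`; a missing link contributes something between `log (1 - p)` and
`0`, because `(1 - p s) / (1 - q s) ≥ 1 - p`. This is where `p < 1` keeps the scores bounded. -/
theorem abs_llr_le (hq : 0 < q) (hqp : q < p) (hp : p < 1) {s : ℝ} (hs0 : 0 ≤ s) (hs1 : s ≤ 1)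
    (b : Bool) : |llr p q s b| ≤ llrBound p q := by
  have h1 : 0 < Real.log (p / q) := Real.log_pos ((one_lt_div hq).2 hqp)
  have h2 : Real.log (1 - p) ≤ 0 := Real.log_nonpos (by linarith) (by linarith)
  have h3 : (1 - p) ≤ 1 - p * s := by nlinarith
  have h4 : 0 < 1 - q * s := by nlinarith
  have h5 : 1 - q * s ≤ 1 := by nlinarith
  have h6 : 1 - p * s ≤ 1 - q * s := by nlinarith
  unfold llrBound llr
  cases b
  · have h7 : Real.log ((1 - p * s) / (1 - q * s)) ≤ 0 :=
      Real.log_nonpos (div_nonneg (by linarith) h4.le) ((div_le_one h4).2 h6)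
    have h8 : Real.log (1 - p) ≤ Real.log ((1 - p * s) / (1 - q * s)) := by
      refine Real.log_le_log (by linarith) ?_
      rw [le_div_iff₀ h4]
      nlinarith
    simp only [Bool.false_eq_true, if_false]
    rw [abs_of_nonpos h7]
    linarith
  · simp only [if_true]
    rw [abs_of_pos h1]
    linarith

theorem llr_false_neg (hq : 0 < q) (hqp : q < p) (hp : p < 1) {s : ℝ} (hs0 : 0 < s) (hs1 : s ≤ 1) :
    llr p q s false < 0 := by
  have h3 : 0 < 1 - p * s := by nlinarith
  have h6 : 1 - p * s < 1 - q * s := by nlinarith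
  simp only [llr, Bool.false_eq_true, if_false]
  exact Real.log_neg (div_pos h3 (h3.trans h6)) ((div_lt_one (h3.trans h6)).2 h6)

theorem llr_zero_false : llr p q 0 false = 0 := by simp [llr]

/-- The probability of a link at kernel value `s` between nodes with labels `a` and `b`. -/
def pairProb (p q s : ℝ) (a b : ℤˣ) : ℝ := (if a = b then p else q) * s

theorem units_mul_eq (a b : ℤˣ) : (((a * b : ℤˣ) : ℤ) : ℝ) = if a = b then 1 else -1 := by
  rcases Int.units_eq_one_or a with rfl | rfl <;> rcases Int.units_eq_one_or b with rfl | rfl <;>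
    norm_num [units_ne_neg_self, neg_units_ne_self]

/-- At the tilt `1/2` equal and different labels lead to the same sum `√(pq) s + √((1 - ps)(1 -
qs))`, so the Chernoff bound for a score does not depend on the labels. -/
theorem exp_llr_mean (hq : 0 < q) (hqp : q < p) (hp : p < 1) {s : ℝ} (hs1 : s ≤ 1)
    (a b : ℤˣ) :
    pairProb p q s a b * Real.exp (-(1 / 2) * (((a * b : ℤˣ) : ℤ) * llr p q s true)) +
      (1 - pairProb p q s a b) * Real.exp (-(1 / 2) * (((a * b : ℤˣ) : ℤ) * llr p q s false)) =
      1 - hell p q s := by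
  have h3 : 0 < 1 - p * s := by nlinarith
  have h4 : 0 < 1 - q * s := by nlinarith
  rw [units_mul_eq]
  simp only [pairProb, llr, if_true, Bool.false_eq_true, if_false]
  split_ifs with h
  · rw [one_mul, one_mul, mul_right_comm, mul_exp_neg_half_log (hq.trans hqp) hq,
      mul_exp_neg_half_log h3 h4, hell]
    ring
  · rw [show ∀ y : ℝ, -(1 / 2) * (-1 * y) = 1 / 2 * y by intro y; ring,
      show ∀ y : ℝ, -(1 / 2) * (-1 * y) = 1 / 2 * y by intro y; ring, mul_right_comm,
      mul_exp_half_log (hq.trans hqp) hq, mul_exp_half_log h3 h4, hell]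
    ring

theorem pairProb_nonneg (hq : 0 < q) (hqp : q < p) {s : ℝ} (hs0 : 0 ≤ s) (a b : ℤˣ) :
    0 ≤ pairProb p q s a b := by
  unfold pairProb
  split_ifs <;> nlinarith

theorem pairProb_le_one (hq : 0 < q) (hqp : q < p) (hp : p < 1) {s : ℝ} (hs1 : s ≤ 1)
    (a b : ℤˣ) : pairProb p q s a b ≤ 1 := by
  unfold pairProb
  split_ifs <;> nlinarith

theorem le_pairProb (hqp : q < p) {s : ℝ} (hs0 : 0 ≤ s) (a b : ℤˣ) :
    q * s ≤ pairProb p q s a b := by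
  unfold pairProb
  split_ifs <;> nlinarith

/-- If `Y` is the signed log-likelihood ratio, then `1 - hell = E exp(-Y/2) ≥ 1 - E Y / 2`. -/
theorem llr_mean_lower (hq : 0 < q) (hqp : q < p) (hp : p < 1) {s : ℝ} (hs0 : 0 ≤ s) (hs1 : s ≤ 1)
    (a b : ℤˣ) :
    2 * hell p q s ≤ ((a * b : ℤˣ) : ℤ) * (pairProb p q s a b * llr p q s true +
      (1 - pairProb p q s a b) * llr p q s false) := by
  have h := exp_llr_mean hq hqp hp hs1 a b
  have h0 := pairProb_nonneg hq hqp hs0 a b (p := p)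
  have h1 := pairProb_le_one hq hqp hp hs1 a b
  have e1 := mul_le_mul_of_nonneg_left
    (Real.add_one_le_exp (-(1 / 2) * (((a * b : ℤˣ) : ℤ) * llr p q s true))) h0
  have e2 := mul_le_mul_of_nonneg_left
    (Real.add_one_le_exp (-(1 / 2) * (((a * b : ℤˣ) : ℤ) * llr p q s false))) (sub_nonneg.2 h1)
  nlinarith

theorem exp_le_quadratic {y : ℝ} (hy : |y| ≤ 1) : Real.exp y ≤ 1 + y + y ^ 2 := by
  have := Real.abs_exp_sub_one_sub_id_le hy
  have := (abs_le.1 this).2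
  linarith

/-- An exponential moment bound for the product of two independent two-valued variables. -/
theorem exp_product_le {P Q a₁ a₀ b₁ b₀ C θ τ : ℝ} (hP0 : 0 ≤ P) (hP1 : P ≤ 1) (hQ0 : 0 ≤ Q)
    (hQ1 : Q ≤ 1) (ha₁ : |a₁| ≤ C) (ha₀ : |a₀| ≤ C) (hb₁ : |b₁| ≤ C) (hb₀ : |b₀| ≤ C)
    (hθ : 0 ≤ θ) (hθC : θ * C ^ 2 ≤ 1) (hτ : |τ| = 1) :
    P * (Q * Real.exp (-θ * (τ * (a₁ * b₁))) + (1 - Q) * Real.exp (-θ * (τ * (a₁ * b₀)))) +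
      (1 - P) * (Q * Real.exp (-θ * (τ * (a₀ * b₁))) + (1 - Q) * Real.exp (-θ * (τ * (a₀ * b₀)))) ≤
      Real.exp (-θ * (τ * ((P * a₁ + (1 - P) * a₀) * (Q * b₁ + (1 - Q) * b₀))) +
        θ ^ 2 * C ^ 4) := by
  -- Second-order expansion, valid since `|θ a b| ≤ θ C² ≤ 1`. After averaging, the linear term is
  -- the product of the two means, by independence.
  have key : ∀ a b : ℝ, |a| ≤ C → |b| ≤ C →
      Real.exp (-θ * (τ * (a * b))) ≤ 1 + -θ * (τ * (a * b)) + θ ^ 2 * C ^ 4 := by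
    intro a b ha hb
    have habs : |(-θ) * (τ * (a * b))| ≤ θ * C ^ 2 := by
      rw [abs_mul, abs_mul, abs_mul, hτ, abs_neg, abs_of_nonneg hθ, one_mul, pow_two]
      gcongr
      exact (abs_nonneg a).trans ha
    refine (exp_le_quadratic (habs.trans hθC)).trans ?_
    have : (-θ * (τ * (a * b))) ^ 2 ≤ (θ * C ^ 2) ^ 2 := by
      rw [← sq_abs]
      gcongr
    nlinarith
  have hP1' := sub_nonneg.2 hP1
  have hQ1' := sub_nonneg.2 hQ1
  calc _ ≤ P * (Q * (1 + -θ * (τ * (a₁ * b₁)) + θ ^ 2 * C ^ 4) +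
        (1 - Q) * (1 + -θ * (τ * (a₁ * b₀)) + θ ^ 2 * C ^ 4)) +
      (1 - P) * (Q * (1 + -θ * (τ * (a₀ * b₁)) + θ ^ 2 * C ^ 4) +
        (1 - Q) * (1 + -θ * (τ * (a₀ * b₀)) + θ ^ 2 * C ^ 4)) := by
        gcongr
        · exact key _ _ ha₁ hb₁
        · exact key _ _ ha₁ hb₀
        · exact key _ _ ha₀ hb₁
        · exact key _ _ ha₀ hb₀
    _ = (-θ * (τ * ((P * a₁ + (1 - P) * a₀) * (Q * b₁ + (1 - Q) * b₀))) + θ ^ 2 * C ^ 4) + 1 := by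
        ring
    _ ≤ _ := Real.add_one_le_exp _

end Likelihood

/-! ### The range of the kernel -/

section Kernel

variable {φ : ℝ≥0 → unitInterval}

theorem kernel_eq_zero (hκ_fin : interactionRange φ < ⊤) {t : ℝ}
    (ht : (interactionRange φ).toReal < t) : φ t.toNNReal = 0 := by
  by_contra h
  have h1 : ((t.toNNReal : ℝ≥0) : ℝ≥0∞) ≤ interactionRange φ := le_sSup ⟨_, h, rfl⟩
  have h2 := ENNReal.toReal_mono hκ_fin.ne h1
  rw [ENNReal.coe_toReal, Real.coe_toNNReal _ (ENNReal.toReal_nonneg.trans ht.le)] at h2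
  linarith

theorem kernel_pos (hκ_fin : interactionRange φ < ⊤)
    (hφ_pos : ∀ x : ℝ≥0, (x : ℝ≥0∞) ≤ interactionRange φ → 0 < φ x) {t : ℝ}
    (ht : t ≤ (interactionRange φ).toReal) : 0 < φ t.toNNReal := by
  apply hφ_pos
  rw [← ENNReal.ofReal_toReal hκ_fin.ne]
  exact ENNReal.ofReal_le_ofReal ht

/-- The indicator of the set where the kernel is positive but less than `ε`. -/
def lowKernel (φ : ℝ≥0 → unitInterval) (ε t : ℝ) : ℝ :=
  ({t | t ≤ (interactionRange φ).toReal ∧ (φ t.toNNReal : ℝ) < ε} : Set ℝ).indicator 1 t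

theorem measurableSet_lowKernel (hφ : Measurable φ) (ε : ℝ) :
    MeasurableSet {t | t ≤ (interactionRange φ).toReal ∧ (φ t.toNNReal : ℝ) < ε} := by
  have h : Measurable fun t : ℝ => (φ t.toNNReal : ℝ) := by fun_prop
  exact (measurableSet_le measurable_id measurable_const).inter
    (measurableSet_lt h measurable_const)

/-- The sets where the kernel is below `1 / (k + 1)` decrease, have finite measure, and have empty
intersection since the kernel is positive on all of `[0, κ]`; their measures therefore tend to zero.
-/
theorem exists_integral_lowKernel_lt (hφ : Measurable φ) (hκ_fin : interactionRange φ < ⊤)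
    (hφ_pos : ∀ x : ℝ≥0, (x : ℝ≥0∞) ≤ interactionRange φ → 0 < φ x) {η : ℝ} (hη : 0 < η) :
    ∃ ε : ℝ, 0 < ε ∧ ∫ t in Set.Ici (0 : ℝ), lowKernel φ ε t < η := by
  set κ := (interactionRange φ).toReal
  set A : ℕ → Set ℝ := fun k => {t | t ≤ κ ∧ (φ t.toNNReal : ℝ) < 1 / (k + 1)} ∩ Set.Ici 0
  have hA : ∀ k, MeasurableSet (A k) := fun k =>
    (measurableSet_lowKernel hφ _).inter measurableSet_Ici
  have hanti : Antitone A := by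
    intro i j hij t ht
    refine ⟨⟨ht.1.1, ht.1.2.trans_le ?_⟩, ht.2⟩
    exact Nat.one_div_le_one_div hij
  have hfin : volume (A 0) ≠ ⊤ := by
    refine ((measure_mono (t := Set.Icc 0 κ) fun t ht => ⟨ht.2, ht.1.1⟩).trans_lt ?_).ne
    simp
  have hempty : ⋂ k, A k = ∅ := by
    refine Set.eq_empty_of_forall_notMem fun t ht => ?_
    rw [Set.mem_iInter] at ht
    have hpos : (0 : ℝ) < φ t.toNNReal := kernel_pos hκ_fin hφ_pos (ht 0).1.1
    obtain ⟨k, hk⟩ := exists_nat_one_div_lt hpos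
    exact absurd (ht k).1.2 (not_lt.2 hk.le)
  have hlim := tendsto_measure_iInter_atTop (μ := volume) (fun k => (hA k).nullMeasurableSet) hanti
    ⟨0, hfin⟩
  rw [hempty, measure_empty] at hlim
  obtain ⟨k, hk⟩ := ((tendsto_order.1 hlim).2 (ENNReal.ofReal η) (by simpa using hη)).exists
  refine ⟨1 / (k + 1), by positivity, ?_⟩
  have : ∫ t in Set.Ici (0 : ℝ), lowKernel φ (1 / (k + 1)) t = (volume (A k)).toReal := by
    unfold lowKernel
    rw [integral_indicator (measurableSet_lowKernel hφ _)]
    simp only [Pi.one_apply, integral_const, smul_eq_mul, mul_one, measureReal_def,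
      Measure.restrict_apply_univ]
    rw [Measure.restrict_apply (measurableSet_lowKernel hφ _)]
  rw [this]
  exact (ENNReal.toReal_lt_toReal hk.ne_top ENNReal.ofReal_ne_top).2 hk |>.trans_eq
    (ENNReal.toReal_ofReal hη.le)

end Kernel

/-! ### Reasoning about programs -/

section Runs

/-- Started in memory `m`, the program takes at most `c` steps and establishes `Q`. -/
def Runs (I : Input) (P : Program) (m : Memory) (c : ℕ) (Q : Memory → Prop) : Prop :=
  Q (P.exec I m).1 ∧ (P.exec I m).2 ≤ c

variable {I : Input} {m : Memory}

theorem Runs.mono {P : Program} {c c' : ℕ} {Q Q' : Memory → Prop} (h : Runs I P m c Q)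
    (hc : c ≤ c') (hQ : ∀ m', Q m' → Q' m') : Runs I P m c' Q' :=
  ⟨hQ _ h.1, h.2.trans hc⟩

theorem Runs.seq {P P' : Program} {c c' : ℕ} {Q R : Memory → Prop} (h : Runs I P m c Q)
    (h' : ∀ m', Q m' → Runs I P' m' c' R) : Runs I (Program.seq P P') m (c + c') R :=
  ⟨(h' _ h.1).1, add_le_add h.2 (h' _ h.1).2⟩

theorem Runs.skip {c : ℕ} (hc : 1 ≤ c) {Q : Memory → Prop} (h : Q m) :
    Runs I Program.skip m c Q := ⟨h, hc⟩

theorem Runs.setNat {a c : ℕ} {i e : NExpr} {Q : Memory → Prop}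
    (h : Q (m.setNat a (i.eval I m) (e.eval I m))) (hc : i.cost + e.cost + 1 ≤ c) :
    Runs I (Program.setNat a i e) m c Q := ⟨h, hc⟩

theorem Runs.setReal {a c : ℕ} {i : NExpr} {e : RExpr} {Q : Memory → Prop}
    (h : Q (m.setReal a (i.eval I m) (e.eval I m))) (hc : i.cost + e.cost + 1 ≤ c) :
    Runs I (Program.setReal a i e) m c Q := ⟨h, hc⟩

theorem Runs.setFloor {a c : ℕ} {i : NExpr} {e : RExpr} {Q : Memory → Prop}
    (h : Q (m.setNat a (i.eval I m) ⌊e.eval I m⌋₊))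
    (hc : i.cost + e.cost + 1 + Nat.size ⌊e.eval I m⌋₊ ≤ c) :
    Runs I (Program.setFloor a i e) m c Q := ⟨h, hc⟩

theorem Runs.ifNatLt {e f : NExpr} {P P' : Program} {c : ℕ} {Q : Memory → Prop}
    (h : e.eval I m < f.eval I m → Runs I P m c Q)
    (h' : ¬ e.eval I m < f.eval I m → Runs I P' m c Q) :
    Runs I (Program.ifNatLt e f P P') m (e.cost + f.cost + 1 + c) Q := by
  by_cases hlt : e.eval I m < f.eval I m
  · have := h hlt
    simp only [Runs, Program.exec, hlt, if_true]
    exact ⟨this.1, Nat.add_le_add_left this.2 _⟩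
  · have := h' hlt
    simp only [Runs, Program.exec, hlt, if_false]
    exact ⟨this.1, Nat.add_le_add_left this.2 _⟩

theorem Runs.ifRealLt {e f : RExpr} {P P' : Program} {c : ℕ} {Q : Memory → Prop}
    (h : e.eval I m < f.eval I m → Runs I P m c Q)
    (h' : ¬ e.eval I m < f.eval I m → Runs I P' m c Q) :
    Runs I (Program.ifRealLt e f P P') m (e.cost + f.cost + 1 + c) Q := by
  by_cases hlt : e.eval I m < f.eval I m
  · have := h hlt
    simp only [Runs, Program.exec, hlt, if_true]
    exact ⟨this.1, Nat.add_le_add_left this.2 _⟩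
  · have := h' hlt
    simp only [Runs, Program.exec, hlt, if_false]
    exact ⟨this.1, Nat.add_le_add_left this.2 _⟩

/-- The rule for loops: `Inv` is an invariant, and each iteration takes at most `c` steps. -/
theorem Runs.loop {a c : ℕ} {e : NExpr} {P : Program} (Inv : ℕ → Memory → Prop) (h0 : Inv 0 m)
    (h : ∀ k < e.eval I m, ∀ m', Inv k m' → Runs I P (m'.setNat a 0 k) c (Inv (k + 1))) :
    Runs I (Program.loop a e P) m (e.cost + 1 + e.eval I m * (c + 1)) (Inv (e.eval I m)) := by
  have key : ∀ T ≤ e.eval I m, Inv T ((List.range T).foldl (fun s k =>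
      let r := P.exec I (s.1.setNat a 0 k); (r.1, s.2 + 1 + r.2)) (m, e.cost + 1)).1 ∧
      ((List.range T).foldl (fun s k =>
      let r := P.exec I (s.1.setNat a 0 k); (r.1, s.2 + 1 + r.2)) (m, e.cost + 1)).2 ≤
        e.cost + 1 + T * (c + 1) := by
    intro T hT
    induction T with
    | zero => exact ⟨h0, by simp⟩
    | succ T ih =>
      obtain ⟨h1, h2⟩ := ih (by omega)
      rw [List.range_succ, List.foldl_append]
      have := h T (by omega) _ h1
      refine ⟨this.1, ?_⟩
      exact (add_le_add (Nat.add_le_add_right h2 1) this.2).trans (le_of_eq (by ring))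
  exact key _ le_rfl

@[simp] theorem setNat_real (m : Memory) (a i k : ℕ) : (m.setNat a i k).real = m.real := rfl

@[simp] theorem setReal_nat (m : Memory) (a i : ℕ) (x : ℝ) : (m.setReal a i x).nat = m.nat := rfl

theorem setNat_nat (m : Memory) (a i k b : ℕ) :
    (m.setNat a i k).nat b = if b = a then Function.update (m.nat a) i k else m.nat b := by
  simp only [Memory.setNat, Function.update_apply]

theorem setReal_real (m : Memory) (a i : ℕ) (x : ℝ) (b : ℕ) :
    (m.setReal a i x).real b = if b = a then Function.update (m.real a) i x else m.real b := by
  simp only [Memory.setReal, Function.update_apply]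

end Runs

/-! ### The scores -/

section Score

/-- The number of the block of node `u`, when the torus is divided into `B` blocks. -/
def Input.bin (I : Input) (B u : ℕ) : ℕ := ⌊(1 / 2 - I.loc u) * B⌋₊

/-- The nodes in block `b`. -/
def Input.bucket (I : Input) (B b : ℕ) : List ℕ :=
  (List.range I.N).filter fun u => I.bin B u = b

/-- The nodes in the `len` blocks from block `st` on, in cyclic order. -/
def Input.window (I : Input) (B st len : ℕ) : List ℕ :=
  (List.range len).flatMap fun t => I.bucket B ((st + t) % B)

/-- The log-likelihood ratio of the pair of nodes `u`, `v`. -/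
def Input.ell (I : Input) (u v : ℕ) : ℝ :=
  llr I.p I.q (psi I.φ I.n (I.loc u) (I.loc v)) (decide (v ∈ I.nbrs u))

/-- The score of node `u` with respect to the reference values `f` of the nodes in a list. -/
def Input.score (I : Input) (l : List ℕ) (f : ℕ → ℝ) (u : ℕ) : ℝ :=
  (l.map fun v => f v * I.ell u v).sum

/-- Integer variables. -/
abbrev nvar (a : ℕ) : NExpr := .read a (.const 0)

/-- Real variables. -/
abbrev rvar (a : ℕ) : RExpr := .read a (.const 0)

/-- Assignment to an integer variable. -/
abbrev nset (a : ℕ) (e : NExpr) : Program := .setNat a (.const 0) e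

/-- Assignment to a real variable. -/
abbrev rset (a : ℕ) (e : RExpr) : Program := .setReal a (.const 0) e

/-- One step in the computation of a score: node `v` (variable 22) contributes to the score
(variable 11) of node `u` (variable 7). -/
def scoreStep : Program :=
  .seq (nset 22 (.read 3 (nvar 21))) <|
  .seq (rset 13 (.sub (.loc (nvar 7)) (.loc (nvar 22)))) <|
  .seq (.ifRealLt (rvar 13) (.const 0) (rset 13 (.sub (.const 0) (rvar 13)))
    (rset 13 (rvar 13))) <|
  .seq (.ifRealLt (.const (1 / 2)) (rvar 13) (rset 13 (.sub (.const 1) (rvar 13)))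
    (rset 13 (rvar 13))) <|
  .seq (rset 14 (.kernel (.mul (.div (.ofNat .scale) (.log (.ofNat .scale))) (rvar 13)))) <|
  .seq (.setReal 12 (nvar 22) (.add (.mul (.read 10 (nvar 22)) (.log (.div .p .q)))
    (.mul (.sub (.const 1) (.read 10 (nvar 22)))
      (.log (.div (.sub (.const 1) (.mul .p (rvar 14))) (.sub (.const 1) (.mul .q (rvar 14)))))))) <|
  .seq (rset 11 (.add (rvar 11) (.mul (.read 1 (nvar 22)) (.read 12 (nvar 22))))) <|
  nset 21 (.add (nvar 21) (nvar 5))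

/-- Write `c` into the marks (array 10) of the neighbours of node `u` (variable 7). -/
def markNbrs (c : ℚ) : Program :=
  .loop 23 (.degree (nvar 7)) (.setReal 10 (.nbr (nvar 7) (nvar 23)) (.const c))

/-- Add the contributions of block `st + t` (variables 8 and 24) to the score. -/
def scoreBlock : Program :=
  .seq (.ifNatLt (.add (nvar 8) (nvar 24)) (nvar 5) (nset 20 (.add (nvar 8) (nvar 24)))
    (nset 20 (.sub (.add (nvar 8) (nvar 24)) (nvar 5)))) <|
  .seq (nset 21 (nvar 20)) <|
  .loop 25 (.read 2 (nvar 20)) scoreStep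

/-- Compute the score of node `u` (variable 7) from `len` blocks, from block `st` (variable 8)
on. -/
def scoreProg (len : ℕ) : Program :=
  .seq (markNbrs 1) <|
  .seq (rset 11 (.const 0)) <|
  .seq (.loop 24 (.const len) scoreBlock) <|
  markNbrs 0

/-- The memory holds the division of the nodes into blocks. -/
structure Data (I : Input) (B : ℕ) (m : Memory) : Prop where
  numBlocks : m.nat 5 0 = B
  bin : ∀ u < I.N, m.nat 1 u = I.bin B u
  count : ∀ b < B, m.nat 2 b = (I.bucket B b).length
  list : ∀ b < B, ∀ k < (I.bucket B b).length, m.nat 3 (b + k * B) = (I.bucket B b).getD k 0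

/-- The variables and arrays outside the scratch area agree. -/
def Frame (m m' : Memory) : Prop :=
  (∀ a < 20, m'.nat a = m.nat a) ∧ ∀ a < 10, m'.real a = m.real a

theorem Frame.refl (m : Memory) : Frame m m := ⟨fun _ _ => rfl, fun _ _ => rfl⟩

theorem Frame.trans {m m' m'' : Memory} (h : Frame m m') (h' : Frame m' m'') : Frame m m'' :=
  ⟨fun a ha => (h'.1 a ha).trans (h.1 a ha), fun a ha => (h'.2 a ha).trans (h.2 a ha)⟩

theorem Frame.setNat (m : Memory) {a : ℕ} (ha : 20 ≤ a) (i k : ℕ) : Frame m (m.setNat a i k) :=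
  ⟨fun b hb => by rw [setNat_nat, if_neg (by omega)], fun _ _ => rfl⟩

theorem Frame.setReal (m : Memory) {a : ℕ} (ha : 10 ≤ a) (i : ℕ) (x : ℝ) :
    Frame m (m.setReal a i x) :=
  ⟨fun _ _ => rfl, fun b hb => by rw [setReal_real, if_neg (by omega)]⟩

theorem Data.frame {I : Input} {B : ℕ} {m m' : Memory} (h : Data I B m) (hf : Frame m m') :
    Data I B m' := by
  refine ⟨?_, ?_, ?_, ?_⟩
  · rw [hf.1 5 (by norm_num)]; exact h.numBlocks
  · rw [hf.1 1 (by norm_num)]; exact h.bin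
  · rw [hf.1 2 (by norm_num)]; exact h.count
  · rw [hf.1 3 (by norm_num)]; exact h.list

variable {I : Input} {m : Memory}

/-- Used both to set the marks, when all of them are zero, and to clear them, when they are carried
by the neighbours. The hypothesis on array 10 covers both cases. Clearing costs a degree and not
`N`. -/
theorem runs_markNbrs (c : ℚ) (hm : ∀ v, m.real 10 v ≠ 0 → v ∈ I.nbrs (m.nat 7 0)) {Δ : ℕ}
    (hΔ : (I.nbrs (m.nat 7 0)).length ≤ Δ) :
    Runs I (markNbrs c) m (4 + 8 * Δ) fun m' => Frame m m' ∧
      (∀ v, m'.real 10 v = if v ∈ I.nbrs (m.nat 7 0) then (c : ℝ) else 0) ∧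
      ∀ a, 11 ≤ a → m'.real a = m.real a := by
  set l := I.nbrs (m.nat 7 0) with hl
  refine (Runs.loop (c := 7) (fun k m' => Frame m m' ∧ (∀ v ∈ l.take k, m'.real 10 v = c) ∧
    (∀ v, v ∉ l → m'.real 10 v = 0) ∧ ∀ a, 11 ≤ a → m'.real a = m.real a) ?_ ?_).mono ?_ ?_
  · refine ⟨Frame.refl m, by simp, fun v hv => ?_, fun _ _ => rfl⟩
    by_contra h
    exact hv (hm v h)
  · rintro k hk m' ⟨hf, h1, h2, h3⟩
    simp only [NExpr.eval] at hk
    have hk' : k < l.length := hk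
    refine Runs.setReal ?_ (by simp [NExpr.cost, RExpr.cost])
    have e7 : m'.nat 7 0 = m.nat 7 0 := by rw [hf.1 7 (by norm_num)]
    have ev : (NExpr.nbr (nvar 7) (nvar 23)).eval I (m'.setNat 23 0 k) = l[k] := by
      simp only [NExpr.eval, setNat_nat, Nat.reduceEqDiff, if_false, if_true,
        Function.update_self, e7]
      rw [← hl, List.getD_eq_getElem _ _ hk']
    rw [ev]
    refine ⟨(hf.trans (Frame.setNat m' (by norm_num) 0 k)).trans
      (Frame.setReal _ (by norm_num) _ _), ?_, ?_, ?_⟩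
    · intro v hv
      simp only [RExpr.eval, setReal_real, if_true, setNat_real]
      rw [List.take_add_one, List.getElem?_eq_getElem hk', List.mem_append] at hv
      by_cases hvk : v = l[k]
      · simp [hvk]
      · rw [Function.update_of_ne hvk]
        rcases hv with hv | hv
        · exact h1 v hv
        · simp at hv
          exact absurd hv hvk
    · intro v hv
      simp only [setReal_real, if_true, setNat_real]
      rw [Function.update_of_ne, h2 v hv]
      rintro rfl
      exact hv (List.getElem_mem hk')
    · intro a ha
      rw [setReal_real, if_neg (by omega), setNat_real]
      exact h3 a ha
  · simp only [NExpr.eval, NExpr.cost]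
    rw [← hl]
    omega
  · rintro m' ⟨hf, h1, h2, h3⟩
    refine ⟨hf, fun v => ?_, h3⟩
    split_ifs with hv
    · apply h1
      simp only [NExpr.eval]
      rwa [← hl, List.take_length]
    · exact h2 v hv

/-- The memory during the computation of the score of `u`. -/
structure ScoreState (I : Input) (m₀ : Memory) (u : ℕ) (l : List ℕ) (m : Memory) : Prop where
  frame : Frame m₀ m
  marks : ∀ v, m.real 10 v = if v ∈ I.nbrs u then 1 else 0
  acc : m.real 11 0 = I.score l (m₀.real 1) u
  ell_mem : ∀ v ∈ l, m.real 12 v = I.ell u v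
  ell_notMem : ∀ v, v ∉ l → m.real 12 v = m₀.real 12 v

/-- The `M₁`, …, `M₇` below are the successive memories, and each assignment is shown to lead from
one to the next. The mark of `v` tells whether the pair is linked, so no adjacency list is searched,
and a score costs a constant per node. -/
theorem runs_scoreStep {m₀ : Memory} {u v : ℕ} {l : List ℕ} (h : ScoreState I m₀ u l m)
    (hu : m₀.nat 7 0 = u) (hv : m₀.nat 3 (m.nat 21 0) = v) :
    Runs I scoreStep m 97 fun m' => ScoreState I m₀ u (l ++ [v]) m' ∧
      m'.nat 21 0 = m.nat 21 0 + m₀.nat 5 0 := by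
  have e3 : m.nat 3 (m.nat 21 0) = v := by rw [h.frame.1 3 (by norm_num), hv]
  have e7 : m.nat 7 0 = u := by rw [h.frame.1 7 (by norm_num), hu]
  have e5 : m.nat 5 0 = m₀.nat 5 0 := by rw [h.frame.1 5 (by norm_num)]
  have e1 : m.real 1 = m₀.real 1 := h.frame.2 1 (by norm_num)
  have hmk := h.marks v
  set x := I.loc u with hx
  set y := I.loc v with hy
  set d₁ : ℝ := if x - y < 0 then 0 - (x - y) else x - y with hd₁
  set d₂ : ℝ := if 1 / 2 < d₁ then 1 - d₁ else d₁ with hd₂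
  -- Comparing `|x - y|` with `1/2` selects the smaller of `|x - y|` and `1 - |x - y|`.
  have hd : d₂ = torusDist x y := by
    have h1 : d₁ = |x - y| := by
      rw [hd₁]
      split_ifs with h
      · rw [abs_of_neg h]; ring
      · rw [abs_of_nonneg (not_lt.1 h)]
    rw [hd₂, h1, torusDist]
    split_ifs with h
    · rw [min_eq_right (by linarith)]
    · rw [min_eq_left (by linarith)]
  have hpsi : psi I.φ I.n x y = I.φ (Real.toNNReal ((I.n : ℝ) / Real.log I.n * d₂)) := by
    rw [hd, psi]
  set M₁ := (m.setNat 22 0 v).setReal 13 0 (x - y) with hM₁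
  set M₂ := M₁.setReal 13 0 d₁ with hM₂
  set M₃ := M₂.setReal 13 0 d₂ with hM₃
  set M₄ := M₃.setReal 14 0 (psi I.φ I.n x y) with hM₄
  set M₅ := M₄.setReal 12 v (I.ell u v) with hM₅
  set M₆ := M₅.setReal 11 0 (I.score (l ++ [v]) (m₀.real 1) u) with hM₆
  set M₇ := M₆.setNat 21 0 (m.nat 21 0 + m₀.nat 5 0) with hM₇
  have eM₁ : M₁.real 13 0 = x - y := by simp [hM₁, setReal_real]
  have eM₂ : M₂.real 13 0 = d₁ := by simp [hM₂, setReal_real]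
  have eM₃ : M₃.real 13 0 = d₂ := by simp [hM₃, setReal_real]
  have eM₄ : M₄.real 14 0 = psi I.φ I.n x y := by simp [hM₄, setReal_real]
  have fM₄ : M₄.real 10 v = if v ∈ I.nbrs u then 1 else 0 := by
    simp [hM₄, hM₃, hM₂, hM₁, setReal_real, hmk]
  have gM₄ : M₄.nat 22 0 = v := by simp [hM₄, hM₃, hM₂, hM₁, setNat_nat]
  have eM₅ : M₅.real 12 v = I.ell u v := by simp [hM₅, setReal_real]
  have fM₅ : M₅.real 11 0 = I.score l (m₀.real 1) u := by
    simp [hM₅, hM₄, hM₃, hM₂, hM₁, setReal_real, h.acc]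
  have gM₅ : M₅.real 1 v = m₀.real 1 v := by
    simp [hM₅, hM₄, hM₃, hM₂, hM₁, setReal_real, e1]
  have kM₅ : M₅.nat 22 0 = v := by rw [hM₅, setReal_nat, gM₄]
  have eM₆ : M₆.nat 21 0 = m.nat 21 0 := by simp [hM₆, hM₅, hM₄, hM₃, hM₂, hM₁, setNat_nat]
  have fM₆ : M₆.nat 5 0 = m₀.nat 5 0 := by simp [hM₆, hM₅, hM₄, hM₃, hM₂, hM₁, setNat_nat, e5]
  have hscore : I.score (l ++ [v]) (m₀.real 1) u =
      I.score l (m₀.real 1) u + m₀.real 1 v * I.ell u v := by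
    simp [Input.score]
  -- The mark is `0` or `1` and interpolates between the two values of the log-likelihood ratio
  -- without a branch.
  have hell : I.ell u v = (if v ∈ I.nbrs u then 1 else 0) * Real.log (I.p / I.q) +
      (1 - (if v ∈ I.nbrs u then 1 else 0)) *
        Real.log ((1 - I.p * psi I.φ I.n x y) / (1 - I.q * psi I.φ I.n x y)) := by
    by_cases hb : v ∈ I.nbrs u <;> simp [Input.ell, llr, hb, hx, hy]
  have hframe : Frame m M₇ := by
    refine ⟨fun a ha => ?_, fun a ha => ?_⟩
    · rw [hM₇, setNat_nat, if_neg (by omega)]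
      simp only [hM₆, hM₅, hM₄, hM₃, hM₂, hM₁, setReal_nat]
      rw [setNat_nat, if_neg (by omega)]
    · simp only [hM₇, setNat_real, hM₆, hM₅, hM₄, hM₃, hM₂, hM₁, setReal_real]
      simp only [show a ≠ 11 by omega, show a ≠ 12 by omega, show a ≠ 13 by omega,
        show a ≠ 14 by omega, if_false]
  have hfinal : ScoreState I m₀ u (l ++ [v]) M₇ := by
    refine ⟨h.frame.trans hframe, fun w => ?_, ?_, fun w hw => ?_, fun w hw => ?_⟩
    · rw [← h.marks w]
      simp [hM₇, hM₆, hM₅, hM₄, hM₃, hM₂, hM₁, setReal_real]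
    · simp [hM₇, hM₆, setReal_real]
    · have e12 : M₇.real 12 = Function.update (m.real 12) v (I.ell u v) := by
        simp [hM₇, hM₆, hM₅, hM₄, hM₃, hM₂, hM₁, setReal_real]
      rw [e12]
      by_cases hwv : w = v
      · simp [hwv]
      · rw [Function.update_of_ne hwv]
        exact h.ell_mem w (by simpa [hwv] using hw)
    · have e12 : M₇.real 12 = Function.update (m.real 12) v (I.ell u v) := by
        simp [hM₇, hM₆, hM₅, hM₄, hM₃, hM₂, hM₁, setReal_real]
      simp only [List.mem_append, List.mem_singleton, not_or] at hw
      rw [e12, Function.update_of_ne hw.2, h.ell_notMem w hw.1]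
  refine Runs.seq (c := 5) (c' := 92) (Q := fun m' => m' = m.setNat 22 0 v)
    (Runs.setNat ?_ (by simp [NExpr.cost])) ?_
  · simp only [NExpr.eval, e3]
  rintro _ rfl
  refine Runs.seq (c := 9) (c' := 83) (Q := fun m' => m' = M₁)
    (Runs.setReal ?_ (by simp [NExpr.cost, RExpr.cost])) ?_
  · simp [NExpr.eval, RExpr.eval, hM₁, setNat_nat, e7, hx, hy]
  rintro _ rfl
  refine Runs.seq (c := 10) (c' := 73) (Q := fun m' => m' = M₂)
    (Runs.mono (c := _ + 6) (Runs.ifRealLt (fun hlt => Runs.setReal ?_ ?_)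
      fun hlt => Runs.setReal ?_ ?_) (by simp [NExpr.cost, RExpr.cost]) fun _ => id) ?_
  · simp only [NExpr.eval, RExpr.eval, eM₁, Rat.cast_zero] at hlt ⊢
    rw [hM₂, hd₁, if_pos hlt]
  · simp [NExpr.cost, RExpr.cost]
  · simp only [NExpr.eval, RExpr.eval, eM₁, Rat.cast_zero] at hlt ⊢
    rw [hM₂, hd₁, if_neg hlt]
  · simp [NExpr.cost, RExpr.cost]
  rintro _ rfl
  refine Runs.seq (c := 10) (c' := 63) (Q := fun m' => m' = M₃)
    (Runs.mono (c := _ + 6) (Runs.ifRealLt (fun hlt => Runs.setReal ?_ ?_)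
      fun hlt => Runs.setReal ?_ ?_) (by simp [NExpr.cost, RExpr.cost]) fun _ => id) ?_
  · simp only [NExpr.eval, RExpr.eval, eM₂, Rat.cast_one, Rat.cast_div, Rat.cast_ofNat] at hlt ⊢
    rw [hM₃, hd₂, if_pos hlt]
  · simp [NExpr.cost, RExpr.cost]
  · simp only [NExpr.eval, RExpr.eval, eM₂, Rat.cast_one, Rat.cast_div, Rat.cast_ofNat] at hlt ⊢
    rw [hM₃, hd₂, if_neg hlt]
  · simp [NExpr.cost, RExpr.cost]
  rintro _ rfl
  refine Runs.seq (c := 12) (c' := 51) (Q := fun m' => m' = M₄)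
    (Runs.setReal ?_ (by simp [NExpr.cost, RExpr.cost])) ?_
  · simp only [NExpr.eval, RExpr.eval, eM₃]
    rw [hM₄, hpsi]
  rintro _ rfl
  refine Runs.seq (c := 32) (c' := 19) (Q := fun m' => m' = M₅)
    (Runs.setReal ?_ (by simp [NExpr.cost, RExpr.cost])) ?_
  · simp only [NExpr.eval, RExpr.eval, gM₄, fM₄, eM₄, Rat.cast_one]
    rw [hM₅, hell]
  rintro _ rfl
  refine Runs.seq (c := 12) (c' := 7) (Q := fun m' => m' = M₆)
    (Runs.setReal ?_ (by simp [NExpr.cost, RExpr.cost])) ?_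
  · simp only [NExpr.eval, RExpr.eval, kM₅, fM₅, eM₅, gM₅]
    rw [hM₆, hscore]
  rintro _ rfl
  refine Runs.setNat ?_ (by simp [NExpr.cost])
  simp only [NExpr.eval, eM₆, fM₆]
  rw [← hM₇]
  exact ⟨hfinal, by simp [hM₇, setNat_nat]⟩

/-- The machine has no remainder operation; as `st + t < 2 * B`, one conditional subtraction reduces
the block number modulo `B`. The list of a block is read with stride `B`. -/
theorem runs_scoreBlock {m₀ : Memory} {u st t B Δ : ℕ} {l : List ℕ} (h : ScoreState I m₀ u l m)
    (hD : Data I B m₀) (hu : m₀.nat 7 0 = u) (hst : m₀.nat 8 0 = st) (ht : m.nat 24 0 = t)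
    (hB : st + t < 2 * B) (hΔ : ∀ b, (I.bucket B b).length ≤ Δ) :
    Runs I scoreBlock m (27 + 98 * Δ) fun m' =>
      ScoreState I m₀ u (l ++ I.bucket B ((st + t) % B)) m' := by
  set b := (st + t) % B with hb
  have hbB : b < B := Nat.mod_lt _ (by omega)
  have e8 : m.nat 8 0 = st := by rw [h.frame.1 8 (by norm_num), hst]
  have e5 : m.nat 5 0 = B := by rw [h.frame.1 5 (by norm_num), hD.numBlocks]
  have hbv : b = if st + t < B then st + t else st + t - B := by
    split_ifs with hlt
    · exact Nat.mod_eq_of_lt hlt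
    · rw [hb, Nat.mod_eq_sub_mod (by omega), Nat.mod_eq_of_lt (by omega)]
  have hstate : ∀ {k i : ℕ} {m' : Memory} {l' : List ℕ}, 20 ≤ k → ScoreState I m₀ u l' m' →
      ∀ j, ScoreState I m₀ u l' (m'.setNat k i j) := fun hk hs j =>
    ⟨hs.frame.trans (Frame.setNat _ hk _ _), hs.marks, hs.acc, hs.ell_mem, hs.ell_notMem⟩
  unfold scoreBlock
  refine Runs.mono (c := 19 + (4 + (4 + 98 * Δ))) ?_ (by omega) fun _ => id
  refine Runs.seq (c := 19) (c' := 4 + (4 + 98 * Δ)) (Q := fun m' => m' = m.setNat 20 0 b)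
    (Runs.mono (c := _ + 10) (Runs.ifNatLt (fun hlt => Runs.setNat ?_ ?_)
      fun hlt => Runs.setNat ?_ ?_) ?_ fun _ => id) ?_
  · simp only [NExpr.eval, e8, ht, e5] at hlt ⊢
    rw [hbv, if_pos hlt]
  · simp [NExpr.cost]
  · simp only [NExpr.eval, e8, ht, e5] at hlt ⊢
    rw [hbv, if_neg hlt]
  · simp [NExpr.cost]
  · simp [NExpr.cost]
  rintro _ rfl
  refine Runs.seq (c := 4) (c' := 4 + 98 * Δ) (Q := fun m' => m' = (m.setNat 20 0 b).setNat 21 0 b)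
    (Runs.setNat ?_ (by simp [NExpr.cost])) ?_
  · simp [NExpr.eval, setNat_nat]
  rintro _ rfl
  set m₁ := (m.setNat 20 0 b).setNat 21 0 b with hm₁
  have hcount : (NExpr.read 2 (nvar 20)).eval I m₁ = (I.bucket B b).length := by
    have : m₁.nat 2 = m₀.nat 2 := by
      simp only [hm₁, setNat_nat, Nat.reduceEqDiff, if_false]
      exact h.frame.1 2 (by norm_num)
    simp only [NExpr.eval, this]
    rw [← hD.count b hbB]
    simp [hm₁, setNat_nat]
  refine (Runs.loop (c := 97) (fun r m' => ScoreState I m₀ u (l ++ (I.bucket B b).take r) m' ∧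
    m'.nat 21 0 = b + r * B) ?_ ?_).mono ?_ ?_
  · refine ⟨?_, by simp [hm₁, setNat_nat]⟩
    rw [List.take_zero, List.append_nil]
    exact hstate (by norm_num) (hstate (by norm_num) h _) _
  · rintro r hr m' ⟨hs, hp⟩
    rw [hcount] at hr
    have hv : m₀.nat 3 ((m'.setNat 25 0 r).nat 21 0) = (I.bucket B b)[r] := by
      have : (m'.setNat 25 0 r).nat 21 0 = b + r * B := by simp [setNat_nat, hp]
      rw [this, hD.list b hbB r hr, List.getD_eq_getElem _ _ hr]
    refine (runs_scoreStep (hstate (by norm_num) hs r) hu hv).mono le_rfl ?_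
    rintro m'' ⟨h1, h2⟩
    constructor
    · rw [List.take_add_one, List.getElem?_eq_getElem hr, ← List.append_assoc]
      exact h1
    · rw [h2, hD.numBlocks]
      simp only [setNat_nat, Nat.reduceEqDiff, if_false, hp]
      ring
  · rw [hcount]
    simp only [NExpr.cost]
    have := hΔ b
    omega
  · rintro m' ⟨hs, -⟩
    rwa [hcount, List.take_length] at hs

theorem window_succ (I : Input) (B st t : ℕ) :
    I.window B st (t + 1) = I.window B st t ++ I.bucket B ((st + t) % B) := by
  simp [Input.window, List.range_succ]

/-- An upper bound for the number of steps in the computation of a score. -/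
def scoreCost (len Δ : ℕ) : ℕ := 100 * (len + 1) * (Δ + 1)

/-- What the computation of a score achieves. -/
structure Scored (I : Input) (m₀ : Memory) (u : ℕ) (l : List ℕ) (m : Memory) : Prop where
  frame : Frame m₀ m
  marks : ∀ v, m.real 10 v = 0
  acc : m.real 11 0 = I.score l (m₀.real 1) u
  ell_mem : ∀ v ∈ l, m.real 12 v = I.ell u v
  ell_notMem : ∀ v, v ∉ l → m.real 12 v = m₀.real 12 v

/-- The marks are zero before and after, so scores can be computed one after the other, each at a
cost proportional to the number of nodes it involves. -/
theorem runs_scoreProg {u st B Δ len : ℕ} (hD : Data I B m) (hmk : ∀ v, m.real 10 v = 0)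
    (hu : m.nat 7 0 = u) (hst : m.nat 8 0 = st) (hB : st + len ≤ 2 * B)
    (hΔ : ∀ b, (I.bucket B b).length ≤ Δ) (hdeg : (I.nbrs u).length ≤ Δ) :
    Runs I (scoreProg len) m (scoreCost len Δ) (Scored I m u (I.window B st len)) := by
  refine Runs.mono (c := (4 + 8 * Δ) + (3 + ((2 + len * (28 + 98 * Δ)) + (4 + 8 * Δ)))) ?_ ?_
    fun _ => id
  swap
  · unfold scoreCost
    nlinarith
  refine Runs.seq (runs_markNbrs 1 (by simp [hmk]) (by rwa [hu])) ?_
  rintro m₁ ⟨hf₁, hmk₁, hr₁⟩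
  rw [hu] at hmk₁
  refine Runs.seq (c := 3) (Q := fun m' => m' = m₁.setReal 11 0 0)
    (Runs.setReal (by simp [NExpr.eval, RExpr.eval]) (by simp [NExpr.cost, RExpr.cost])) ?_
  rintro _ rfl
  refine Runs.seq (Q := ScoreState I m u (I.window B st len))
    ((Runs.loop (c := 27 + 98 * Δ) (fun t m' => ScoreState I m u (I.window B st t) m') ?_ ?_).mono
      ?_ ?_) ?_
  · refine ⟨hf₁.trans (Frame.setReal _ (by norm_num) _ _), ?_, ?_, ?_, ?_⟩
    · intro v
      simp [setReal_real, hmk₁]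
    · simp [setReal_real, Input.score, Input.window]
    · simp [Input.window]
    · intro v _
      simp [setReal_real, hr₁ 12 (by norm_num)]
  · intro t ht m' hs
    simp only [NExpr.eval] at ht
    rw [window_succ]
    refine runs_scoreBlock (t := t) ⟨hs.frame.trans (Frame.setNat _ (by norm_num) _ _), hs.marks,
      hs.acc, hs.ell_mem, hs.ell_notMem⟩ hD hu hst ?_ (by omega) hΔ
    simp [setNat_nat]
  · simp only [NExpr.eval, NExpr.cost]
    nlinarith
  · intro m' hs
    exact hs
  · intro m₂ hs
    have e7 : m₂.nat 7 0 = u := by rw [hs.frame.1 7 (by norm_num), hu]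
    refine (runs_markNbrs 0 (Δ := Δ) ?_ (by rwa [e7])).mono le_rfl ?_
    · intro v hv
      rw [e7]
      by_contra hn
      rw [hs.marks, if_neg hn] at hv
      exact hv rfl
    · rintro m₃ ⟨hf₃, hmk₃, hr₃⟩
      refine ⟨hs.frame.trans hf₃, ?_, ?_, ?_, ?_⟩
      · simpa using hmk₃
      · rw [hr₃ 11 le_rfl, hs.acc]
      · intro v hv
        rw [hr₃ 12 (by norm_num), hs.ell_mem v hv]
      · intro v hv
        rw [hr₃ 12 (by norm_num), hs.ell_notMem v hv]

end Score

/-! ### The algorithm -/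

section Algorithm

/-- The sign of a score. -/
def sg (x : ℝ) : ℝ := if 0 < x then 1 else -1

/-- The labels of the nodes in the first `K` blocks, relative to node `s`. -/
def Input.seedLab (I : Input) (B K s u : ℕ) : ℝ :=
  if I.bin B u < K then sg (I.score (I.window B 0 K) (I.ell s) u) else 0

/-- The labels after the propagation to the first `K + j` blocks. -/
def Input.stageLab (I : Input) (B K s : ℕ) : ℕ → ℕ → ℝ
  | 0, u => I.seedLab B K s u
  | j + 1, u => if I.bin B u = j + K then sg (I.score (I.window B j K) (I.stageLab B K s j) u)
      else I.stageLab B K s j u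

/-- The first of the blocks from which the final label of node `u` is found. -/
def Input.start (I : Input) (B D u : ℕ) : ℕ :=
  if I.bin B u < D then I.bin B u + B - D else I.bin B u - D

/-- The number of blocks. -/
def Input.numBlocks (I : Input) (M : ℕ) : ℕ := ⌊(M : ℝ) * I.n / Real.log I.n⌋₊

/-- Store the label `±1` of node `u` (variable 7), given by the sign of its score. -/
def storeSign (a : ℕ) : Program :=
  .ifRealLt (.const 0) (rvar 11) (.setReal a (nvar 7) (.const 1)) (.setReal a (nvar 7) (.const (-1)))

/-- Add node `u` (variable 7) to the list of its block. -/
def insertNode (K : ℕ) : Program :=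
  .seq (.setFloor 1 (nvar 7) (.mul (.sub (.const (1 / 2)) (.loc (nvar 7))) (.ofNat (nvar 5)))) <|
  .seq (.setNat 3 (.read 4 (.read 1 (nvar 7))) (nvar 7)) <|
  .seq (.setNat 4 (.read 1 (nvar 7)) (.add (.read 4 (.read 1 (nvar 7))) (nvar 5))) <|
  .seq (.setNat 2 (.read 1 (nvar 7)) (.add (.read 2 (.read 1 (nvar 7))) (.const 1))) <|
  .ifNatLt (.read 1 (nvar 7)) (.const K) (nset 6 (nvar 7)) .skip

/-- Divide the nodes into blocks. -/
def divideProg (M K : ℕ) : Program :=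
  .seq (.setFloor 5 (.const 0) (.div (.mul (.ofNat (.const M)) (.ofNat .scale))
    (.log (.ofNat .scale)))) <|
  .seq (.loop 12 (nvar 5) (.setNat 4 (nvar 12) (nvar 12))) <|
  .loop 7 .numNodes (insertNode K)

/-- Copy a real array. -/
def copyProg (a b : ℕ) : Program :=
  .loop 12 .numNodes (.setReal a (nvar 12) (.read b (nvar 12)))

/-- Label the nodes in the first `K` blocks. -/
def seedProg (K : ℕ) : Program :=
  .seq (nset 7 (nvar 6)) <|
  .seq (nset 8 (.const 0)) <|
  .seq (scoreProg K) <|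
  .seq (copyProg 1 12) <|
  .seq (.loop 7 .numNodes (.ifNatLt (.read 1 (nvar 7)) (.const K)
    (.seq (scoreProg K) (storeSign 2)) .skip)) <|
  copyProg 1 2

/-- Label the next node of a block from the preceding `K` blocks. -/
def labelNext (K : ℕ) : Program :=
  .seq (nset 7 (.read 3 (nvar 10))) <|
  .seq (scoreProg K) <|
  .seq (storeSign 1) <|
  nset 10 (.add (nvar 10) (nvar 5))

/-- Label the nodes of the other blocks, block by block. -/
def propagateProg (K : ℕ) : Program :=
  .loop 9 (.sub (nvar 5) (.const K)) <|
    .seq (nset 8 (nvar 9)) <|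
    .seq (nset 10 (.add (nvar 9) (.const K))) <|
    .loop 11 (.read 2 (.add (nvar 9) (.const K))) (labelNext K)

/-- Find the final labels. -/
def refineProg (D : ℕ) : Program :=
  .loop 7 .numNodes <|
    .seq (.ifNatLt (.read 1 (nvar 7)) (.const D)
      (nset 8 (.sub (.add (.read 1 (nvar 7)) (nvar 5)) (.const D)))
      (nset 8 (.sub (.read 1 (nvar 7)) (.const D)))) <|
    .seq (scoreProg (2 * D + 1)) <|
    .ifRealLt (.const 0) (rvar 11) (.setNat 0 (nvar 7) (.const 1)) (.setNat 0 (nvar 7) (.const 0))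

/-- The algorithm. -/
def recoveryProg (M K D : ℕ) : Program :=
  .seq (divideProg M K) <| .seq (seedProg K) <| .seq (propagateProg K) (refineProg D)

variable {I : Input} {m : Memory}

theorem mem_bucket {B b v : ℕ} : v ∈ I.bucket B b ↔ v < I.N ∧ I.bin B v = b := by
  simp [Input.bucket]

theorem mem_window {B st len v : ℕ} :
    v ∈ I.window B st len ↔ v < I.N ∧ ∃ t < len, I.bin B v = (st + t) % B := by
  simp only [Input.window, List.mem_flatMap, List.mem_range, mem_bucket]
  constructor
  · rintro ⟨t, ht, hv, h⟩
    exact ⟨hv, t, ht, h⟩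
  · rintro ⟨hv, t, ht, h⟩
    exact ⟨t, ht, hv, h⟩

theorem score_congr {l : List ℕ} {f g : ℕ → ℝ} (h : ∀ v ∈ l, f v = g v) (u : ℕ) :
    I.score l f u = I.score l g u := by
  unfold Input.score
  congr 1
  exact List.map_congr_left fun v hv => by rw [h v hv]

/-- The state after the first `i` nodes have been added to the lists. -/
structure Inserted (I : Input) (B K i : ℕ) (m : Memory) : Prop where
  real : m.real = fun _ _ => 0
  numBlocks : m.nat 5 0 = B
  bin : ∀ u < i, m.nat 1 u = I.bin B u
  count : ∀ b < B, m.nat 2 b = ((List.range i).filter fun u => I.bin B u = b).length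
  slot : ∀ b < B, m.nat 4 b = b + ((List.range i).filter fun u => I.bin B u = b).length * B
  list : ∀ b < B, ∀ k < ((List.range i).filter fun u => I.bin B u = b).length,
    m.nat 3 (b + k * B) = ((List.range i).filter fun u => I.bin B u = b).getD k 0
  seed : (∃ u < i, I.bin B u < K) → m.nat 6 0 < i ∧ I.bin B (m.nat 6 0) < K

/-- The lists of all blocks are interleaved in one array with stride `B`: they can grow without
known bounds, distinct lists never collide, and addresses are found by addition alone. -/
theorem slot_inj {B b b' k k' : ℕ} (hb : b < B) (hb' : b' < B) (h : b + k * B = b' + k' * B) :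
    b = b' ∧ k = k' := by
  have h1 : (b + k * B) % B = b := by rw [Nat.add_mul_mod_self_right, Nat.mod_eq_of_lt hb]
  have h2 : (b' + k' * B) % B = b' := by rw [Nat.add_mul_mod_self_right, Nat.mod_eq_of_lt hb']
  have h3 : b = b' := by rw [← h1, ← h2, h]
  subst h3
  exact ⟨rfl, Nat.eq_of_mul_eq_mul_right (by omega) (Nat.add_left_cancel h)⟩

theorem filter_range_succ {B b i : ℕ} : (List.range (i + 1)).filter (fun u => I.bin B u = b) =
    (List.range i).filter (fun u => I.bin B u = b) ++ if I.bin B i = b then [i] else [] := by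
  rw [List.range_succ, List.filter_append]
  congr 1
  by_cases h : I.bin B i = b <;> simp [h]

/-- Array 4 holds the next free address of each block. Variable 6 keeps the last node found in the
first `K` blocks, which becomes the reference node of the seeding. The term `Nat.size B` pays for
the integer part; it is of order `log n` per node and thus affordable. -/
theorem runs_insertNode {B K i : ℕ} (h : Inserted I B K i m) (hi : I.bin B i < B) :
    Runs I (insertNode K) (m.setNat 7 0 i) (60 + Nat.size B) (Inserted I B K (i + 1)) := by
  set b := I.bin B i with hb
  set l := (List.range i).filter (fun u => I.bin B u = b) with hl
  set M₀ := m.setNat 7 0 i with hM₀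
  set M₁ := M₀.setNat 1 i b with hM₁
  set M₂ := M₁.setNat 3 (b + l.length * B) i with hM₂
  set M₃ := M₂.setNat 4 b (b + l.length * B + B) with hM₃
  set M₄ := M₃.setNat 2 b (l.length + 1) with hM₄
  -- Common end of both branches of the last test, which only decides whether variable 6 changes.
  have hfin : ∀ M₅ : Memory, (∀ a, a ≠ 6 → M₅.nat a = M₄.nat a) → M₅.real = M₄.real →
      (I.bin B i < K → M₅.nat 6 0 = i) → (¬ I.bin B i < K → M₅.nat 6 0 = m.nat 6 0) →
      Inserted I B K (i + 1) M₅ := by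
    intro M₅ ha hr h6 h6'
    have e1 : M₅.nat 1 = Function.update (m.nat 1) i b := by
      rw [ha 1 (by norm_num)]
      simp [hM₄, hM₃, hM₂, hM₁, hM₀, setNat_nat]
    have e2 : M₅.nat 2 = Function.update (m.nat 2) b (l.length + 1) := by
      rw [ha 2 (by norm_num)]
      simp [hM₄, hM₃, hM₂, hM₁, hM₀, setNat_nat]
    have e3 : M₅.nat 3 = Function.update (m.nat 3) (b + l.length * B) i := by
      rw [ha 3 (by norm_num)]
      simp [hM₄, hM₃, hM₂, hM₁, hM₀, setNat_nat]
    have e4 : M₅.nat 4 = Function.update (m.nat 4) b (b + l.length * B + B) := by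
      rw [ha 4 (by norm_num)]
      simp [hM₄, hM₃, hM₂, hM₁, hM₀, setNat_nat]
    have e5 : M₅.nat 5 = m.nat 5 := by
      rw [ha 5 (by norm_num)]
      simp [hM₄, hM₃, hM₂, hM₁, hM₀, setNat_nat]
    refine ⟨?_, ?_, ?_, ?_, ?_, ?_, ?_⟩
    · rw [hr]
      exact h.real
    · rw [e5, h.numBlocks]
    · intro u hu
      rw [e1]
      by_cases hui : u = i
      · simp [hui, hb]
      · rw [Function.update_of_ne hui, h.bin u (by omega)]
    · intro b' hb'
      rw [e2, filter_range_succ]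
      by_cases hbb : b' = b
      · subst hbb
        simp [← hb, ← hl]
      · rw [Function.update_of_ne hbb, h.count b' hb', if_neg (by rw [← hb]; exact Ne.symm hbb),
          List.append_nil]
    · intro b' hb'
      rw [e4, filter_range_succ]
      by_cases hbb : b' = b
      · subst hbb
        simp [← hb, ← hl]
        ring
      · rw [Function.update_of_ne hbb, h.slot b' hb', if_neg (by rw [← hb]; exact Ne.symm hbb),
          List.append_nil]
    · intro b' hb' k hk
      rw [filter_range_succ] at hk ⊢
      rw [e3]
      by_cases hbb : b' = b
      · subst hbb
        rw [if_pos hb.symm, ← hl] at hk ⊢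
        rw [List.length_append, List.length_singleton] at hk
        by_cases hkl : k = l.length
        · subst hkl
          simp
        · rw [Function.update_of_ne (fun he => hkl (slot_inj hi hi he).2), h.list _ hi k (by
            rw [← hl]; omega), ← hl, List.getD_append _ _ _ _ (by omega)]
      · rw [if_neg (by rw [← hb]; exact Ne.symm hbb), List.append_nil] at hk ⊢
        rw [Function.update_of_ne (fun he => hbb (slot_inj hb' hi he).1), h.list b' hb' k hk]
    · rintro ⟨u, hu, huK⟩
      by_cases hiK : I.bin B i < K
      · rw [h6 hiK]
        exact ⟨by omega, hiK⟩
      · rw [h6' hiK]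
        have := h.seed ⟨u, by
          rcases Nat.lt_succ_iff_lt_or_eq.1 hu with h' | h'
          · exact h'
          · exact absurd (h' ▸ huK) hiK, huK⟩
        exact ⟨by omega, this.2⟩
  have e5 : M₀.nat 5 0 = B := by simp [hM₀, setNat_nat, h.numBlocks]
  have e7 : M₀.nat 7 0 = i := by simp [hM₀, setNat_nat]
  have f1 : M₁.nat 1 i = b := by simp [hM₁, setNat_nat]
  have f7 : M₁.nat 7 0 = i := by simp [hM₁, setNat_nat, e7]
  have f4 : M₁.nat 4 b = b + l.length * B := by simp [hM₁, hM₀, setNat_nat, h.slot b hi, hl]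
  have g1 : M₂.nat 1 i = b := by simp [hM₂, setNat_nat, f1]
  have g7 : M₂.nat 7 0 = i := by simp [hM₂, setNat_nat, f7]
  have g4 : M₂.nat 4 b = b + l.length * B := by simp [hM₂, setNat_nat, f4]
  have g5 : M₂.nat 5 0 = B := by simp [hM₂, hM₁, setNat_nat, e5]
  have k1 : M₃.nat 1 i = b := by simp [hM₃, setNat_nat, g1]
  have k7 : M₃.nat 7 0 = i := by simp [hM₃, setNat_nat, g7]
  have k2 : M₃.nat 2 b = l.length := by
    simp [hM₃, hM₂, hM₁, hM₀, setNat_nat, h.count b hi, hl]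
  have j1 : M₄.nat 1 i = b := by simp [hM₄, setNat_nat, k1]
  have j7 : M₄.nat 7 0 = i := by simp [hM₄, setNat_nat, k7]
  have j6 : M₄.nat 6 0 = m.nat 6 0 := by simp [hM₄, hM₃, hM₂, hM₁, hM₀, setNat_nat]
  have hfl : ⌊(RExpr.mul (.sub (.const (1 / 2)) (.loc (nvar 7))) (.ofNat (nvar 5))).eval I M₀⌋₊ =
      b := by
    simp only [RExpr.eval, NExpr.eval, e7, e5, hb, Input.bin]
    norm_num
  unfold insertNode
  refine Runs.mono (c := (12 + Nat.size B) + (7 + (12 + (11 + 9)))) ?_ (by omega) fun _ => id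
  refine Runs.seq (Q := fun m' => m' = M₁) (Runs.setFloor ?_ ?_) ?_
  · rw [hfl]
    simp [NExpr.eval, e7, hM₁]
  · rw [hfl]
    have := Nat.size_le_size hi.le
    simp only [NExpr.cost, RExpr.cost]
    omega
  rintro _ rfl
  refine Runs.seq (Q := fun m' => m' = M₂) (Runs.setNat ?_ ?_) ?_
  · simp only [NExpr.eval, f7, f1, f4]
    rw [← hM₂]
  · simp [NExpr.cost]
  rintro _ rfl
  refine Runs.seq (Q := fun m' => m' = M₃) (Runs.setNat ?_ ?_) ?_
  · simp only [NExpr.eval, g7, g1, g4, g5]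
    rw [← hM₃]
  · simp [NExpr.cost]
  rintro _ rfl
  refine Runs.seq (Q := fun m' => m' = M₄) (Runs.setNat ?_ ?_) ?_
  · simp only [NExpr.eval, k7, k1, k2]
    rw [← hM₄]
  · simp [NExpr.cost]
  rintro _ rfl
  refine Runs.mono (c := 3 + 1 + 1 + 4) (Runs.ifNatLt (fun hlt => Runs.setNat ?_ ?_)
    fun hlt => Runs.skip ?_ ?_) ?_ fun _ => id
  · simp only [NExpr.eval, j7, j1] at hlt ⊢
    refine hfin _ (fun a ha => ?_) rfl (fun _ => ?_) fun hn => absurd hlt hn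
    · rw [setNat_nat, if_neg ha]
    · simp [setNat_nat]
  · simp [NExpr.cost]
  · norm_num
  · simp only [NExpr.eval, j7, j1] at hlt
    exact hfin _ (fun _ _ => rfl) rfl (fun hn => absurd hn hlt) fun _ => j6
  · norm_num

theorem runs_divideProg {M K : ℕ} (hbin : ∀ u < I.N, I.bin (I.numBlocks M) u < I.numBlocks M) :
    Runs I (divideProg M K) Memory.init
      (20 + 6 * I.numBlocks M + (61 + Nat.size (I.numBlocks M)) * I.N + Nat.size (I.numBlocks M))
      (Inserted I (I.numBlocks M) K I.N) := by
  set B := I.numBlocks M with hB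
  refine Runs.mono (c := (11 + Nat.size B) + ((3 + B * (5 + 1)) +
    (2 + I.N * (60 + Nat.size B + 1)))) ?_ (by nlinarith) fun _ => id
  have hfl : ⌊(RExpr.div (.mul (.ofNat (.const M)) (.ofNat .scale))
      (.log (.ofNat .scale))).eval I Memory.init⌋₊ = B := by
    simp only [RExpr.eval, NExpr.eval, hB, Input.numBlocks]
  refine Runs.seq (Q := fun m' => m' = Memory.init.setNat 5 0 B) (Runs.setFloor ?_ ?_) ?_
  · rw [hfl]
    simp [NExpr.eval]
  · rw [hfl]
    simp only [NExpr.cost, RExpr.cost]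
    omega
  rintro _ rfl
  set m₀ := Memory.init.setNat 5 0 B with hm₀
  have e5 : (nvar 5).eval I m₀ = B := by simp [NExpr.eval, hm₀, setNat_nat]
  -- The free address of an empty list `b` is `b` itself; this is what the loop stores.
  refine Runs.seq (Q := Inserted I B K 0) ((Runs.loop (c := 5) (fun k m' =>
    (∀ b < k, m'.nat 4 b = b) ∧ m'.nat 2 = (fun _ => 0) ∧ m'.nat 5 0 = B ∧ m'.real = fun _ _ => 0)
      ?_ ?_).mono ?_ ?_) ?_
  · refine ⟨by simp, ?_, ?_, ?_⟩
    · simp [hm₀, setNat_nat, Memory.init]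
    · simp [hm₀, setNat_nat]
    · rfl
  · rintro k hk m' ⟨h1, h2, h3, h4⟩
    refine Runs.setNat ⟨fun b hb => ?_, ?_, ?_, h4⟩ (by simp [NExpr.cost])
    · simp only [NExpr.eval, setNat_nat, if_true, Function.update_self, Nat.reduceEqDiff, if_false]
      by_cases hbk : b = k
      · simp [hbk]
      · rw [Function.update_of_ne hbk, h1 b (by omega)]
    · simp [setNat_nat, h2]
    · simp [setNat_nat, h3]
  · rw [e5]
    simp [NExpr.cost]
  · rintro m' ⟨h1, h2, h3, h4⟩
    rw [e5] at h1
    refine ⟨h4, h3, by simp, by simp [h2], fun b hb => by simp [h1 b hb], by simp, ?_⟩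
    rintro ⟨u, hu, -⟩
    omega
  · intro m₁ h₁
    refine (Runs.loop (c := 60 + Nat.size B) (fun i m' => Inserted I B K i m') h₁ ?_).mono ?_
      fun _ h => h
    · intro i hi m' h
      exact runs_insertNode h (hbin i hi)
    · simp [NExpr.cost, NExpr.eval]

end Algorithm

/-! ### The labels computed by seeding, propagation and refinement -/

section Correctness

variable {I : Input} {m : Memory}

theorem Data.congr {B : ℕ} {m' : Memory} (h : Data I B m)
    (h1 : m'.nat 1 = m.nat 1) (h2 : m'.nat 2 = m.nat 2) (h3 : m'.nat 3 = m.nat 3)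
    (h5 : m'.nat 5 = m.nat 5) : Data I B m' :=
  ⟨h5 ▸ h.numBlocks, h1 ▸ h.bin, h2 ▸ h.count, h3 ▸ h.list⟩

theorem Data.setNat {B : ℕ} (h : Data I B m) {a : ℕ} (ha : 6 ≤ a) (i k : ℕ) :
    Data I B (m.setNat a i k) := by
  apply h.congr <;> rw [setNat_nat, if_neg (by omega)]

theorem Inserted.data {B K : ℕ} (h : Inserted I B K I.N m) : Data I B m :=
  ⟨h.numBlocks, h.bin, h.count, h.list⟩

theorem runs_storeSign (a : ℕ) :
    Runs I (storeSign a) m 8 fun m' => m' = m.setReal a (m.nat 7 0) (sg (m.real 11 0)) := by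
  refine Runs.mono (c := 4 + 4) (Runs.ifRealLt (fun hlt => Runs.setReal ?_ ?_)
    fun hlt => Runs.setReal ?_ ?_) le_rfl fun _ => id
  · simp only [NExpr.eval, RExpr.eval, Rat.cast_zero, Rat.cast_one] at hlt ⊢
    rw [sg, if_pos hlt]
  · simp [NExpr.cost, RExpr.cost]
  · simp only [NExpr.eval, RExpr.eval, Rat.cast_zero, Rat.cast_one, Rat.cast_neg] at hlt ⊢
    rw [sg, if_neg hlt]
  · simp [NExpr.cost, RExpr.cost]

theorem runs_copyProg {a b : ℕ} (hab : a ≠ b) :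
    Runs I (copyProg a b) m (2 + I.N * 7) fun m' => (∀ u < I.N, m'.real a u = m.real b u) ∧
      (∀ c, c ≠ a → m'.real c = m.real c) ∧ ∀ c, c ≠ 12 → m'.nat c = m.nat c := by
  refine (Runs.loop (c := 6) (fun i m' => (∀ u < i, m'.real a u = m.real b u) ∧
      (∀ c, c ≠ a → m'.real c = m.real c) ∧ ∀ c, c ≠ 12 → m'.nat c = m.nat c) ?_ ?_).mono ?_ ?_
  · exact ⟨by simp, fun _ _ => rfl, fun _ _ => rfl⟩
  · rintro i hi m' ⟨h1, h2, h3⟩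
    have e12 : (m'.setNat 12 0 i).nat 12 0 = i := by simp [setNat_nat]
    refine Runs.setReal ⟨fun u hu => ?_, fun c hc => ?_, fun c hc => ?_⟩
      (by simp [NExpr.cost, RExpr.cost])
    · simp only [NExpr.eval, RExpr.eval, e12, setReal_real, if_true, setNat_real]
      by_cases hui : u = i
      · subst hui
        rw [Function.update_self, h2 b hab.symm]
      · rw [Function.update_of_ne hui, h1 u (by omega)]
    · rw [setReal_real, if_neg hc, setNat_real, h2 c hc]
    · rw [setReal_nat, setNat_nat, if_neg hc, h3 c hc]
  · simp [NExpr.cost, NExpr.eval]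
  · exact fun _ h => h

/-- The memory holds the blocks, and no node is marked. -/
structure Ready (I : Input) (B : ℕ) (m : Memory) : Prop extends Data I B m where
  marks : ∀ v, m.real 10 v = 0

theorem Scored.ready {B u : ℕ} {l : List ℕ} {m₀ : Memory} (h : Scored I m₀ u l m)
    (h₀ : Ready I B m₀) : Ready I B m := ⟨h₀.toData.frame h.frame, h.marks⟩

theorem Ready.setNat {B : ℕ} (h : Ready I B m) {a : ℕ} (ha : 6 ≤ a) (i k : ℕ) :
    Ready I B (m.setNat a i k) := ⟨h.toData.setNat ha i k, h.marks⟩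

theorem Ready.setReal {B : ℕ} (h : Ready I B m) {a : ℕ} (ha : a < 10) (i : ℕ) (x : ℝ) :
    Ready I B (m.setReal a i x) := by
  refine ⟨h.toData.congr rfl rfl rfl rfl, ?_⟩
  rw [setReal_real, if_neg (by omega)]
  exact h.marks

/-- The first score is computed for its side effect: it leaves the values `ℓ(s, ·)` in array 12.
Copied into array 1 they serve as reference values, so that the score of `u` is `∑ ℓ(s, w) ℓ(u, w)`.
The labels go to array 2, because array 1 has to stay intact until all of them are found. -/
theorem runs_seedProg {B K Δ : ℕ} (hins : Inserted I B K I.N m)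
    (hseed : ∃ u < I.N, I.bin B u < K) (hKB : K ≤ B) (hΔ : ∀ b, (I.bucket B b).length ≤ Δ)
    (hdeg : ∀ u, (I.nbrs u).length ≤ Δ) :
    Runs I (seedProg K) m (20 + 30 * I.N + scoreCost K Δ + I.N * scoreCost K Δ) fun m' =>
      Ready I B m' ∧ ∃ s < I.N, I.bin B s < K ∧ ∀ u < I.N, m'.real 1 u = I.seedLab B K s u := by
  set s := m.nat 6 0 with hs
  obtain ⟨hsN, hsK⟩ := hins.seed hseed
  set W := I.window B 0 K with hW
  have hready : Ready I B m := ⟨hins.data, by simp [hins.real]⟩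
  refine Runs.mono (c := 4 + (3 + (scoreCost K Δ + ((2 + I.N * 7) +
    ((2 + I.N * (scoreCost K Δ + 14)) + (2 + I.N * 7)))))) ?_ (by nlinarith) fun _ => id
  refine Runs.seq (Q := fun m' => m' = m.setNat 7 0 s)
    (Runs.setNat (by simp [NExpr.eval, hs]) (by simp [NExpr.cost])) ?_
  rintro _ rfl
  refine Runs.seq (Q := fun m' => m' = (m.setNat 7 0 s).setNat 8 0 0)
    (Runs.setNat (by simp [NExpr.eval]) (by simp [NExpr.cost])) ?_
  rintro _ rfl
  set m₀ := (m.setNat 7 0 s).setNat 8 0 0 with hm₀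
  have hready₀ : Ready I B m₀ := (hready.setNat (by norm_num) _ _).setNat (by norm_num) _ _
  have h8₀ : m₀.nat 8 0 = 0 := by simp [hm₀, setNat_nat]
  refine Runs.seq (runs_scoreProg hready₀.toData hready₀.marks (u := s) (st := 0)
    (by simp [hm₀, setNat_nat]) h8₀ (by omega) hΔ (hdeg _)) ?_
  intro m₁ h₁
  have hready₁ := h₁.ready hready₀
  refine Runs.seq (runs_copyProg (by norm_num)) ?_
  rintro m₂ ⟨hr₂, hc₂, hn₂⟩
  have hready₂ : Ready I B m₂ := ⟨hready₁.toData.congr (hn₂ _ (by norm_num))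
    (hn₂ _ (by norm_num)) (hn₂ _ (by norm_num)) (hn₂ _ (by norm_num)), by
      rw [hc₂ 10 (by norm_num)]; exact hready₁.marks⟩
  have href : ∀ v ∈ W, m₂.real 1 v = I.ell s v := by
    intro v hv
    rw [hr₂ v (mem_window.1 hv).1, h₁.ell_mem v hv]
  have h8₂ : m₂.nat 8 0 = 0 := by
    rw [hn₂ 8 (by norm_num), h₁.frame.1 8 (by norm_num), h8₀]
  have hlab₂ : ∀ v, m₂.real 2 v = 0 := by
    intro v
    rw [hc₂ 2 (by norm_num), h₁.frame.2 2 (by norm_num)]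
    simp [hm₀, hins.real]
  refine Runs.seq (Q := fun m' => Ready I B m' ∧ ∀ v < I.N, m'.real 2 v = I.seedLab B K s v)
    ((Runs.loop (c := scoreCost K Δ + 13) (fun i m' => Ready I B m' ∧ m'.nat 8 0 = 0 ∧
      m'.real 1 = m₂.real 1 ∧ (∀ v < i, m'.real 2 v = I.seedLab B K s v) ∧
      ∀ v, i ≤ v → m'.real 2 v = 0) ?_ ?_).mono ?_ ?_) ?_
  · exact ⟨hready₂, h8₂, rfl, by simp, fun v _ => hlab₂ v⟩
  · rintro i hi m' ⟨hR, h8, h1, h2, h3⟩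
    simp only [NExpr.eval] at hi
    have hR' : Ready I B (m'.setNat 7 0 i) := hR.setNat (by norm_num) _ _
    have e7 : (m'.setNat 7 0 i).nat 7 0 = i := by simp [setNat_nat]
    have ebin : (m'.setNat 7 0 i).nat 1 i = I.bin B i := hR'.bin i hi
    refine Runs.mono (c := 3 + 1 + 1 + (scoreCost K Δ + 8)) (Runs.ifNatLt (fun hlt => ?_)
      fun hlt => ?_) (by omega) fun _ => id
    · simp only [NExpr.eval, e7, ebin] at hlt
      refine Runs.seq (runs_scoreProg hR'.toData hR'.marks e7 (st := 0)
        (by simpa [setNat_nat] using h8) (by omega) hΔ (hdeg _)) ?_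
      intro m₃ h₃
      have e7₃ : m₃.nat 7 0 = i := by rw [h₃.frame.1 7 (by norm_num), e7]
      refine (runs_storeSign 2).mono le_rfl ?_
      rintro _ rfl
      rw [e7₃]
      have hval : m₃.real 11 0 = I.score W (I.ell s) i := by
        rw [h₃.acc]
        exact score_congr (fun v hv => by rw [setNat_real, h1, href v hv]) i
      have hreal2 : m₃.real 2 = m'.real 2 := h₃.frame.2 2 (by norm_num)
      refine ⟨(h₃.ready hR').setReal (by norm_num) _ _, ?_, ?_, fun v hv => ?_, fun v hv => ?_⟩
      · rw [setReal_nat, h₃.frame.1 8 (by norm_num)]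
        simpa [setNat_nat] using h8
      · rw [setReal_real, if_neg (by norm_num), h₃.frame.2 1 (by norm_num)]
        exact h1
      · rw [setReal_real, if_pos rfl, hreal2]
        by_cases hvi : v = i
        · rw [hvi, Function.update_self, hval, Input.seedLab, if_pos hlt]
        · rw [Function.update_of_ne hvi, h2 v (by omega)]
      · rw [setReal_real, if_pos rfl, Function.update_of_ne (by omega), hreal2, h3 v (by omega)]
    · simp only [NExpr.eval, e7, ebin] at hlt
      refine Runs.skip (by omega) ⟨hR', by simpa [setNat_nat] using h8, h1, fun v hv => ?_,
        fun v hv => h3 v (by omega)⟩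
      by_cases hvi : v = i
      · rw [setNat_real, h3 v (by omega), Input.seedLab, hvi, if_neg hlt]
      · exact h2 v (by omega)
  · simp only [NExpr.eval, NExpr.cost]
    nlinarith
  · rintro m' ⟨hR, -, -, h2, -⟩
    exact ⟨hR, h2⟩
  · rintro m₃ ⟨hR₃, h₃⟩
    refine (runs_copyProg (by norm_num)).mono le_rfl ?_
    rintro m₄ ⟨hr₄, hc₄, hn₄⟩
    refine ⟨⟨hR₃.toData.congr (hn₄ _ (by norm_num))
      (hn₄ _ (by norm_num)) (hn₄ _ (by norm_num)) (hn₄ _ (by norm_num)), by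
        rw [hc₄ 10 (by norm_num)]; exact hR₃.marks⟩, s, hsN, hsK, fun u hu => ?_⟩
    rw [hr₄ u hu, h₃ u hu]

/-- The labels of block `j + K` are overwritten in place. This is harmless, as the scores read only
the blocks `j, …, j + K - 1`. -/
theorem runs_propagateProg {B K Δ s : ℕ} (hR : Ready I B m) (hKB : K ≤ B)
    (hlab : ∀ u < I.N, m.real 1 u = I.seedLab B K s u)
    (hΔ : ∀ b, (I.bucket B b).length ≤ Δ) (hdeg : ∀ u, (I.nbrs u).length ≤ Δ) :
    Runs I (propagateProg K) m (10 + B * (25 + Δ * (scoreCost K Δ + 21))) fun m' =>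
      Ready I B m' ∧ ∀ u < I.N, m'.real 1 u = I.stageLab B K s (B - K) u := by
  have eB : (NExpr.sub (nvar 5) (.const K)).eval I m = B - K := by
    simp [NExpr.eval, hR.numBlocks]
  refine (Runs.loop (c := 4 + (6 + (10 + Δ * (scoreCost K Δ + 21)))) (fun j m' => Ready I B m' ∧
    ∀ u < I.N, m'.real 1 u = I.stageLab B K s j u) ⟨hR, hlab⟩ ?_).mono ?_ ?_
  · rintro j hj m' ⟨hR', hlab'⟩
    rw [eB] at hj
    have hbB : j + K < B := by omega
    have e9 : (m'.setNat 9 0 j).nat 9 0 = j := by simp [setNat_nat]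
    refine Runs.seq (Q := fun m'' => m'' = (m'.setNat 9 0 j).setNat 8 0 j)
      (Runs.setNat (by simp [NExpr.eval, e9]) (by simp [NExpr.cost])) ?_
    rintro _ rfl
    refine Runs.seq (Q := fun m'' => m'' = ((m'.setNat 9 0 j).setNat 8 0 j).setNat 10 0 (j + K))
      (Runs.setNat (by simp [NExpr.eval, setNat_nat]) (by simp [NExpr.cost])) ?_
    rintro _ rfl
    set m₀ := ((m'.setNat 9 0 j).setNat 8 0 j).setNat 10 0 (j + K) with hm₀
    have hR₀ : Ready I B m₀ :=
      ((hR'.setNat (by norm_num) _ _).setNat (by norm_num) _ _).setNat (by norm_num) _ _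
    set l := I.bucket B (j + K) with hl
    have ecount : (NExpr.read 2 (.add (nvar 9) (.const K))).eval I m₀ = l.length := by
      have : m₀.nat 9 0 = j := by simp [hm₀, setNat_nat]
      simp only [NExpr.eval, this]
      exact hR₀.count _ hbB
    refine (Runs.loop (c := scoreCost K Δ + 20) (fun r m'' => Ready I B m'' ∧ m''.nat 8 0 = j ∧
      m''.nat 10 0 = j + K + r * B ∧ ∀ u < I.N, m''.real 1 u = if u ∈ l.take r then
        sg (I.score (I.window B j K) (I.stageLab B K s j) u) else I.stageLab B K s j u)
        ?_ ?_).mono ?_ ?_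
    · refine ⟨hR₀, by simp [hm₀, setNat_nat], by simp [hm₀, setNat_nat], fun u hu => ?_⟩
      simpa [hm₀] using hlab' u hu
    · rintro r hr m'' ⟨hR₁, h8, h10, hlab₁⟩
      rw [ecount] at hr
      set v := l[r] with hv
      have hvl : v ∈ l := List.getElem_mem hr
      have hvN := (mem_bucket.1 hvl).1
      have hvb := (mem_bucket.1 hvl).2
      refine Runs.mono (c := 5 + (scoreCost K Δ + (8 + 7))) ?_ (by omega) fun _ => id
      set m₁ := m''.setNat 11 0 r with hm₁
      have hR₁' : Ready I B m₁ := hR₁.setNat (by norm_num) _ _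
      have e10 : m₁.nat 10 0 = j + K + r * B := by simp [hm₁, setNat_nat, h10]
      refine Runs.seq (Q := fun m' => m' = m₁.setNat 7 0 v) (Runs.setNat ?_ ?_) ?_
      · simp only [NExpr.eval, e10]
        rw [hR₁'.list _ hbB r hr, ← hl, List.getD_eq_getElem _ _ hr]
      · simp [NExpr.cost]
      rintro _ rfl
      set m₂ := m₁.setNat 7 0 v with hm₂
      have hR₂ : Ready I B m₂ := hR₁'.setNat (by norm_num) _ _
      have e7 : m₂.nat 7 0 = v := by simp [hm₂, setNat_nat]
      have e8 : m₂.nat 8 0 = j := by simp [hm₂, hm₁, setNat_nat, h8]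
      refine Runs.seq (runs_scoreProg hR₂.toData hR₂.marks e7 e8 (by omega) hΔ (hdeg _)) ?_
      intro m₃ h₃
      have hR₃ := h₃.ready hR₂
      refine Runs.seq (runs_storeSign 1) ?_
      rintro _ rfl
      -- No node of the window lies in block `j + K`, so the labels already changed do not enter
      -- this score.
      have hval : m₃.real 11 0 = I.score (I.window B j K) (I.stageLab B K s j) v := by
        rw [h₃.acc]
        refine score_congr (fun w hw => ?_) v
        obtain ⟨hwN, t, ht, hwb⟩ := mem_window.1 hw
        rw [hm₂, hm₁, setNat_real, setNat_real, hlab₁ w hwN, if_neg]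
        intro hwl
        have := (mem_bucket.1 (List.mem_of_mem_take hwl)).2
        rw [Nat.mod_eq_of_lt (by omega)] at hwb
        omega
      have e7₃ : m₃.nat 7 0 = v := by rw [h₃.frame.1 7 (by norm_num), e7]
      have e10₃ : m₃.nat 10 0 = j + K + r * B := by
        rw [h₃.frame.1 10 (by norm_num)]
        simpa [hm₂, setNat_nat] using e10
      have e5₃ : m₃.nat 5 0 = B := hR₃.numBlocks
      have e1₃ : m₃.real 1 = m''.real 1 := h₃.frame.2 1 (by norm_num)
      refine Runs.setNat ?_ (by simp [NExpr.cost])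
      refine ⟨(hR₃.setReal (by norm_num) _ _).setNat (by norm_num) _ _, ?_, ?_, fun u hu => ?_⟩
      · simp only [setNat_nat, Nat.reduceEqDiff, if_false, setReal_nat]
        rw [h₃.frame.1 8 (by norm_num), e8]
      · simp only [NExpr.eval, setReal_nat, setNat_nat, if_true, Function.update_self, e10₃, e5₃]
        ring
      · rw [setNat_real, setReal_real, if_pos rfl, e7₃, hval, e1₃, List.take_add_one,
          List.getElem?_eq_getElem hr]
        by_cases huv : u = v
        · rw [huv, Function.update_self, if_pos]
          exact List.mem_append_right _ (by simp [hv])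
        · rw [Function.update_of_ne huv, hlab₁ u hu]
          have : u ∈ l.take r ↔ u ∈ l.take r ++ (some l[r]).toList := by
            simp [← hv, huv]
          simp only [← this]
    · rw [ecount]
      have := hΔ (j + K)
      rw [← hl] at this
      simp only [NExpr.cost]
      nlinarith
    · rintro m'' ⟨hR₁, -, -, hlab₁⟩
      refine ⟨hR₁, fun u hu => ?_⟩
      rw [hlab₁ u hu, ecount, List.take_length, Input.stageLab]
      simp only [hl, mem_bucket, hu, true_and]
  · rw [eB]
    simp only [NExpr.cost]
    set X := Δ * (scoreCost K Δ + 21)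
    have h1 : (B - K) * (4 + (6 + (10 + X)) + 1) ≤ B * (25 + X) :=
      Nat.mul_le_mul (Nat.sub_le _ _) (by omega)
    omega
  · rintro m' ⟨h1, h2⟩
    rw [eB] at h2
    exact ⟨h1, h2⟩

/-- The results go to integer array 0, and array 1 is never written: every final score uses the
labels of the propagation, not those already refined. -/
theorem runs_refineProg {B D Δ : ℕ} (hR : Ready I B m) (hDB : 2 * D + 1 ≤ B)
    (hbin : ∀ u < I.N, I.bin B u < B)
    (hΔ : ∀ b, (I.bucket B b).length ≤ Δ) (hdeg : ∀ u, (I.nbrs u).length ≤ Δ) :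
    Runs I (refineProg D) m (2 + I.N * (30 + scoreCost (2 * D + 1) Δ)) fun m' =>
      ∀ u < I.N, (m'.nat 0 u = 0 ↔
        ¬ 0 < I.score (I.window B (I.start B D u) (2 * D + 1)) (m.real 1) u) := by
  refine (Runs.loop (c := 15 + (scoreCost (2 * D + 1) Δ + 8)) (fun i m' => Ready I B m' ∧
    m'.real 1 = m.real 1 ∧ ∀ u < i, (m'.nat 0 u = 0 ↔
        ¬ 0 < I.score (I.window B (I.start B D u) (2 * D + 1)) (m.real 1) u))
      ⟨hR, rfl, by simp⟩ ?_).mono ?_ ?_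
  · rintro i hi m' ⟨hR', h1, h2⟩
    simp only [NExpr.eval] at hi
    set m₁ := m'.setNat 7 0 i with hm₁
    have hR₁ : Ready I B m₁ := hR'.setNat (by norm_num) _ _
    have e7 : m₁.nat 7 0 = i := by simp [hm₁, setNat_nat]
    have ebin : m₁.nat 1 i = I.bin B i := hR₁.bin i hi
    refine Runs.seq (Q := fun m' => m' = m₁.setNat 8 0 (I.start B D i))
      (Runs.mono (c := 5 + 10) (Runs.ifNatLt (fun hlt => Runs.setNat ?_ ?_)
      fun hlt => Runs.setNat ?_ ?_) le_rfl fun _ => id) ?_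
    · simp only [NExpr.eval, e7, ebin, hR₁.numBlocks] at hlt ⊢
      rw [Input.start, if_pos hlt]
    · simp [NExpr.cost]
    · simp only [NExpr.eval, e7, ebin] at hlt ⊢
      rw [Input.start, if_neg hlt]
    · simp [NExpr.cost]
    rintro _ rfl
    have hR₂ : Ready I B (m₁.setNat 8 0 (I.start B D i)) := hR₁.setNat (by norm_num) _ _
    -- The window wraps around at most once, as the single conditional subtraction requires.
    have hst : I.start B D i + (2 * D + 1) ≤ 2 * B := by
      have := hbin i hi
      unfold Input.start
      split_ifs <;> omega
    refine Runs.seq (runs_scoreProg hR₂.toData hR₂.marks (u := i) (st := I.start B D i)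
      (by simp [setNat_nat, e7]) (by simp [setNat_nat]) hst hΔ (hdeg _)) ?_
    intro m₃ h₃
    have e7₃ : m₃.nat 7 0 = i := by
      rw [h₃.frame.1 7 (by norm_num)]
      simp [setNat_nat, e7]
    have e1₃ : m₃.real 1 = m.real 1 := by
      rw [h₃.frame.2 1 (by norm_num)]
      exact h1
    have e0₃ : m₃.nat 0 = m'.nat 0 := by
      rw [h₃.frame.1 0 (by norm_num)]
      simp [setNat_nat, hm₁]
    have hacc : m₃.real 11 0 =
        I.score (I.window B (I.start B D i) (2 * D + 1)) (m.real 1) i := by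
      rw [h₃.acc, setNat_real, hm₁, setNat_real, h1]
    have hR₃ := h₃.ready hR₂
    have hfin : ∀ k, (k = 0 ↔ ¬ 0 < m₃.real 11 0) → Ready I B (m₃.setNat 0 i k) ∧
        (m₃.setNat 0 i k).real 1 = m.real 1 ∧ ∀ u < i + 1, ((m₃.setNat 0 i k).nat 0 u = 0 ↔
        ¬ 0 < I.score (I.window B (I.start B D u) (2 * D + 1)) (m.real 1) u) := by
      intro k hk
      refine ⟨⟨hR₃.toData.congr ?_ ?_ ?_ ?_, hR₃.marks⟩, e1₃, fun u hu => ?_⟩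
      · simp [setNat_nat]
      · simp [setNat_nat]
      · simp [setNat_nat]
      · simp [setNat_nat]
      · rw [setNat_nat, if_pos rfl]
        by_cases hui : u = i
        · rw [hui, Function.update_self, hk, hacc]
        · rw [Function.update_of_ne hui, e0₃]
          exact h2 u (by omega)
    refine Runs.mono (c := 4 + 4) (Runs.ifRealLt (fun hlt => Runs.setNat ?_ ?_)
      fun hlt => Runs.setNat ?_ ?_) le_rfl fun _ => id
    · simp only [NExpr.eval, RExpr.eval, Rat.cast_zero, e7₃] at hlt ⊢
      exact hfin 1 (by simp [hlt])
    · simp [NExpr.cost]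
    · simp only [NExpr.eval, RExpr.eval, Rat.cast_zero, e7₃] at hlt ⊢
      exact hfin 0 (by simpa using hlt)
    · simp [NExpr.cost]
  · simp only [NExpr.eval, NExpr.cost]
    nlinarith
  · rintro m' ⟨-, -, h⟩
    exact h

/-- What the algorithm computes, and the number of its steps. -/
theorem recoveryProg_spec {M K D B Δ : ℕ} (hB : I.numBlocks M = B)
    (hbin : ∀ u < I.N, I.bin B u < B) (hseed : ∃ u < I.N, I.bin B u < K) (hKB : K ≤ B)
    (hDB : 2 * D + 1 ≤ B) (hΔ : ∀ b, (I.bucket B b).length ≤ Δ)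
    (hdeg : ∀ u, (I.nbrs u).length ≤ Δ) :
    (∃ s < I.N, I.bin B s < K ∧ ∀ u : Fin I.N, (recoveryProg M K D).output I u =
      if 0 < I.score (I.window B (I.start B D u) (2 * D + 1)) (I.stageLab B K s (B - K)) u
      then 1 else -1) ∧
    (recoveryProg M K D).steps I ≤
      300 * (I.N + B * (Δ + 1) + 1) * (Nat.size B + scoreCost (K + 2 * D + 1) Δ) := by
  subst hB
  set B := I.numBlocks M with hB
  have hrun : Runs I (recoveryProg M K D) Memory.init
      ((20 + 6 * B + (61 + Nat.size B) * I.N + Nat.size B) +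
        ((20 + 30 * I.N + scoreCost K Δ + I.N * scoreCost K Δ) +
          ((10 + B * (25 + Δ * (scoreCost K Δ + 21))) +
            (2 + I.N * (30 + scoreCost (2 * D + 1) Δ)))))
      fun m' => ∃ s < I.N, I.bin B s < K ∧ ∀ u < I.N, (m'.nat 0 u = 0 ↔
        ¬ 0 < I.score (I.window B (I.start B D u) (2 * D + 1)) (I.stageLab B K s (B - K)) u) := by
    refine Runs.seq (runs_divideProg hbin) fun m₁ h₁ => ?_
    refine Runs.seq (runs_seedProg h₁ hseed hKB hΔ hdeg) ?_
    rintro m₂ ⟨hR₂, s, hsN, hsK, hlab⟩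
    refine Runs.seq (runs_propagateProg hR₂ hKB hlab hΔ hdeg) ?_
    rintro m₃ ⟨hR₃, hlab₃⟩
    refine (runs_refineProg hR₃ hDB hbin hΔ hdeg).mono le_rfl fun m₄ h₄ => ?_
    refine ⟨s, hsN, hsK, fun u hu => ?_⟩
    rw [h₄ u hu, score_congr fun v hv => hlab₃ v (mem_window.1 hv).1]
  obtain ⟨⟨s, hsN, hsK, h⟩, hsteps⟩ := hrun
  refine ⟨⟨s, hsN, hsK, fun u => ?_⟩, hsteps.trans ?_⟩
  · rw [Program.output]
    by_cases h0 : 0 < I.score (I.window B (I.start B D u) (2 * D + 1)) (I.stageLab B K s (B - K)) u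
    · rw [if_pos h0, if_neg fun hc => (h u u.2).1 hc h0]
    · rw [if_neg h0, if_pos ((h u u.2).2 h0)]
  · have h1 : scoreCost K Δ ≤ scoreCost (K + 2 * D + 1) Δ := by
      unfold scoreCost
      gcongr
      omega
    have h2 : scoreCost (2 * D + 1) Δ ≤ scoreCost (K + 2 * D + 1) Δ := by
      unfold scoreCost
      gcongr
      omega
    have h3 : 100 ≤ scoreCost (K + 2 * D + 1) Δ := by
      unfold scoreCost
      nlinarith [Nat.zero_le ((K + 2 * D + 1) * Δ)]
    set S := scoreCost (K + 2 * D + 1) Δ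
    set z := Nat.size B
    have e1 : I.N * scoreCost K Δ ≤ I.N * S := Nat.mul_le_mul_left _ h1
    have e2 : I.N * scoreCost (2 * D + 1) Δ ≤ I.N * S := Nat.mul_le_mul_left _ h2
    have e3 : B * (Δ * scoreCost K Δ) ≤ B * (Δ * S) := by gcongr
    have e4 : B * Δ * 100 ≤ B * Δ * S := by gcongr
    have e5 : B * 100 ≤ B * S := by gcongr
    have e6 : I.N * 100 ≤ I.N * S := by gcongr
    have e7 : 0 ≤ B * Δ * z := Nat.zero_le _
    have e8 : 0 ≤ B * z := Nat.zero_le _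
    have e9 : 0 ≤ I.N * z := Nat.zero_le _
    clear hsteps
    -- The costs become atoms, so that only the inequalities collected above are used.
    generalize scoreCost K Δ = S₁ at *
    generalize scoreCost (2 * D + 1) Δ = S₂ at *
    ring_nf at e3 e4 ⊢
    nlinarith

end Correctness

/-! ### Deterministic analysis -/

section Deterministic

open Classical

variable {ι : Type*} {e : ι → ι → ℝ} {σ : ι → ℝ} {C : ℝ}

/-- The label of node `v` is wrong. -/
def Wrong (g : ℝ) (σ lab : ι → ℝ) (v : ι) : Prop := lab v ≠ g * σ v

/-- A wrong label is the opposite sign, so it changes its term by at most `2 * C`. -/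
theorem perturbed_score (hσ : ∀ v, σ v = 1 ∨ σ v = -1) (hC : ∀ u v, |e u v| ≤ C) {g : ℝ}
    (hg : g = 1 ∨ g = -1) (R : Finset ι) {lab : ι → ℝ} (hlab : ∀ v ∈ R, lab v = 1 ∨ lab v = -1)
    (u : ι) :
    σ u * (∑ v ∈ R, σ v * e u v) - 2 * C * (R.filter (Wrong g σ lab)).card ≤
      g * σ u * ∑ v ∈ R, lab v * e u v := by
  have key : ∑ v ∈ R, (σ u * (σ v * e u v) - if Wrong g σ lab v then 2 * C else 0) ≤
      ∑ v ∈ R, g * σ u * (lab v * e u v) := by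
    refine Finset.sum_le_sum fun v hv => ?_
    have he := abs_le.1 (hC u v)
    by_cases h : lab v = g * σ v
    · rw [if_neg (show ¬ Wrong g σ lab v from not_not.2 h), h, sub_zero]
      rcases hg with rfl | rfl <;> linarith
    · rw [if_pos (show Wrong g σ lab v from h)]
      rcases hg with rfl | rfl <;> rcases hσ u with h1 | h1 <;> rcases hσ v with h2 | h2 <;>
        rcases hlab v hv with h3 | h3 <;> rw [h1, h2, h3] <;> linarith
  rw [Finset.sum_sub_distrib, ← Finset.mul_sum, ← Finset.mul_sum, ← Finset.sum_filter,
    Finset.sum_const, nsmul_eq_mul] at key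
  linarith

theorem sg_eq (x : ℝ) : sg x = 1 ∨ sg x = -1 := by
  unfold sg
  split_ifs <;> simp

/-- A wrong sign includes the tie `x = 0`, whence the weak inequality here and the strict ones in
the separation hypotheses. -/
theorem sg_ne {x a : ℝ} (ha : a = 1 ∨ a = -1) (h : sg x ≠ a) : a * x ≤ 0 := by
  unfold sg at h
  split_ifs at h with h1
  · rcases ha with rfl | rfl
    · exact absurd rfl h
    · linarith
  · rcases ha with rfl | rfl
    · linarith
    · exact absurd rfl h

/-- The labels relative to a node of the first blocks are right. -/
theorem seed_labels [DecidableEq ι] (hσ : ∀ v, σ v = 1 ∨ σ v = -1) (hC : ∀ u v, |e u v| ≤ C)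
    (W : Finset ι) (s : ι)
    (hs : s ∈ W) (hself : ∀ u, e u u ≠ 0)
    (hsep : ∀ u ∈ W, u ≠ s → 2 * C ^ 2 <
      σ s * σ u * ∑ w ∈ (W.erase u).erase s, e s w * e u w) (u : ι) (hu : u ∈ W) :
    sg (∑ w ∈ W, e s w * e u w) = σ s * σ u := by
  by_cases hus : u = s
  · subst hus
    -- For `u = s` the score is a sum of squares, one of which is positive.
    have h1 : σ u * σ u = 1 := by rcases hσ u with h | h <;> rw [h] <;> norm_num
    rw [h1, sg, if_pos]
    refine Finset.sum_pos' (fun w _ => mul_self_nonneg _) ⟨u, hu, ?_⟩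
    exact mul_self_pos.2 (hself u)
  · by_contra hne
    have hss : σ s * σ u = 1 ∨ σ s * σ u = -1 := by
      rcases hσ s with h | h <;> rcases hσ u with h' | h' <;> rw [h, h'] <;> norm_num
    have hneg := sg_ne hss hne
    have h1 := hsep u hu hus
    -- The terms `w = u` and `w = s` both involve the pair `s`, `u`; they are split off to keep the
    -- rest a sum over distinct links, and cost at most `C²` each.
    rw [← Finset.add_sum_erase _ _ hu,
      ← Finset.add_sum_erase _ _ (Finset.mem_erase.2 ⟨Ne.symm hus, hs⟩)] at hneg
    have hb : ∀ w, |e s w * e u w| ≤ C ^ 2 := by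
      intro w
      rw [abs_mul, pow_two]
      exact mul_le_mul (hC _ _) (hC _ _) (abs_nonneg _) ((abs_nonneg _).trans (hC s w))
    have hb1 := abs_le.1 (hb u)
    have hb2 := abs_le.1 (hb s)
    rcases hss with h | h <;> rw [h] at hneg h1 <;> linarith

variable [Fintype ι]

theorem card_union_blocks_le (bin : ι → ℕ) (bad : ι → Prop) {μ : ℝ} (T : Finset ℕ)
    (h : ∀ b ∈ T, ((Finset.univ.filter fun v => bin v = b ∧ bad v).card : ℝ) ≤ μ)
    (R : Finset ι) (hR : ∀ v ∈ R, bin v ∈ T) :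
    ((R.filter bad).card : ℝ) ≤ T.card * μ := by
  have h1 : R.filter bad ⊆ T.biUnion fun b => Finset.univ.filter fun v => bin v = b ∧ bad v := by
    intro v hv
    rw [Finset.mem_filter] at hv
    simp only [Finset.mem_biUnion, Finset.mem_filter, Finset.mem_univ, true_and]
    exact ⟨bin v, hR v hv.1, rfl, hv.2⟩
  have h2 := (Finset.card_le_card h1).trans Finset.card_biUnion_le
  calc ((R.filter bad).card : ℝ)
      ≤ ∑ b ∈ T, ((Finset.univ.filter fun v => bin v = b ∧ bad v).card : ℝ) := by exact_mod_cast h2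
    _ ≤ ∑ _b ∈ T, μ := Finset.sum_le_sum h
    _ = T.card * μ := by simp

variable (bin : ι → ℕ) (K B : ℕ)

/-- The nodes in the `K` blocks from block `j` on. -/
def blockRange (j : ℕ) : Finset ι := Finset.univ.filter fun v => j ≤ bin v ∧ bin v < j + K

/-- If the labels of the first blocks are right, and most nodes in each block are well separated
by the preceding `K` blocks, then the labels of all blocks have few mistakes. -/
theorem few_mistakes (hσ : ∀ v, σ v = 1 ∨ σ v = -1) (hC : ∀ u v, |e u v| ≤ C) (hC0 : 0 ≤ C) {g : ℝ}
    (hg : g = 1 ∨ g = -1) {μ : ℝ} (hμ : 0 ≤ μ) {lab : ℕ → ι → ℝ}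
    (h0 : ∀ u, bin u < K → lab 0 u = g * σ u)
    (hstep : ∀ j u, lab (j + 1) u = if bin u = j + K then
      sg (∑ v ∈ blockRange bin K j, lab j v * e u v) else lab j u)
    (hsep : ∀ j, j + K < B → ((Finset.univ.filter fun u => bin u = j + K ∧
      σ u * (∑ v ∈ blockRange bin K j, σ v * e u v) ≤ 2 * C * (K * μ)).card : ℝ) ≤ μ) :
    ∀ j, j + K ≤ B → (∀ u, bin u < j + K → lab j u = 1 ∨ lab j u = -1) ∧
      ∀ b < j + K, ((Finset.univ.filter fun v => bin v = b ∧ Wrong g σ (lab j) v).card : ℝ) ≤ μ := by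
  have hgσ : ∀ u, g * σ u = 1 ∨ g * σ u = -1 := by
    intro u
    rcases hg with rfl | rfl <;> rcases hσ u with h | h <;> rw [h] <;> norm_num
  intro j
  induction j with
  | zero =>
    intro _
    rw [zero_add]
    refine ⟨fun u hu => by rw [h0 u hu]; exact hgσ u, fun b hb => ?_⟩
    rw [Finset.filter_false_of_mem]
    · simpa using hμ
    · rintro v - ⟨hv, hne⟩
      exact hne (h0 v (by omega))
  | succ j ih =>
    intro hj
    obtain ⟨ih1, ih2⟩ := ih (by omega)
    refine ⟨fun u hu => ?_, fun b hb => ?_⟩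
    · rw [hstep]
      split_ifs with h
      · exact sg_eq _
      · exact ih1 u (by omega)
    · by_cases hbj : b = j + K
      · subst hbj
        refine le_trans ?_ (hsep j (by omega))
        refine Nat.cast_le.2 (Finset.card_le_card fun u hu => ?_)
        simp only [Finset.mem_filter, Finset.mem_univ, true_and] at hu ⊢
        refine ⟨hu.1, ?_⟩
        -- A mislabelled node has a nonpositive perturbed score. The window holds at most `K * μ`
        -- mistakes, so the score with the true labels is at most `2 * C * (K * μ)`, and the node is
        -- counted by `hsep`.
        have hne : lab (j + 1) u ≠ g * σ u := hu.2
        rw [hstep, if_pos hu.1] at hne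
        have hneg := sg_ne (hgσ u) hne
        have hpert := perturbed_score hσ hC hg (blockRange bin K j) (lab := lab j)
          (fun v hv => ih1 v (by simp [blockRange] at hv; omega)) u
        have hcard := card_union_blocks_le bin (Wrong g σ (lab j)) (μ := μ)
          (Finset.Ico j (j + K)) (fun b hb => ih2 b (by simp at hb; omega)) (blockRange bin K j)
          (fun v hv => by simpa [blockRange] using hv)
        rw [Nat.card_Ico, Nat.add_sub_cancel_left] at hcard
        have := mul_le_mul_of_nonneg_left hcard (by positivity : 0 ≤ 2 * C)
        linarith
      · refine le_trans (le_of_eq ?_) (ih2 b (by omega))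
        congr 2
        ext v
        simp only [Finset.mem_filter, Finset.mem_univ, true_and]
        refine and_congr_right fun hv => ?_
        rw [Wrong, Wrong, hstep, if_neg (by omega)]

/-- If there are few mistakes near `u`, then the refined label of `u` is right. -/
theorem refined_label [DecidableEq ι] (hσ : ∀ v, σ v = 1 ∨ σ v = -1)
    (hC : ∀ u v, |e u v| ≤ C) (hC0 : 0 ≤ C) {g : ℝ}
    (hg : g = 1 ∨ g = -1) {μ : ℝ} {lab : ι → ℝ} (hlab : ∀ v, lab v = 1 ∨ lab v = -1)
    (hmist : ∀ b, ((Finset.univ.filter fun v => bin v = b ∧ Wrong g σ lab v).card : ℝ) ≤ μ)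
    (u : ι) (R : Finset ι) (T : Finset ℕ) (hR : ∀ v ∈ R, bin v ∈ T)
    (hout : ∀ v, v ∉ R → e u v = 0)
    (hsep : C + 2 * C * (T.card * μ) < σ u * ∑ v ∈ Finset.univ.erase u, σ v * e u v) :
    0 < g * σ u * ∑ v ∈ R, lab v * e u v := by
  have hpert := perturbed_score hσ hC hg R (lab := lab) (fun v _ => hlab v) u
  have hcard := card_union_blocks_le bin (Wrong g σ lab) T (fun b _ => hmist b) R hR
  have hc := mul_le_mul_of_nonneg_left hcard (by positivity : 0 ≤ 2 * C)
  have hall : ∑ v ∈ R, σ v * e u v = ∑ v, σ v * e u v := by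
    refine Finset.sum_subset (Finset.subset_univ R) fun v _ hv => ?_
    rw [hout v hv, mul_zero]
  rw [hall, ← Finset.add_sum_erase _ _ (Finset.mem_univ u)] at hpert
  -- The pair of `u` with itself is in the computed score but not in `hsep`; its term accounts for
  -- the summand `C` there.
  have h1 : -C ≤ σ u * (σ u * e u u) := by
    have := abs_le.1 (hC u u)
    rcases hσ u with h | h <;> rw [h] <;> linarith
  rw [mul_add] at hpert
  linarith

end Deterministic

/-! ### The scores as sums over the nodes -/

section Sums

open Classical

variable {I : Input}

theorem score_eq_sum {l : List ℕ} (hl : l.Nodup) (hN : ∀ v ∈ l, v < I.N) (f : ℕ → ℝ) (u : ℕ)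
    {R : Finset (Fin I.N)} (hR : ∀ v : Fin I.N, v ∈ R ↔ (v : ℕ) ∈ l) :
    I.score l f u = ∑ v ∈ R, f v * I.ell u v := by
  unfold Input.score
  rw [← List.sum_toFinset _ hl]
  symm
  refine Finset.sum_bij (fun v _ => (v : ℕ)) ?_ ?_ ?_ ?_
  · intro v hv
    simpa using (hR v).1 hv
  · intro a _ b _ h
    exact Fin.ext h
  · intro v hv
    rw [List.mem_toFinset] at hv
    exact ⟨⟨v, hN v hv⟩, (hR _).2 hv, rfl⟩
  · intro v _
    rfl

theorem window_nodup {B st len : ℕ} (hB : len ≤ B) : (I.window B st len).Nodup := by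
  unfold Input.window
  rw [List.nodup_flatMap]
  refine ⟨fun t _ => List.nodup_range.filter _, ?_⟩
  refine List.nodup_range.pairwise_of_forall_ne ?_
  intro t ht t' ht' hne
  rw [List.mem_range] at ht ht'
  intro v hv hv'
  have h1 := (mem_bucket.1 hv).2
  have h2 := (mem_bucket.1 hv').2
  rw [h1] at h2
  have h3 : t ≡ t' [MOD B] := Nat.ModEq.add_left_cancel' st h2
  exact hne (h3.eq_of_lt_of_lt (by omega) (by omega))

theorem score_window {B st len : ℕ} (hB : st + len ≤ B) (f : ℕ → ℝ) (u : ℕ) :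
    I.score (I.window B st len) f u =
      ∑ v ∈ blockRange (fun v : Fin I.N => I.bin B v) len st, f v * I.ell u v := by
  refine score_eq_sum (window_nodup (by omega)) (fun v hv => (mem_window.1 hv).1) f u fun v => ?_
  simp only [blockRange, Finset.mem_filter, Finset.mem_univ, true_and, mem_window, v.2]
  constructor
  · rintro ⟨h1, h2⟩
    exact ⟨I.bin B v - st, by omega, by rw [Nat.mod_eq_of_lt (by omega)]; omega⟩
  · rintro ⟨t, ht, h⟩
    rw [Nat.mod_eq_of_lt (by omega)] at h
    omega

end Sums

/-! ### Samples on which the algorithm succeeds -/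

section GoodSamples

open Classical

/-- The number of the block of a point of the torus. -/
def blk (B : ℕ) (y : ℝ) : ℕ := ⌊(1 / 2 - y) * B⌋₊

/-- The log-likelihood ratio of a pair of nodes. -/
def pairLlr (p q : ℝ) (φ : ℝ≥0 → unitInterval) (n : ℕ) {N : ℕ} (x : Fin N → ℝ)
    (G : SimpleGraph (Fin N)) (u v : Fin N) : ℝ :=
  llr p q (psi φ n (x u) (x v)) (decide (G.Adj u v))

/-- A community label as a real number. -/
def lbl {N : ℕ} (σ : Fin N → ℤˣ) (u : Fin N) : ℝ := ((σ u : ℤ) : ℝ)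

theorem lbl_eq {N : ℕ} (σ : Fin N → ℤˣ) (u : Fin N) : lbl σ u = 1 ∨ lbl σ u = -1 := by
  unfold lbl
  rcases Int.units_eq_one_or (σ u) with h | h <;> simp [h]

/-- The nodes in block `b`. -/
def inBlock (B : ℕ) {N : ℕ} (x : Fin N → ℝ) (b : ℕ) : Finset (Fin N) :=
  Finset.univ.filter fun u => blk B (x u) = b

/-- The nodes in the `K` blocks from block `j` on. -/
def inBlocks (B K : ℕ) {N : ℕ} (x : Fin N → ℝ) (j : ℕ) : Finset (Fin N) :=
  blockRange (fun u => blk B (x u)) K j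

/-- Blocks are counted from the right end, which belongs to the torus while the left end does not.
So `1/2 - y` lies in `[0, 1)` and no end point needs special treatment. -/
theorem blk_lt {B : ℕ} (hB : 0 < B) {y : ℝ} (hy : y ∈ torus) : blk B y < B := by
  have hB' : (0 : ℝ) < B := Nat.cast_pos.2 hB
  obtain ⟨h1, h2⟩ := hy
  rw [blk, Nat.floor_lt (mul_nonneg (by linarith) hB'.le)]
  nlinarith

theorem blk_le {B : ℕ} {y : ℝ} (hy : y ∈ torus) : (blk B y : ℝ) ≤ (1 / 2 - y) * B :=
  Nat.floor_le (mul_nonneg (by linarith [hy.2]) (Nat.cast_nonneg _))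

theorem lt_blk_add_one (B : ℕ) (y : ℝ) : (1 / 2 - y) * B < blk B y + 1 := Nat.lt_floor_add_one _

/-- Points at small distance are in close blocks. -/
theorem blk_close {B D : ℕ} {x y c : ℝ} (hx : x ∈ torus) (hy : y ∈ torus)
    (hd : torusDist x y * B ≤ c) (hc : c + 1 ≤ D) :
    (blk B y ≤ blk B x + D ∧ blk B x ≤ blk B y + D) ∨ blk B y + B ≤ blk B x + D ∨
      blk B x + B ≤ blk B y + D := by
  have hB : (0 : ℝ) ≤ B := Nat.cast_nonneg _
  have x1 := blk_le (B := B) hx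
  have x2 := lt_blk_add_one B x
  have y1 := blk_le (B := B) hy
  have y2 := lt_blk_add_one B y
  have cast : ∀ a b : ℕ, (a : ℝ) < b + 1 → a ≤ b := fun a b h => by
    have : a < b + 1 := by exact_mod_cast h
    omega
  rcases min_choice |x - y| (1 - |x - y|) with h | h
  · rw [torusDist, h] at hd
    have h1 : (x - y) * B ≤ c := (mul_le_mul_of_nonneg_right (le_abs_self _) hB).trans hd
    have h2 : -(x - y) * B ≤ c := (mul_le_mul_of_nonneg_right (neg_le_abs _) hB).trans hd
    left
    constructor <;> apply cast <;> push_cast <;> linarith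
  · rw [torusDist, h] at hd
    right
    rcases abs_choice (x - y) with h' | h' <;> rw [h'] at hd
    · right
      apply cast
      push_cast
      linarith
    · left
      apply cast
      push_cast
      linarith

/-- The window of the refinement starts `D` blocks before `b`, modulo `B`; the case distinction is
needed since subtraction is truncated. The three alternatives are closeness without wrapping and
across either side of the cut. -/
theorem exists_window_index {b b' B D : ℕ} (hb : b < B) (hb' : b' < B) (hD : 2 * D + 1 ≤ B)
    (h : (b' ≤ b + D ∧ b ≤ b' + D) ∨ b' + B ≤ b + D ∨ b + B ≤ b' + D) :
    ∃ t < 2 * D + 1, b' = ((if b < D then b + B - D else b - D) + t) % B := by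
  have wrap : ∀ a, a = b' + B → b' = a % B := by
    rintro _ rfl
    rw [Nat.add_mod_right, Nat.mod_eq_of_lt hb']
  have plain : ∀ a, a = b' → b' = a % B := by
    rintro _ rfl
    rw [Nat.mod_eq_of_lt hb']
  split_ifs with hbD
  · rcases h with h | h | h
    · exact ⟨b' + D - b, by omega, wrap _ (by omega)⟩
    · omega
    · exact ⟨b' - (b + B - D), by omega, plain _ (by omega)⟩
  · rcases h with h | h | h
    · exact ⟨b' + D - b, by omega, plain _ (by omega)⟩
    · exact ⟨b' + B + D - b, by omega, wrap _ (by omega)⟩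
    · omega

variable {lam p q : ℝ} {φ : ℝ≥0 → unitInterval} {n : ℕ}

/-- The conditions under which the algorithm succeeds. -/
structure Good (p q : ℝ) (φ : ℝ≥0 → unitInterval) (n B K D d : ℕ) (μ : ℝ) (ω : Sample) : Prop where
  mem_torus : ∀ u, ω.X u ∈ torus
  nonempty : (inBlocks B K ω.X 0).Nonempty
  card_le : ∀ b, (inBlock B ω.X b).card ≤ d
  adj : ∀ u v, ω.G.Adj u v → psi φ n (ω.X u) (ω.X v) ≠ 0
  seed : ∀ s ∈ inBlocks B K ω.X 0, ∀ u ∈ inBlocks B K ω.X 0, u ≠ s → 2 * llrBound p q ^ 2 <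
    lbl ω.σ s * lbl ω.σ u * ∑ w ∈ ((inBlocks B K ω.X 0).erase u).erase s,
      pairLlr p q φ n ω.X ω.G s w * pairLlr p q φ n ω.X ω.G u w
  propagate : ∀ j, j + K < B → ((Finset.univ.filter fun u => blk B (ω.X u) = j + K ∧
    lbl ω.σ u * (∑ v ∈ inBlocks B K ω.X j, lbl ω.σ v * pairLlr p q φ n ω.X ω.G u v) ≤
      2 * llrBound p q * (K * μ)).card : ℝ) ≤ μ
  refine : ∀ u, llrBound p q + 2 * llrBound p q * ((2 * D + 1) * μ) <
    lbl ω.σ u * ∑ v ∈ Finset.univ.erase u, lbl ω.σ v * pairLlr p q φ n ω.X ω.G u v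

theorem toInput_bin (ω : Sample) (B : ℕ) (u : Fin ω.N) :
    (toInput lam p q φ n ω).bin B u = blk B (ω.X u) := by
  simp [Input.bin, blk, Input.loc, toInput]

theorem mem_toInput_nbrs (ω : Sample) (u v : ℕ) : v ∈ (toInput lam p q φ n ω).nbrs u ↔
    ∃ (hu : u < ω.N) (hv : v < ω.N), ω.G.Adj ⟨u, hu⟩ ⟨v, hv⟩ := by
  simp only [Input.nbrs, toInput, List.mem_filter, List.mem_range]
  exact ⟨fun h => of_decide_eq_true h.2, fun h => ⟨h.2.1, decide_eq_true h⟩⟩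

theorem toInput_ell (ω : Sample) (u v : Fin ω.N) :
    (toInput lam p q φ n ω).ell u v = pairLlr p q φ n ω.X ω.G u v := by
  have h : ((v : ℕ) ∈ (toInput lam p q φ n ω).nbrs u) ↔ ω.G.Adj u v := by
    rw [mem_toInput_nbrs]
    exact ⟨fun ⟨_, _, h⟩ => h, fun h => ⟨u.2, v.2, h⟩⟩
  unfold Input.ell pairLlr
  simp only [h]
  simp [Input.loc, toInput]

theorem toInput_bucket_length (ω : Sample) (B b : ℕ) :
    ((toInput lam p q φ n ω).bucket B b).length = (inBlock B ω.X b).card := by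
  have hnd : ((toInput lam p q φ n ω).bucket B b).Nodup := List.nodup_range.filter _
  rw [← List.toFinset_card_of_nodup hnd]
  symm
  refine Finset.card_bij (fun u _ => (u : ℕ)) ?_ ?_ ?_
  · intro u hu
    rw [List.mem_toFinset, mem_bucket, toInput_bin]
    exact ⟨u.2, by simpa [inBlock] using hu⟩
  · intro a _ b _ h
    exact Fin.ext h
  · intro v hv
    rw [List.mem_toFinset, mem_bucket] at hv
    refine ⟨⟨v, hv.1⟩, ?_, rfl⟩
    have := toInput_bin (lam := lam) (p := p) (q := q) (φ := φ) (n := n) ω B ⟨v, hv.1⟩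
    simp only [inBlock, Finset.mem_filter, Finset.mem_univ, true_and]
    rw [← this]
    exact hv.2

theorem abs_pairLlr_le (hq : 0 < q) (hqp : q < p) (hp : p < 1) {N : ℕ} (x : Fin N → ℝ)
    (G : SimpleGraph (Fin N)) (u v : Fin N) : |pairLlr p q φ n x G u v| ≤ llrBound p q :=
  abs_llr_le hq hqp hp (psi_nonneg ..) (psi_le_one ..) _

/-- A node is not linked to itself while the kernel is positive at `0`, so the ratio is that of a
missing link at a positive kernel value. This makes the reference node's score with itself positive.
-/
theorem pairLlr_self_ne_zero (hq : 0 < q) (hqp : q < p) (hp : p < 1)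
    (hκ_fin : interactionRange φ < ⊤)
    (hφ_pos : ∀ x : ℝ≥0, (x : ℝ≥0∞) ≤ interactionRange φ → 0 < φ x) {N : ℕ} (x : Fin N → ℝ)
    (G : SimpleGraph (Fin N)) (u : Fin N) : pairLlr p q φ n x G u u ≠ 0 := by
  have h0 : torusDist (x u) (x u) = 0 := by simp [torusDist]
  have hpos : 0 < psi φ n (x u) (x u) := by
    unfold psi
    rw [h0, mul_zero]
    exact kernel_pos hκ_fin hφ_pos ENNReal.toReal_nonneg
  unfold pairLlr
  rw [show decide (G.Adj u u) = false by simp]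
  exact (llr_false_neg hq hqp hp hpos (psi_le_one ..)).ne

theorem start_eq (I : Input) (B D u : ℕ) :
    I.start B D u = if I.bin B u < D then I.bin B u + B - D else I.bin B u - D := rfl

/-- On good samples, the algorithm succeeds and is fast. -/
theorem Good.spec {M B K D d : ℕ} {μ : ℝ} {ω : Sample} (h : Good p q φ n B K D d μ ω)
    (hq : 0 < q) (hqp : q < p) (hp : p < 1) (hκ_fin : interactionRange φ < ⊤)
    (hφ_pos : ∀ x : ℝ≥0, (x : ℝ≥0∞) ≤ interactionRange φ → 0 < φ x) (hμ : 0 ≤ μ)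
    (hn : 0 < (n : ℝ) / Real.log n)
    (hB : ⌊(M : ℝ) * n / Real.log n⌋₊ = B) (hKB : K ≤ B) (hDB : 2 * D + 1 ≤ B)
    (hD : (interactionRange φ).toReal * M + 1 ≤ D) :
    ((recoveryProg M K D).output (toInput lam p q φ n ω) = ω.σ ∨
      (recoveryProg M K D).output (toInput lam p q φ n ω) = -ω.σ) ∧
    (recoveryProg M K D).steps (toInput lam p q φ n ω) ≤
      300 * (ω.N + B * ((2 * D + 1) * d + 1) + 1) *
        (Nat.size B + scoreCost (K + 2 * D + 1) ((2 * D + 1) * d)) := by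
  set I := toInput lam p q φ n ω with hI
  have hB0 : 0 < B := by omega
  have hbin : ∀ u < I.N, I.bin B u < B := by
    intro u hu
    have := blk_lt hB0 (h.mem_torus ⟨u, hu⟩)
    rwa [← toInput_bin (lam := lam) (p := p) (q := q) (φ := φ) (n := n)] at this
  -- A nonzero kernel value means a rescaled distance of at most `κ`, that is, fewer than `κ M + 1 ≤
  -- D` blocks. The refinement thus sees every informative pair.
  have hwin : ∀ u v : Fin ω.N, psi φ n (ω.X u) (ω.X v) ≠ 0 →
      (v : ℕ) ∈ I.window B (I.start B D u) (2 * D + 1) := by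
    intro u v huv
    have hd : (n : ℝ) / Real.log n * torusDist (ω.X u) (ω.X v) ≤ (interactionRange φ).toReal := by
      by_contra hlt
      apply huv
      rw [psi, kernel_eq_zero hκ_fin (not_le.1 hlt)]
      rfl
    have hBM : (B : ℝ) ≤ M * ((n : ℝ) / Real.log n) := by
      rw [← hB, ← mul_div_assoc]
      exact Nat.floor_le (by rw [mul_div_assoc]; positivity)
    have hdist : 0 ≤ torusDist (ω.X u) (ω.X v) := by
      obtain ⟨a1, a2⟩ := h.mem_torus u
      obtain ⟨b1, b2⟩ := h.mem_torus v
      refine le_min (abs_nonneg _) (sub_nonneg.2 (abs_le.2 ⟨?_, ?_⟩)) <;> linarith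
    have hc : torusDist (ω.X u) (ω.X v) * B ≤ (interactionRange φ).toReal * M := by
      calc torusDist (ω.X u) (ω.X v) * B
          ≤ torusDist (ω.X u) (ω.X v) * (M * ((n : ℝ) / Real.log n)) := by gcongr
        _ = (n : ℝ) / Real.log n * torusDist (ω.X u) (ω.X v) * M := by ring
        _ ≤ _ := by gcongr
    have hcl := exists_window_index (blk_lt hB0 (h.mem_torus u)) (blk_lt hB0 (h.mem_torus v)) hDB
      (blk_close (h.mem_torus u) (h.mem_torus v) hc hD)
    rw [mem_window, start_eq, toInput_bin, toInput_bin]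
    exact ⟨v.2, hcl⟩
  have hΔ : ∀ b, (I.bucket B b).length ≤ (2 * D + 1) * d := by
    intro b
    rw [toInput_bucket_length]
    have := h.card_le b
    nlinarith
  -- Neighbours lie in the window of `2 * D + 1` blocks, each with at most `d` nodes.
  have hdeg : ∀ u, (I.nbrs u).length ≤ (2 * D + 1) * d := by
    intro u
    by_cases hu : u < ω.N
    · have hsub : I.nbrs u ⊆ I.window B (I.start B D u) (2 * D + 1) := by
        intro v hv
        obtain ⟨_, hvN, hadj⟩ := (mem_toInput_nbrs ω u v).1 hv
        exact hwin ⟨u, hu⟩ ⟨v, hvN⟩ (h.adj _ _ hadj)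
      have hnd : (I.nbrs u).Nodup := List.nodup_range.filter _
      refine (hnd.subperm hsub).length_le.trans ?_
      rw [Input.window, List.length_flatMap]
      refine (List.sum_le_card_nsmul _ d ?_).trans ?_
      · intro c hc
        rw [List.mem_map] at hc
        obtain ⟨t, -, rfl⟩ := hc
        rw [toInput_bucket_length]
        exact h.card_le _
      · simp
    · have : I.nbrs u = [] := by
        rw [List.eq_nil_iff_forall_not_mem]
        intro v hv
        exact hu ((mem_toInput_nbrs ω u v).1 hv).1
      simp [this]
  have hseed : ∃ u < I.N, I.bin B u < K := by
    obtain ⟨u, hu⟩ := h.nonempty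
    refine ⟨u, u.2, ?_⟩
    rw [toInput_bin]
    simpa [inBlocks, blockRange] using hu
  obtain ⟨⟨s, hsN, hsK, hout⟩, hsteps⟩ :=
    recoveryProg_spec (I := I) (M := M) (D := D) hB hbin hseed hKB hDB hΔ hdeg
  refine ⟨?_, hsteps⟩
  have hC := abs_pairLlr_le (φ := φ) (n := n) hq hqp hp ω.X ω.G
  have hC0 := (llrBound_pos hq hqp hp).le
  have hσ := lbl_eq ω.σ
  set e := pairLlr p q φ n ω.X ω.G with he
  set s' : Fin ω.N := ⟨s, hsN⟩ with hs'
  -- All labels are found relative to the reference node, so its own label is the global flip.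
  set g := lbl ω.σ s' with hg
  set lab : ℕ → Fin ω.N → ℝ := fun j u => I.stageLab B K s j u with hlab
  have hbinI : ∀ v : Fin ω.N, I.bin B v = blk B (ω.X v) := toInput_bin ω B
  have hell : ∀ u v : Fin ω.N, I.ell u v = e u v := toInput_ell ω
  have hrange : ∀ j, blockRange (fun v : Fin I.N => I.bin B v) K j = inBlocks B K ω.X j := by
    intro j
    unfold inBlocks
    congr 1
    funext v
    exact hbinI v
  have h0 : ∀ u, blk B (ω.X u) < K → lab 0 u = g * lbl ω.σ u := by
    intro u hu
    have hu' : u ∈ inBlocks B K ω.X 0 := by simpa [inBlocks, blockRange] using hu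
    have hs : s' ∈ inBlocks B K ω.X 0 := by
      have : blk B (ω.X s') < K := by rw [← hbinI]; exact hsK
      simpa [inBlocks, blockRange] using this
    rw [← seed_labels hσ hC (inBlocks B K ω.X 0) s' hs
      (pairLlr_self_ne_zero hq hqp hp hκ_fin hφ_pos ω.X ω.G) (h.seed s' hs) u hu']
    simp only [hlab, Input.stageLab, Input.seedLab]
    rw [if_pos (by rw [hbinI]; exact hu), score_window (by omega), hrange]
    congr 1
    exact Finset.sum_congr rfl fun v _ => congrArg₂ (· * ·) (hell s' v) (hell u v)
  have hstep : ∀ j u, lab (j + 1) u = if blk B (ω.X u) = j + K then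
      sg (∑ v ∈ blockRange (fun v => blk B (ω.X v)) K j, lab j v * e u v) else lab j u := by
    intro j u
    simp only [hlab, Input.stageLab, hbinI]
    split_ifs with hj
    · have := blk_lt hB0 (h.mem_torus u)
      rw [score_window (by omega), hrange]
      congr 1
      exact Finset.sum_congr rfl fun v _ => congrArg (I.stageLab B K s _ v * ·) (hell u v)
    · rfl
  obtain ⟨hpm, hfew⟩ := few_mistakes (fun v => blk B (ω.X v)) K B hσ hC hC0 (hσ s') hμ h0 hstep
    h.propagate (B - K) (by omega)
  have hfew' : ∀ b, ((Finset.univ.filter fun v => blk B (ω.X v) = b ∧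
      Wrong g (lbl ω.σ) (lab (B - K)) v).card : ℝ) ≤ μ := by
    intro b
    by_cases hb : b < B
    · exact hfew b (by omega)
    · rw [Finset.filter_false_of_mem]
      · simpa using hμ
      · rintro v - ⟨hv, -⟩
        have := blk_lt hB0 (h.mem_torus v)
        omega
  have hfinal : ∀ u : Fin ω.N, 0 < g * lbl ω.σ u *
      I.score (I.window B (I.start B D u) (2 * D + 1)) (I.stageLab B K s (B - K)) u := by
    intro u
    rw [score_eq_sum (window_nodup hDB) (fun v hv => (mem_window.1 hv).1) _ _
      (R := Finset.univ.filter fun v : Fin I.N =>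
        (v : ℕ) ∈ I.window B (I.start B D u) (2 * D + 1)) (by simp)]
    set T := (Finset.range (2 * D + 1)).image fun t => (I.start B D u + t) % B with hT
    have hTc : (T.card : ℝ) ≤ 2 * D + 1 := by
      have : T.card ≤ 2 * D + 1 := Finset.card_image_le.trans (by simp)
      exact_mod_cast this
    have := refined_label (fun v => blk B (ω.X v)) hσ hC hC0 (hσ s') (lab := lab (B - K))
      (fun v => hpm v (by have := blk_lt hB0 (h.mem_torus v); omega)) hfew' u
      (Finset.univ.filter fun v : Fin ω.N => (v : ℕ) ∈ I.window B (I.start B D u) (2 * D + 1)) T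
      (fun v hv => ?_) (fun v hv => ?_) (lt_of_le_of_lt ?_ (h.refine u))
    · refine this.trans_le (le_of_eq ?_)
      congr 1
      exact Finset.sum_congr rfl fun v _ => congrArg (I.stageLab B K s _ v * ·) (hell u v).symm
    · simp only [Finset.mem_filter, Finset.mem_univ, true_and] at hv
      obtain ⟨-, t, ht, hvt⟩ := mem_window.1 hv
      rw [hT, Finset.mem_image]
      exact ⟨t, Finset.mem_range.2 ht, by rw [← hvt, hbinI]⟩
    · simp only [Finset.mem_filter, Finset.mem_univ, true_and] at hv
      have hpsi : psi φ n (ω.X u) (ω.X v) = 0 := by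
        by_contra hne
        exact hv (hwin u v hne)
      have hadj : ¬ ω.G.Adj u v := fun hadj => h.adj u v hadj hpsi
      rw [he, pairLlr, hpsi, show decide (ω.G.Adj u v) = false by simpa using hadj,
        llr_zero_false]
    · gcongr
  have hval : ∀ u : Fin ω.N, (recoveryProg M K D).output I u = ω.σ s' * ω.σ u := by
    intro u
    have hf := hfinal u
    rw [hout u]
    have hcast : g * lbl ω.σ u = (((ω.σ s' * ω.σ u : ℤˣ) : ℤ) : ℝ) := by
      simp [hg, lbl]
    rw [hcast] at hf
    rcases Int.units_eq_one_or (ω.σ s' * ω.σ u) with h1 | h1 <;> rw [h1] at hf ⊢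
    · rw [if_pos (by simpa using hf)]
    · rw [if_neg]
      simp at hf
      linarith
  rcases Int.units_eq_one_or (ω.σ s') with h1 | h1
  · left
    funext u
    rw [hval u, h1, one_mul]
  · right
    funext u
    rw [hval u, h1, neg_one_mul]
    rfl

end GoodSamples

/-! ### Events that depend only on the locations -/

section Locations

open Classical

theorem measurable_blk (B : ℕ) : Measurable (blk B) := by
  unfold blk
  fun_prop

theorem measurableSet_forall {α ι : Type*} [MeasurableSpace α] [Countable ι] {P : ι → α → Prop}
    (h : ∀ i, MeasurableSet {x | P i x}) : MeasurableSet {x | ∀ i, P i x} := by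
  have : {x | ∀ i, P i x} = ⋂ i, {x | P i x} := by ext; simp
  rw [this]
  exact MeasurableSet.iInter h

theorem measurableSet_exists {α ι : Type*} [MeasurableSpace α] [Countable ι] {P : ι → α → Prop}
    (h : ∀ i, MeasurableSet {x | P i x}) : MeasurableSet {x | ∃ i, P i x} := by
  have : {x | ∃ i, P i x} = ⋃ i, {x | P i x} := by ext; simp
  rw [this]
  exact MeasurableSet.iUnion h

theorem measurableSet_const_imp {α : Type*} [MeasurableSpace α] {p : Prop} {P : α → Prop}
    (h : MeasurableSet {x | P x}) : MeasurableSet {x | p → P x} := by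
  by_cases hp : p <;> simp [hp, h]

theorem measurableSet_const_and {α : Type*} [MeasurableSpace α] {p : Prop} {P : α → Prop}
    (h : MeasurableSet {x | P x}) : MeasurableSet {x | p ∧ P x} := by
  by_cases hp : p <;> simp [hp, h]

/-- To show that a set is measurable, one may treat the blocks of the nodes as fixed. -/
theorem measurableSet_of_blocks {N : ℕ} (B : ℕ) {P : (Fin N → ℕ) → (Fin N → ℝ) → Prop}
    (h : ∀ b, MeasurableSet {x | P b x}) :
    MeasurableSet {x : Fin N → ℝ | P (fun u => blk B (x u)) x} := by
  have hm : Measurable fun x : Fin N → ℝ => fun u => blk B (x u) :=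
    measurable_pi_lambda _ fun u => (measurable_blk B).comp (measurable_pi_apply u)
  have : {x : Fin N → ℝ | P (fun u => blk B (x u)) x} =
      ⋃ b : Fin N → ℕ, {x | (fun u => blk B (x u)) = b} ∩ {x | P b x} := by
    ext x
    simp
  rw [this]
  exact MeasurableSet.iUnion fun b => (hm (measurableSet_singleton b)).inter (h b)

/-- The conditions on the locations. -/
structure LocGood (φ : ℝ≥0 → unitInterval) (n B K : ℕ) (ε δ c a : ℝ) {N : ℕ} (x : Fin N → ℝ) :
    Prop where
  mem_torus : ∀ u, x u ∈ torus
  window : ∀ j, j + K ≤ B → δ < (inBlocks B K x j).card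
  card_lt : ∀ b < B, ((inBlocks B 1 x b).card : ℝ) < c
  low : ∀ u, ∑ v ∈ Finset.univ.erase u,
    lowKernel φ ε ((n : ℝ) / Real.log n * torusDist (x u) (x v)) < δ / 4
  many : a < (inBlocks B B x 0).card

variable {lam p q : ℝ} {φ : ℝ≥0 → unitInterval} {n : ℕ}

theorem measurable_lowKernel (hφ : Measurable φ) (ε : ℝ) : Measurable (lowKernel φ ε) :=
  measurable_const.indicator (measurableSet_lowKernel hφ ε)

theorem measurable_lowSum (hφ : Measurable φ) (ε : ℝ) {N : ℕ} (u : Fin N) :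
    Measurable fun x : Fin N → ℝ => ∑ v ∈ Finset.univ.erase u,
      lowKernel φ ε ((n : ℝ) / Real.log n * torusDist (x u) (x v)) := by
  refine Finset.measurable_fun_sum _ fun v _ => (measurable_lowKernel hφ ε).comp ?_
  have : Measurable fun x : Fin N → ℝ => torusDist (x u) (x v) :=
    measurable_torusDist.comp (f := fun x : Fin N → ℝ => (x u, x v)) (by fun_prop)
  exact this.const_mul _

theorem measurable_card_inBlocks (B K j : ℕ) {N : ℕ} :
    Measurable fun x : Fin N → ℝ => ((inBlocks B K x j).card : ℝ) := by
  have : ∀ x : Fin N → ℝ, ((inBlocks B K x j).card : ℝ) =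
      ∑ u, if blk B (x u) ∈ Set.Ico j (j + K) then (1 : ℝ) else 0 := by
    intro x
    simp [inBlocks, blockRange]
  simp_rw [this]
  refine Finset.measurable_fun_sum _ fun u _ => Measurable.ite ?_ measurable_const measurable_const
  exact ((measurable_blk B).comp (measurable_pi_apply u)) (Set.to_countable _).measurableSet

theorem measurableSet_locGood (hφ : Measurable φ) (n B K : ℕ) (ε δ c a : ℝ) (N : ℕ) :
    MeasurableSet {x : Fin N → ℝ | LocGood φ n B K ε δ c a x} := by
  have : {x : Fin N → ℝ | LocGood φ n B K ε δ c a x} = {x | (∀ u, x u ∈ torus) ∧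
      (∀ j, j + K ≤ B → δ < (inBlocks B K x j).card) ∧
      (∀ b, b < B → ((inBlocks B 1 x b).card : ℝ) < c) ∧
      (∀ u, ∑ v ∈ Finset.univ.erase u,
        lowKernel φ ε ((n : ℝ) / Real.log n * torusDist (x u) (x v)) < δ / 4) ∧
      a < (inBlocks B B x 0).card} := by
    ext x
    exact ⟨fun h => ⟨h.1, h.2, h.3, h.4, h.5⟩, fun h => ⟨h.1, h.2.1, h.2.2.1, h.2.2.2.1, h.2.2.2.2⟩⟩
  rw [this]
  refine (measurableSet_forall fun u => measurable_pi_apply u measurableSet_torus).inter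
    (MeasurableSet.inter ?_ (MeasurableSet.inter ?_ (MeasurableSet.inter ?_ ?_)))
  · exact measurableSet_forall fun j => measurableSet_const_imp
      (measurableSet_lt measurable_const (measurable_card_inBlocks B K j))
  · exact measurableSet_forall fun j => measurableSet_const_imp
      (measurableSet_lt (measurable_card_inBlocks B 1 j) measurable_const)
  · exact measurableSet_forall fun u => measurableSet_lt (measurable_lowSum hφ ε u) measurable_const
  · exact measurableSet_lt measurable_const (measurable_card_inBlocks B B 0)

theorem condProb_loc {P : (N : ℕ) → (Fin N → ℝ) → Prop} (N : ℕ) (σ : Fin N → ℤˣ) (x : Fin N → ℝ) :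
    condProb p q φ n {ω | P ω.N ω.X} N σ x = if P N x then 1 else 0 := by
  have h : ∀ G, ((⟨⟨N, σ, G⟩, x⟩ : Sample) ∈ {ω : Sample | P ω.N ω.X}) ↔ P N x := fun _ => Iff.rfl
  by_cases hP : P N x
  · simp only [condProb, h, hP, if_true]
    exact graphExp_const (linkProb_comm φ n σ x) _
  · simp only [condProb, h, hP, if_false]
    exact graphExp_const (linkProb_comm φ n σ x) _

/-- A range of blocks is an interval, closed on the right like the torus; `j + k ≤ B` keeps it from
leaving the torus on the left. -/
theorem unif_blocks {B k j : ℕ} (hB : 0 < B) (hjk : j + k ≤ B) :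
    unif {y | j ≤ blk B y ∧ blk B y < j + k} = ENNReal.ofReal (k / B) := by
  have hB' : (0 : ℝ) < B := Nat.cast_pos.2 hB
  have hjk' : (j : ℝ) + k ≤ B := by exact_mod_cast hjk
  have hset : {y | j ≤ blk B y ∧ blk B y < j + k} ∩ torus =
      Set.Ioc (1 / 2 - ((j : ℝ) + k) / B) (1 / 2 - (j : ℝ) / B) := by
    ext y
    simp only [Set.mem_inter_iff, Set.mem_ofPred_eq, Set.mem_Ioc]
    have key : y ≤ 1 / 2 → ((j ≤ blk B y ∧ blk B y < j + k) ↔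
        1 / 2 - ((j : ℝ) + k) / B < y ∧ y ≤ 1 / 2 - (j : ℝ) / B) := by
      intro hy
      have h0 : 0 ≤ (1 / 2 - y) * B := mul_nonneg (by linarith) hB'.le
      rw [blk, Nat.le_floor_iff h0, Nat.floor_lt h0, sub_lt_comm, le_sub_comm, lt_div_iff₀ hB',
        div_le_iff₀ hB', and_comm]
      push_cast
      rfl
    constructor
    · rintro ⟨h1, h2⟩
      exact (key h2.2).1 h1
    · intro h
      have h1 : y ≤ 1 / 2 := h.2.trans (by linarith [show 0 ≤ (j : ℝ) / B by positivity])
      refine ⟨(key h1).2 h, ?_, h1⟩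
      have : ((j : ℝ) + k) / B ≤ 1 := (div_le_one hB').2 hjk'
      linarith [h.1]
  rw [unif, Measure.restrict_apply, hset, Real.volume_Ioc]
  · congr 1
    ring
  · exact (measurable_blk B) (Set.to_countable (Set.Ico j (j + k))).measurableSet

/-- Exponential moments of the number of nodes in a range of blocks. -/
theorem law_count_le (hφ : Measurable φ) (hp : 0 ≤ p) (hq : 0 ≤ q) (hp1 : p ≤ 1)
    (hq1 : q ≤ 1) (hlam : 0 ≤ lam) {B k j : ℕ} (hB : 0 < B) (hjk : j + k ≤ B) (θ c : ℝ) :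
    law lam p q φ n {ω | c ≤ θ * (inBlocks B k ω.X j).card} ≤
      ENNReal.ofReal (Real.exp (-c) * Real.exp (lam * n * (k / B * (Real.exp θ - 1)))) := by
  have hB' : (0 : ℝ) < B := Nat.cast_pos.2 hB
  have hkB : (k : ℝ) / B ≤ 1 := (div_le_one hB').2 (by exact_mod_cast (by omega : k ≤ B))
  have hkB0 : (0 : ℝ) ≤ k / B := by positivity
  set A : Set ℝ := {y | j ≤ blk B y ∧ blk B y < j + k} with hA
  have hAm : MeasurableSet A := (measurable_blk B) (Set.to_countable (Set.Ico j (j + k))).measurableSet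
  set f : ℝ → ℝ := fun y => if y ∈ A then Real.exp θ else 1 with hf
  have hfm : Measurable f := Measurable.ite hAm measurable_const measurable_const
  -- This is the mean of `exp (θ * 1_A)`, as `A` has probability `k / B`. Positive `θ` will serve
  -- for upper tails and negative `θ` for lower ones.
  have hz : 0 ≤ 1 + (k : ℝ) / B * (Real.exp θ - 1) := by
    nlinarith [Real.exp_pos θ, mul_nonneg hkB0 (Real.exp_pos θ).le]
  have hintf : ∫⁻ y, ENNReal.ofReal (f y) ∂unif ≤
      ENNReal.ofReal (1 + (k : ℝ) / B * (Real.exp θ - 1)) := by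
    rw [← lintegral_add_compl _ hAm, setLIntegral_congr_fun (g := fun _ => ENNReal.ofReal (Real.exp θ))
        hAm (fun y hy => by simp [hf, hy]),
      setLIntegral_congr_fun (g := fun _ => 1) hAm.compl (fun y hy => by
        simp only [hf]; rw [if_neg hy, ENNReal.ofReal_one]), setLIntegral_const, setLIntegral_const,
      prob_compl_eq_one_sub hAm, hA, unif_blocks hB hjk, ← ENNReal.ofReal_mul (Real.exp_pos θ).le,
      one_mul, ← ENNReal.ofReal_one, ← ENNReal.ofReal_sub _ hkB0, ← ENNReal.ofReal_add (by positivity)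
        (by linarith)]
    apply ENNReal.ofReal_le_ofReal
    linarith
  have hS : MeasurableSet {ω : Sample | c ≤ θ * (inBlocks B k ω.X j).card} :=
    measurableSet_sample_iff.2 fun cf => measurableSet_le measurable_const
      ((measurable_card_inBlocks B k j).const_mul θ)
  have := law_le_of_prod (lam := lam) (n := n) hφ hp hq hp1 hq1 hlam hS (Real.exp_pos (-c)).le hz hfm
    (fun y => by simp only [hf]; split_ifs <;> positivity) hintf ?_
  · rwa [add_sub_cancel_left] at this
  · intro N σ x _
    rw [condProb_loc (P := fun N x => c ≤ θ * (inBlocks B k x j).card)]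
    have hprod : ∏ v, f (x v) = Real.exp (θ * (inBlocks B k x j).card) := by
      simp only [hf]
      rw [Finset.prod_ite, Finset.prod_const_one, mul_one, Finset.prod_const, ← Real.exp_nat_mul,
        mul_comm]
      congr 3
    rw [hprod, ← Real.exp_add]
    split_ifs with h
    · exact Real.one_le_exp (by linarith)
    · positivity

/-- Union bound over `u`, and for each `u` the exponential moment of a sum over the other nodes: the
indicator takes the values `0` and `1`, so `exp (θ * 1_A) = 1 + (exp θ - 1) * 1_A`. -/
theorem law_low_le (hφ : Measurable φ) (hp : 0 ≤ p) (hq : 0 ≤ q) (hp1 : p ≤ 1)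
    (hq1 : q ≤ 1) (hlam : 0 ≤ lam) (hn : 0 < (n : ℝ) / Real.log n)
    (hκ : (interactionRange φ).toReal / ((n : ℝ) / Real.log n) < 1 / 2) {θ : ℝ} (hθ : 0 ≤ θ)
    (ε c : ℝ) :
    law lam p q φ n {ω | ∃ u, c ≤ ∑ v ∈ Finset.univ.erase u,
      lowKernel φ ε ((n : ℝ) / Real.log n * torusDist (ω.X u) (ω.X v))} ≤
      ENNReal.ofReal (Real.exp (-(θ * c)) * (lam * n * Real.exp (lam * n * (2 / ((n : ℝ) / Real.log n) *
        ((Real.exp θ - 1) * ∫ t in Set.Ici (0 : ℝ), lowKernel φ ε t))))) := by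
  set a := (n : ℝ) / Real.log n with ha
  have hexp : 0 ≤ Real.exp θ - 1 := by linarith [Real.one_le_exp hθ]
  have hlow : ∀ t, lowKernel φ ε t = 0 ∨ lowKernel φ ε t = 1 := fun t => by
    unfold lowKernel
    by_cases h : t ∈ {t | t ≤ (interactionRange φ).toReal ∧ (φ t.toNNReal : ℝ) < ε}
    · right; rw [Set.indicator_of_mem h]; rfl
    · left; rw [Set.indicator_of_notMem h]
  set k : ℝ → ℝ := fun t => (Real.exp θ - 1) * lowKernel φ ε t with hk
  have hkm : Measurable k := (measurable_lowKernel hφ ε).const_mul _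
  have hk0 : ∀ t, 0 ≤ k t := fun t => by
    rcases hlow t with h | h <;> simp [hk, h, hexp]
  have hkint : 0 ≤ ∫ t in Set.Ici (0 : ℝ), k t := integral_nonneg hk0
  have hS : MeasurableSet {ω : Sample | ∃ u, c ≤ ∑ v ∈ Finset.univ.erase u,
      lowKernel φ ε (a * torusDist (ω.X u) (ω.X v))} :=
    measurableSet_sample_iff.2 fun cf => measurableSet_exists fun u =>
      measurableSet_le measurable_const (measurable_lowSum hφ ε u)
  have := law_le_of_star (lam := lam) (n := n) hφ hp hq hp1 hq1 hlam hS
    (c := Real.exp (-(θ * c))) (z := 1 + 2 / a * ∫ t in Set.Ici (0 : ℝ), k t)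
    (Real.exp_pos _).le (by positivity) (f := fun x y => 1 + k (a * torusDist x y)) ?_
    (fun x y => by linarith [hk0 (a * torusDist x y)]) ?_ ?_
  · rwa [add_sub_cancel_left, integral_const_mul] at this
  · exact (hkm.comp (measurable_torusDist.const_mul a)).const_add 1
  · intro x hx
    refine (lintegral_one_add_torusDist hkm (C := Real.exp θ - 1) (fun t => ?_)
      (fun t => by linarith [hk0 t]) hn hκ (fun t ht => ?_) hx).le
    · rw [abs_of_nonneg (hk0 t)]
      rcases hlow t with h | h <;> simp only [hk, h] <;> linarith
    · have : lowKernel φ ε t = 0 := Set.indicator_of_notMem (fun h => by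
        have := h.1; linarith) _
      simp [hk, this]
  · intro N σ x _
    rw [condProb_loc (P := fun N x => ∃ u, c ≤ ∑ v ∈ Finset.univ.erase u,
      lowKernel φ ε (a * torusDist (x u) (x v)))]
    have hterm : ∀ u, Real.exp (-(θ * c)) * ∏ v ∈ Finset.univ.erase u,
        (1 + k (a * torusDist (x u) (x v))) = Real.exp (θ * (∑ v ∈ Finset.univ.erase u,
          lowKernel φ ε (a * torusDist (x u) (x v))) - θ * c) := by
      intro u
      have : ∀ v, 1 + k (a * torusDist (x u) (x v)) =
          Real.exp (θ * lowKernel φ ε (a * torusDist (x u) (x v))) := by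
        intro v
        rcases hlow (a * torusDist (x u) (x v)) with h | h <;> simp [hk, h]
      simp_rw [this]
      rw [← Real.exp_sum, ← Finset.mul_sum, ← Real.exp_add]
      congr 1
      ring
    simp_rw [hterm]
    split_ifs with h
    · obtain ⟨u, hu⟩ := h
      refine le_trans ?_ (Finset.single_le_sum (fun u _ => (Real.exp_pos _).le) (Finset.mem_univ u))
      exact Real.one_le_exp (by nlinarith)
    · exact Finset.sum_nonneg fun u _ => (Real.exp_pos _).le

theorem law_not_mem_torus (hφ : Measurable φ) (hp : 0 ≤ p) (hq : 0 ≤ q) (hp1 : p ≤ 1)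
    (hq1 : q ≤ 1) (hlam : 0 ≤ lam) :
    law lam p q φ n {ω | ¬ ∀ u, ω.X u ∈ torus} = 0 := by
  have hS : MeasurableSet {ω : Sample | ¬ ∀ u, ω.X u ∈ torus} :=
    measurableSet_sample_iff.2 fun cf => (measurableSet_forall fun u =>
      measurable_pi_apply u measurableSet_torus).compl
  have := law_le_of_condProb_le (lam := lam) (n := n) hφ hp hq hp1 hq1 hlam hS (β := 0) ?_
  · simpa using this
  · intro N σ x hx
    rw [condProb_loc (P := fun N x => ¬ ∀ u, x u ∈ torus), if_neg (not_not.2 hx)]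

/-- The probability that the locations are not as they should be. -/
theorem law_not_locGood_le (hφ : Measurable φ) (hp : 0 ≤ p) (hq : 0 ≤ q) (hp1 : p ≤ 1)
    (hq1 : q ≤ 1) (hlam : 0 ≤ lam) (hn : 0 < (n : ℝ) / Real.log n)
    (hκ : (interactionRange φ).toReal / ((n : ℝ) / Real.log n) < 1 / 2) {B K : ℕ} (hB : 0 < B)
    (ε : ℝ) {δ c a s θ : ℝ} (hs : 0 ≤ s) (hθ : 0 ≤ θ) :
    law lam p q φ n {ω | ¬ LocGood φ n B K ε δ c a ω.X} ≤
      ENNReal.ofReal ((B + 1) * (Real.exp (s * δ) *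
        Real.exp (lam * n * (K / B * (Real.exp (-s) - 1))))) +
      ENNReal.ofReal (B * (Real.exp (-c) * Real.exp (lam * n * (1 / B * (Real.exp 1 - 1))))) +
      ENNReal.ofReal (Real.exp (-(θ * (δ / 4))) * (lam * n * Real.exp (lam * n *
        (2 / ((n : ℝ) / Real.log n) * ((Real.exp θ - 1) *
          ∫ t in Set.Ici (0 : ℝ), lowKernel φ ε t))))) +
      ENNReal.ofReal (Real.exp a * Real.exp (lam * n * (Real.exp (-1) - 1))) := by
  -- The counting events are put in the form of `law_count_le`, with `θ` equal to `-s` for sparse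
  -- windows, `1` for crowded blocks and `-1` for the total number of nodes.
  set S₁ : ℕ → Set Sample := fun j => {ω | -(s * δ) ≤ -s * (inBlocks B K ω.X j).card}
  set S₂ : ℕ → Set Sample := fun j => {ω | c ≤ 1 * (inBlocks B 1 ω.X j).card}
  set S₃ : Set Sample := {ω | ∃ u, δ / 4 ≤ ∑ v ∈ Finset.univ.erase u,
      lowKernel φ ε ((n : ℝ) / Real.log n * torusDist (ω.X u) (ω.X v))}
  set S₄ : Set Sample := {ω | -a ≤ -1 * (inBlocks B B ω.X 0).card}
  set S₀ : Set Sample := {ω | ¬ ∀ u, ω.X u ∈ torus}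
  set J := (Finset.range (B + 1)).filter fun j => j + K ≤ B
  have hsub : {ω : Sample | ¬ LocGood φ n B K ε δ c a ω.X} ⊆
      ((((⋃ j ∈ J, S₁ j) ∪ ⋃ j ∈ Finset.range B, S₂ j) ∪ S₃) ∪ S₄) ∪ S₀ := by
    intro ω hω
    by_contra hn
    simp only [Set.mem_union, Set.mem_iUnion, not_or, not_exists] at hn
    obtain ⟨⟨⟨⟨h1, h2⟩, h3⟩, h4⟩, h0⟩ := hn
    refine hω ⟨not_not.1 h0, fun j hj => ?_, fun b hb => ?_, fun u => ?_, ?_⟩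
    · by_contra hlt
      refine h1 j (by simp [J]; omega) (show -(s * δ) ≤ -s * _ from ?_)
      nlinarith [not_lt.1 hlt]
    · by_contra hlt
      refine h2 b (by simpa using hb) (show c ≤ 1 * _ from ?_)
      linarith [not_lt.1 hlt]
    · by_contra hlt
      exact h3 ⟨u, not_lt.1 hlt⟩
    · by_contra hlt
      refine h4 (show -a ≤ -1 * _ from ?_)
      linarith [not_lt.1 hlt]
  have sum_le : ∀ (T : Finset ℕ) (S : ℕ → Set Sample) (b : ℝ) (k : ℕ), 0 ≤ b → T.card ≤ k →
      (∀ j ∈ T, law lam p q φ n (S j) ≤ ENNReal.ofReal b) →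
      law lam p q φ n (⋃ j ∈ T, S j) ≤ ENNReal.ofReal (k * b) := by
    intro T S b k hb hk h
    calc law lam p q φ n (⋃ j ∈ T, S j) ≤ ∑ j ∈ T, law lam p q φ n (S j) :=
          measure_biUnion_finset_le _ _
      _ ≤ ∑ _j ∈ T, ENNReal.ofReal b := Finset.sum_le_sum h
      _ = T.card * ENNReal.ofReal b := by simp
      _ ≤ k * ENNReal.ofReal b := by gcongr
      _ = _ := by rw [ENNReal.ofReal_mul (Nat.cast_nonneg _), ENNReal.ofReal_natCast]
  have hB' : (B : ℝ) ≠ 0 := by positivity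
  refine (measure_mono hsub).trans ((measure_union_le _ _).trans ?_)
  rw [law_not_mem_torus hφ hp hq hp1 hq1 hlam, add_zero]
  refine (measure_union_le _ _).trans (add_le_add ((measure_union_le _ _).trans (add_le_add
    ((measure_union_le _ _).trans (add_le_add ?_ ?_)) ?_)) ?_)
  · have := sum_le J S₁ (Real.exp (s * δ) * Real.exp (lam * n * (K / B * (Real.exp (-s) - 1))))
      (B + 1) (by positivity) ((Finset.card_filter_le _ _).trans (by simp)) ?_
    · exact_mod_cast this
    · intro j hj
      have hj' : j + K ≤ B := by simp [J] at hj; exact hj.2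
      have := law_count_le (lam := lam) (n := n) hφ hp hq hp1 hq1 hlam hB hj' (-s) (-(s * δ))
      rwa [neg_neg] at this
  · refine sum_le (Finset.range B) S₂ _ B (by positivity) (by simp) ?_
    intro j hj
    have := law_count_le (lam := lam) (n := n) hφ hp hq hp1 hq1 hlam hB (k := 1) (j := j)
      (by have := Finset.mem_range.1 hj; omega) 1 c
    simpa only [Nat.cast_one] using this
  · exact law_low_le hφ hp hq hp1 hq1 hlam hn hκ hθ ε (δ / 4)
  · have := law_count_le (lam := lam) (n := n) hφ hp hq hp1 hq1 hlam hB (k := B) (j := 0)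
      (by omega) (-1) (-a)
    rwa [neg_neg, div_self hB', one_mul] at this

end Locations

/-! ### Events that depend on the links -/

section Links

open Classical

variable {lam p q : ℝ} {φ : ℝ≥0 → unitInterval} {n : ℕ} {N : ℕ} {σ : Fin N → ℤˣ} {x : Fin N → ℝ}

/-- Markov's inequality. Sums of exponentials as `F` include a union bound. -/
theorem condProb_le_graphExp (hp : 0 ≤ p) (hq : 0 ≤ q) (hp1 : p ≤ 1) (hq1 : q ≤ 1) {S : Set Sample}
    {F : SimpleGraph (Fin N) → ℝ} (h0 : ∀ G, 0 ≤ F G)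
    (h1 : ∀ G, (⟨⟨N, σ, G⟩, x⟩ : Sample) ∈ S → 1 ≤ F G) :
    condProb p q φ n S N σ x ≤ graphExp (linkProb p q φ n σ x) F := by
  refine graphExp_mono (linkProb_nonneg φ n σ x hp hq) (linkProb_le_one φ n σ x hp1 hq1) fun G => ?_
  by_cases h : (⟨⟨N, σ, G⟩, x⟩ : Sample) ∈ S
  · simpa [h] using h1 G h
  · simpa [h] using h0 G

theorem lbl_mul_lbl (u v : Fin N) : lbl σ u * lbl σ v = (((σ u * σ v : ℤˣ) : ℤ) : ℝ) := by
  simp [lbl]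

theorem linkProb_eq_pairProb (u v : Fin N) :
    linkProb p q φ n σ x u v = pairProb p q (psi φ n (x u) (x v)) (σ u) (σ v) := rfl

/-- The exponential moment of a sum of log-likelihood ratios. -/
theorem graphExp_exp_pairLlr (hq : 0 < q) (hqp : q < p) (hp : p < 1) {Q : Finset (Fin N × Fin N)}
    (hQ : Oriented Q) :
    graphExp (linkProb p q φ n σ x) (fun G => Real.exp (-(1 / 2) * ∑ e ∈ Q,
      lbl σ e.1 * lbl σ e.2 * pairLlr p q φ n x G e.1 e.2)) =
      ∏ e ∈ Q, (1 - hell p q (psi φ n (x e.1) (x e.2))) := by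
  have h := graphExp_prod (linkProb_comm φ n σ x (p := p) (q := q)) hQ
    (fun u v => Real.exp (-(1 / 2) * (lbl σ u * lbl σ v * llr p q (psi φ n (x u) (x v)) true)))
    (fun u v => Real.exp (-(1 / 2) * (lbl σ u * lbl σ v * llr p q (psi φ n (x u) (x v)) false)))
  rw [Finset.prod_congr rfl (g := fun e => 1 - hell p q (psi φ n (x e.1) (x e.2)))] at h
  · rw [← h]
    congr 1
    funext G
    rw [Finset.mul_sum, Real.exp_sum]
    refine Finset.prod_congr rfl fun e _ => ?_
    by_cases hG : G.Adj e.1 e.2 <;> simp [pairLlr, hG]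
  · intro e _
    simp only [lbl_mul_lbl]
    exact exp_llr_mean hq hqp hp (psi_le_one φ n _ _) (σ e.1) (σ e.2)

theorem prod_one_sub_le_exp {ι : Type*} (s : Finset ι) (f : ι → ℝ) (hf : ∀ i ∈ s, f i ≤ 1) :
    ∏ i ∈ s, (1 - f i) ≤ Real.exp (-∑ i ∈ s, f i) := by
  rw [← Finset.sum_neg_distrib, Real.exp_sum]
  exact Finset.prod_le_prod (fun i hi => by linarith [hf i hi]) fun i _ => by
    linarith [Real.add_one_le_exp (-f i)]

/-! #### Links to nodes at zero kernel value -/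

theorem measurable_psi_pair (hφ : Measurable φ) (n : ℕ) (u v : Fin N) :
    Measurable fun x : Fin N → ℝ => psi φ n (x u) (x v) :=
  (measurable_psi hφ n).comp (f := fun x : Fin N → ℝ => (x u, x v)) (by fun_prop)

theorem measurable_pairLlr (hφ : Measurable φ) (G : SimpleGraph (Fin N)) (u v : Fin N) :
    Measurable fun x : Fin N → ℝ => pairLlr p q φ n x G u v := by
  have h := measurable_psi_pair hφ n u v
  unfold pairLlr llr
  by_cases hG : G.Adj u v
  · simp [hG]
  · simp only [hG, decide_false, Bool.false_eq_true, if_false]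
    fun_prop

theorem law_adj_zero (hφ : Measurable φ) (hp : 0 ≤ p) (hq : 0 ≤ q) (hp1 : p ≤ 1)
    (hq1 : q ≤ 1) (hlam : 0 ≤ lam) :
    law lam p q φ n {ω | ∃ u v, ω.G.Adj u v ∧ psi φ n (ω.X u) (ω.X v) = 0} = 0 := by
  have hS : MeasurableSet {ω : Sample | ∃ u v, ω.G.Adj u v ∧ psi φ n (ω.X u) (ω.X v) = 0} :=
    measurableSet_sample_iff.2 fun c => show MeasurableSet {x : Fin c.N → ℝ | ∃ u v, c.G.Adj u v ∧
        psi φ n (x u) (x v) = 0} from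
      measurableSet_exists fun u => measurableSet_exists fun v => measurableSet_const_and 
        (measurableSet_eq_fun (measurable_psi_pair hφ n u v) measurable_const)
  have := law_le_of_condProb_le (lam := lam) (n := n) hφ hp hq hp1 hq1 hlam hS (β := 0) ?_
  · simpa using this
  intro N σ x _
  set Z : Finset (Fin N × Fin N) :=
    Finset.univ.filter fun e => e.1 ≠ e.2 ∧ psi φ n (x e.1) (x e.2) = 0 with hZ
  refine (condProb_le_graphExp hp hq hp1 hq1
    (F := fun G => ∑ e ∈ Z, if G.Adj e.1 e.2 then (1 : ℝ) else 0) ?_ ?_).trans ?_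
  · exact fun G => Finset.sum_nonneg fun e _ => by split_ifs <;> norm_num
  · rintro G ⟨u, v, hG, h⟩
    have hmem : (u, v) ∈ Z := by simp [hZ, hG.ne, h]
    refine le_trans ?_ (Finset.single_le_sum (fun e _ => by split_ifs <;> norm_num) hmem)
    have hG' : G.Adj u v := hG
    simp [hG']
  · rw [graphExp_sum]
    refine (Finset.sum_eq_zero fun e he => ?_).le
    have he' : e.1 ≠ e.2 ∧ psi φ n (x e.1) (x e.2) = 0 := by simpa [hZ] using he
    have hQ : Oriented {e} := by
      intro u v h
      rw [Finset.mem_singleton] at h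
      subst h
      refine ⟨he'.1, fun h => he'.1 ?_⟩
      rw [Finset.mem_singleton] at h
      exact (Prod.mk.inj h).2
    have := graphExp_prod (linkProb_comm φ n σ x (p := p) (q := q)) hQ (fun _ _ => 1) (fun _ _ => 0)
    simp only [Finset.prod_singleton] at this
    rw [this]
    rw [linkProb, he'.2]
    ring

/-! #### The scores given the true labels of the other nodes -/

/-- The information threshold. The tilt `1/2` gives a factor `1 - hell` for each other node; its
mean over the location is `1 - I / (n / log n)`, the integral of `hell` being `I / 2`. The Poisson
sum turns this into `exp(-λ I log n)`, and the choice of `u` contributes `λ n`. -/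
theorem law_refine_le (hφ : Measurable φ) (hq : 0 < q) (hqp : q < p) (hp : p < 1)
    (hκ_fin : interactionRange φ < ⊤) (hlam : 0 ≤ lam) (hn : 0 < (n : ℝ) / Real.log n)
    (hκ : (interactionRange φ).toReal / ((n : ℝ) / Real.log n) < 1 / 2)
    (hz : infoMetric φ p q / ((n : ℝ) / Real.log n) ≤ 1) (T : ℝ) :
    law lam p q φ n {ω | ∃ u, lbl ω.σ u * ∑ v ∈ Finset.univ.erase u,
      lbl ω.σ v * pairLlr p q φ n ω.X ω.G u v ≤ T} ≤
      ENNReal.ofReal (Real.exp (T / 2) *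
        (lam * n * Real.exp (lam * n * -(infoMetric φ p q / ((n : ℝ) / Real.log n))))) := by
  have hp0 : 0 ≤ p := (hq.trans hqp).le
  have hq1 : q ≤ 1 := (hqp.trans hp).le
  set a := (n : ℝ) / Real.log n with ha
  set k : ℝ → ℝ := fun t => -hell p q (φ t.toNNReal) with hk
  have hkm : Measurable k := by
    have h : Measurable fun t : ℝ => (φ t.toNNReal : ℝ) := by fun_prop
    simp only [hk, hell]
    fun_prop
  have h01 : ∀ t : ℝ, 0 ≤ (φ t.toNNReal : ℝ) ∧ (φ t.toNNReal : ℝ) ≤ 1 := fun t => (φ _).2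
  have hkI : ∫ t in Set.Ici (0 : ℝ), k t = -(infoMetric φ p q / 2) := by
    simp only [hk, integral_neg, infoMetric, hell]
    ring
  have hS : MeasurableSet {ω : Sample | ∃ u, lbl ω.σ u * ∑ v ∈ Finset.univ.erase u,
      lbl ω.σ v * pairLlr p q φ n ω.X ω.G u v ≤ T} :=
    measurableSet_sample_iff.2 fun c => show MeasurableSet {x : Fin c.N → ℝ | ∃ u, lbl c.σ u *
        ∑ v ∈ Finset.univ.erase u, lbl c.σ v * pairLlr p q φ n x c.G u v ≤ T} from
      measurableSet_exists fun u => measurableSet_le ((Finset.measurable_fun_sum _ fun v _ =>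
        (measurable_pairLlr hφ _ u v).const_mul _).const_mul _) measurable_const
  have := law_le_of_star (lam := lam) (n := n) hφ hp0 hq.le hp.le hq1 hlam hS
    (c := Real.exp (T / 2)) (z := 1 - infoMetric φ p q / a) (Real.exp_pos _).le (by linarith)
    (f := fun x y => 1 + k (a * torusDist x y)) ?_ ?_ ?_ ?_
  · rwa [sub_sub_cancel_left] at this
  · exact (hkm.comp (measurable_torusDist.const_mul a)).const_add 1
  · intro x y
    simp only [hk]
    linarith [hell_le_one (p := p) (q := q) (h01 (a * torusDist x y)).1]
  · intro x hx
    refine (lintegral_one_add_torusDist hkm (C := 1) (fun t => ?_) (fun t => ?_) hn hκ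
      (fun t ht => ?_) hx).le.trans ?_
    · rw [hk, abs_neg, abs_of_nonneg (hell_nonneg hq hqp hp (h01 t).1 (h01 t).2)]
      exact hell_le_one (h01 t).1
    · simp only [hk]
      linarith [hell_le_one (p := p) (q := q) (h01 t).1]
    · simp [hk, kernel_eq_zero hκ_fin ht, hell_zero]
    · rw [hkI]
      apply ENNReal.ofReal_le_ofReal
      apply le_of_eq
      ring
  · intro N σ x _
    refine (condProb_le_graphExp hp0 hq.le hp.le hq1 (F := fun G => ∑ u, Real.exp (T / 2) *
      Real.exp (-(1 / 2) * ∑ e ∈ ({u} : Finset (Fin N)) ×ˢ Finset.univ.erase u,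
        lbl σ e.1 * lbl σ e.2 * pairLlr p q φ n x G e.1 e.2)) ?_ ?_).trans ?_
    · exact fun G => Finset.sum_nonneg fun u _ => by positivity
    · rintro G ⟨u, hu⟩
      refine le_trans ?_ (Finset.single_le_sum (fun u _ => by positivity) (Finset.mem_univ u))
      rw [← Real.exp_add]
      apply Real.one_le_exp
      rw [Finset.sum_product, Finset.sum_singleton]
      simp only [Finset.mul_sum, mul_assoc] at hu ⊢
      rw [← Finset.mul_sum]
      linarith
    · rw [graphExp_sum]
      refine Finset.sum_le_sum fun u _ => ?_
      rw [graphExp_mul_left, graphExp_exp_pairLlr hq hqp hp, Finset.prod_product,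
        Finset.prod_singleton]
      · simp only [hk, ← sub_eq_add_neg]
        rfl
      · intro v w h
        simp only [Finset.mem_product, Finset.mem_singleton, Finset.mem_erase, Finset.mem_univ,
          and_true] at h ⊢
        exact ⟨fun hvw => h.2 (hvw ▸ h.1), fun hwv => h.2 hwv.1⟩

/-! #### Visible nodes -/

variable {B K : ℕ} {ε δ c a : ℝ}

/-- Nodes at most `K` blocks apart have a rescaled distance of at most `κ` by `hvis`; the extra `1`
there covers the positions within the blocks. Among them, those of low kernel value are exactly what
`lowKernel` counts. -/
theorem LocGood.card_low_lt (h : LocGood φ n B K ε δ c a x) (hB : 0 < B)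
    (hn : 0 < (n : ℝ) / Real.log n)
    (hvis : (n : ℝ) / Real.log n * (K + 1) ≤ (interactionRange φ).toReal * B) {u : Fin N}
    {R : Finset (Fin N)} (huR : u ∉ R)
    (hR : ∀ v ∈ R, blk B (x v) ≤ blk B (x u) + K ∧ blk B (x u) ≤ blk B (x v) + K) :
    ((R.filter fun v => psi φ n (x u) (x v) < ε).card : ℝ) < δ / 4 := by
  have hB' : (0 : ℝ) < B := Nat.cast_pos.2 hB
  refine lt_of_le_of_lt ?_ (h.low u)
  have hlow : ∀ t, 0 ≤ lowKernel φ ε t := fun t =>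
    Set.indicator_nonneg (fun _ _ => zero_le_one) _
  calc ((R.filter fun v => psi φ n (x u) (x v) < ε).card : ℝ)
      = ∑ v ∈ R.filter fun v => psi φ n (x u) (x v) < ε, (1 : ℝ) := by simp
    _ ≤ ∑ v ∈ R.filter fun v => psi φ n (x u) (x v) < ε,
        lowKernel φ ε ((n : ℝ) / Real.log n * torusDist (x u) (x v)) := by
        refine Finset.sum_le_sum fun v hv => ?_
        obtain ⟨hvR, hpsi⟩ := Finset.mem_filter.1 hv
        have h1 := blk_le (B := B) (h.mem_torus u)
        have h2 := lt_blk_add_one B (x u)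
        have h3 := blk_le (B := B) (h.mem_torus v)
        have h4 := lt_blk_add_one B (x v)
        have h5 : (blk B (x v) : ℝ) ≤ blk B (x u) + K := by exact_mod_cast (hR v hvR).1
        have h6 : (blk B (x u) : ℝ) ≤ blk B (x v) + K := by exact_mod_cast (hR v hvR).2
        have hdist : torusDist (x u) (x v) * B ≤ K + 1 := by
          have : |x u - x v| * B ≤ K + 1 := by
            rcases abs_choice (x u - x v) with e | e <;> rw [e] <;> nlinarith
          exact (mul_le_mul_of_nonneg_right (min_le_left _ _) hB'.le).trans this
        have hle : (n : ℝ) / Real.log n * torusDist (x u) (x v) ≤ (interactionRange φ).toReal := by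
          refine le_of_mul_le_mul_right ?_ hB'
          rw [mul_assoc]
          exact (mul_le_mul_of_nonneg_left hdist hn.le).trans hvis
        have hmem : (n : ℝ) / Real.log n * torusDist (x u) (x v) ∈
            {t : ℝ | t ≤ (interactionRange φ).toReal ∧ (φ t.toNNReal : ℝ) < ε} := ⟨hle, hpsi⟩
        exact (Set.indicator_of_mem hmem (1 : ℝ → ℝ)).ge
    _ ≤ _ := Finset.sum_le_sum_of_subset_of_nonneg (fun v hv => Finset.mem_erase.2
        ⟨ne_of_mem_of_not_mem (Finset.mem_filter.1 hv).1 huR, Finset.mem_univ v⟩) fun v _ _ => hlow _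

/-- All but `δ / 4` nodes of `R` have a kernel value of at least `ε` and contribute at least `g₀`;
the others are merely nonnegative. -/
theorem LocGood.sum_ge (h : LocGood φ n B K ε δ c a x) (hB : 0 < B)
    (hn : 0 < (n : ℝ) / Real.log n)
    (hvis : (n : ℝ) / Real.log n * (K + 1) ≤ (interactionRange φ).toReal * B) {u : Fin N}
    {R : Finset (Fin N)} (huR : u ∉ R)
    (hR : ∀ v ∈ R, blk B (x v) ≤ blk B (x u) + K ∧ blk B (x u) ≤ blk B (x v) + K)
    {g : Fin N → ℝ} {g₀ : ℝ} (hg : ∀ v ∈ R, 0 ≤ g v) (hg₀ : 0 ≤ g₀)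
    (hgε : ∀ v ∈ R, ε ≤ psi φ n (x u) (x v) → g₀ ≤ g v) :
    g₀ * (R.card - δ / 4) ≤ ∑ v ∈ R, g v := by
  have h1 := h.card_low_lt hB hn hvis huR hR
  have h2 := Finset.card_filter_add_card_filter_not (s := R) (fun v => psi φ n (x u) (x v) < ε)
  have h3 : ((R.filter fun v => psi φ n (x u) (x v) < ε).card : ℝ) +
      (R.filter fun v => ¬ psi φ n (x u) (x v) < ε).card = R.card := by exact_mod_cast h2
  calc g₀ * (R.card - δ / 4) ≤ g₀ * (R.filter fun v => ¬ psi φ n (x u) (x v) < ε).card :=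
        mul_le_mul_of_nonneg_left (by linarith) hg₀
    _ = ∑ v ∈ R.filter fun v => ¬ psi φ n (x u) (x v) < ε, g₀ := by
        rw [Finset.sum_const, nsmul_eq_mul, mul_comm]
    _ ≤ ∑ v ∈ R.filter fun v => ¬ psi φ n (x u) (x v) < ε, g v :=
        Finset.sum_le_sum fun v hv => by
          obtain ⟨h4, h5⟩ := Finset.mem_filter.1 hv
          exact hgε v h4 (not_lt.1 h5)
    _ ≤ _ := Finset.sum_le_sum_of_subset_of_nonneg (Finset.filter_subset _ _) fun v hv _ => hg v hv

theorem mem_inBlocks {j : ℕ} {u : Fin N} :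
    u ∈ inBlocks B K x j ↔ j ≤ blk B (x u) ∧ blk B (x u) < j + K := by
  simp [inBlocks, blockRange]

theorem LocGood.card_inBlocks_le (h : LocGood φ n B K ε δ c a x) {j : ℕ} (k : ℕ) (hj : j + k ≤ B) :
    ((inBlocks B k x j).card : ℝ) ≤ k * c := by
  induction k with
  | zero =>
    have : inBlocks B 0 x j = ∅ := by
      ext u
      rw [mem_inBlocks]
      simp
    simp [this]
  | succ k ih =>
    have hsub : inBlocks B (k + 1) x j ⊆ inBlocks B k x j ∪ inBlocks B 1 x (j + k) := by
      intro u hu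
      simp only [Finset.mem_union, mem_inBlocks] at hu ⊢
      omega
    have h1 : ((inBlocks B (k + 1) x j).card : ℝ) ≤
        (inBlocks B k x j).card + (inBlocks B 1 x (j + k)).card := by
      exact_mod_cast (Finset.card_le_card hsub).trans (Finset.card_union_le _ _)
    have h2 := h.card_lt (j + k) (by omega)
    have h3 := ih (by omega)
    push_cast
    linarith

end Links

/-! ### Chernoff bounds for propagation, seeding and the number of edges -/

section LinkBounds

open Classical

variable {lam p q : ℝ} {φ : ℝ≥0 → unitInterval} {n : ℕ} {N : ℕ} {σ : Fin N → ℤˣ} {x : Fin N → ℝ}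
  {B K : ℕ} {ε δ c a : ℝ}

theorem condProb_eq_zero {S : Set Sample}
    (h : ∀ G, (⟨⟨N, σ, G⟩, x⟩ : Sample) ∉ S) : condProb p q φ n S N σ x = 0 := by
  simp [condProb, graphExp, h]

/-! #### Few nodes are badly separated by the preceding blocks -/

/-- The nodes of `U` lie beyond the window, so the pairs in `U ×ˢ window` are distinct links and
thus independent, although they share end points. Each node of `U` has at least `3/4 * δ` partners
of kernel value at least `ε`. -/
theorem graphExp_propagate_le (hq : 0 < q) (hqp : q < p) (hp : p < 1)
    (h : LocGood φ n B K ε δ c a x) (hn : 0 < (n : ℝ) / Real.log n)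
    (hvis : (n : ℝ) / Real.log n * (K + 1) ≤ (interactionRange φ).toReal * B) {j : ℕ}
    (hj : j + K < B) {U : Finset (Fin N)} (hU : ∀ u ∈ U, blk B (x u) = j + K) {h₀ : ℝ} (hh₀ : 0 ≤ h₀)
    (hh : ∀ s, ε ≤ s → s ≤ 1 → h₀ ≤ hell p q s) :
    graphExp (linkProb p q φ n σ x) (fun G => Real.exp (-(1 / 2) * ∑ e ∈ U ×ˢ inBlocks B K x j,
      lbl σ e.1 * lbl σ e.2 * pairLlr p q φ n x G e.1 e.2)) ≤
      Real.exp (-(U.card * (h₀ * (3 / 4 * δ)))) := by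
  have hnotin : ∀ u ∈ U, u ∉ inBlocks B K x j := fun u hu hu' => by
    rw [mem_inBlocks, hU u hu] at hu'
    omega
  have hQ : Oriented (U ×ˢ inBlocks B K x j) := by
    intro u v huv
    rw [Finset.mem_product] at huv ⊢
    exact ⟨fun e => hnotin u huv.1 (e ▸ huv.2), fun h' => hnotin v h'.1 huv.2⟩
  rw [graphExp_exp_pairLlr hq hqp hp hQ]
  refine (prod_one_sub_le_exp _ _ fun e _ => hell_le_one (psi_nonneg φ n _ _)).trans ?_
  rw [Real.exp_le_exp, neg_le_neg_iff, Finset.sum_product, ← nsmul_eq_mul, ← Finset.sum_const]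
  refine Finset.sum_le_sum fun u hu => ?_
  have := h.sum_ge (by omega) hn hvis (hnotin u hu) (fun v hv => by
    rw [mem_inBlocks] at hv
    rw [hU u hu]
    omega) (g := fun v => hell p q (psi φ n (x u) (x v)))
    (fun v _ => hell_nonneg hq hqp hp (psi_nonneg φ n _ _) (psi_le_one φ n _ _)) hh₀
    (fun v _ hv => hh _ hv (psi_le_one φ n _ _))
  refine le_trans (mul_le_mul_of_nonneg_left ?_ hh₀) this
  linarith [h.window j hj.le]

/-- If more than `μ` nodes of a block are bad, then the total score of this set `U` is at most `|U|
T`. Markov's inequality bounds this by `exp(|U| (T/2 - 3/4 h₀ δ)) ≤ exp(-μ h₀ δ / 2)`. A block has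
at most `2^c ≤ exp c` subsets. -/
theorem law_propagate_le (hφ : Measurable φ) (hq : 0 < q) (hqp : q < p) (hp : p < 1) (hlam : 0 ≤ lam)
    (hn : 0 < (n : ℝ) / Real.log n)
    (hvis : (n : ℝ) / Real.log n * (K + 1) ≤ (interactionRange φ).toReal * B)
    {h₀ T μ : ℝ} (hh₀ : 0 ≤ h₀) (hδ : 0 ≤ δ)
    (hh : ∀ s, ε ≤ s → s ≤ 1 → h₀ ≤ hell p q s) (hT : T ≤ h₀ * δ / 2) :
    law lam p q φ n {ω | LocGood φ n B K ε δ c a ω.X ∧ ∃ j, j + K < B ∧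
      μ < (Finset.univ.filter fun u => blk B (ω.X u) = j + K ∧ lbl ω.σ u *
        (∑ v ∈ inBlocks B K ω.X j, lbl ω.σ v * pairLlr p q φ n ω.X ω.G u v) ≤ T).card} ≤
      ENNReal.ofReal (B * Real.exp (c - μ * (h₀ * δ / 2))) := by
  have hp0 : 0 ≤ p := (hq.trans hqp).le
  have hq1 : q ≤ 1 := (hqp.trans hp).le
  have hS : MeasurableSet {ω : Sample | LocGood φ n B K ε δ c a ω.X ∧ ∃ j, j + K < B ∧
      μ < (Finset.univ.filter fun u => blk B (ω.X u) = j + K ∧ lbl ω.σ u *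
        (∑ v ∈ inBlocks B K ω.X j, lbl ω.σ v * pairLlr p q φ n ω.X ω.G u v) ≤ T).card} := by
    refine measurableSet_sample_iff.2 fun cf => (measurableSet_locGood hφ n B K ε δ c a _).inter ?_
    refine measurableSet_exists fun j => measurableSet_const_and ?_
    refine measurableSet_of_blocks (N := cf.N) B (P := fun b x => μ < (Finset.univ.filter fun u =>
      b u = j + K ∧ lbl cf.σ u * (∑ v ∈ blockRange b K j, lbl cf.σ v *
        pairLlr p q φ n x cf.G u v) ≤ T).card) fun b => measurableSet_lt measurable_const ?_
    have : ∀ x : Fin cf.N → ℝ, (((Finset.univ.filter fun u => b u = j + K ∧ lbl cf.σ u *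
        (∑ v ∈ blockRange b K j, lbl cf.σ v * pairLlr p q φ n x cf.G u v) ≤ T).card : ℕ) : ℝ) =
        ∑ u, if b u = j + K ∧ lbl cf.σ u *
          (∑ v ∈ blockRange b K j, lbl cf.σ v * pairLlr p q φ n x cf.G u v) ≤ T then (1 : ℝ) else 0 :=
      fun x => by simp
    simp_rw [this]
    refine Finset.measurable_fun_sum _ fun u _ => Measurable.ite (measurableSet_const_and
      (measurableSet_le ((Finset.measurable_fun_sum _ fun v _ =>
        (measurable_pairLlr hφ _ u v).const_mul _).const_mul _) measurable_const))
      measurable_const measurable_const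
  refine law_le_of_condProb_le hφ hp0 hq.le hp.le hq1 hlam hS fun N σ x _ => ?_
  by_cases h : LocGood φ n B K ε δ c a x
  swap
  · rw [condProb_eq_zero fun G hG => h hG.1]
    positivity
  set J := (Finset.range B).filter fun j => j + K < B with hJ
  set 𝒰 : ℕ → Finset (Finset (Fin N)) := fun j =>
    (inBlocks B 1 x (j + K)).powerset.filter fun U => μ < (U.card : ℝ) with h𝒰
  refine (condProb_le_graphExp hp0 hq.le hp.le hq1 (F := fun G => ∑ j ∈ J, ∑ U ∈ 𝒰 j,
    Real.exp (U.card * T / 2) * Real.exp (-(1 / 2) * ∑ e ∈ U ×ˢ inBlocks B K x j,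
      lbl σ e.1 * lbl σ e.2 * pairLlr p q φ n x G e.1 e.2)) ?_ ?_).trans ?_
  · exact fun G => Finset.sum_nonneg fun j _ => Finset.sum_nonneg fun U _ => by positivity
  · rintro G ⟨-, j, hj, hμ⟩
    refine le_trans ?_ (Finset.single_le_sum (fun j _ => Finset.sum_nonneg fun U _ => by positivity)
      (show j ∈ J by simp [hJ]; omega))
    set U := Finset.univ.filter fun u => blk B (x u) = j + K ∧ lbl σ u *
      (∑ v ∈ inBlocks B K x j, lbl σ v * pairLlr p q φ n x G u v) ≤ T with hU
    have hmem : U ∈ 𝒰 j := by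
      refine Finset.mem_filter.2 ⟨Finset.mem_powerset.2 fun u hu => ?_, hμ⟩
      have := (Finset.mem_filter.1 hu).2.1
      rw [mem_inBlocks]
      omega
    refine le_trans ?_ (Finset.single_le_sum (fun U _ => by positivity) hmem)
    rw [← Real.exp_add]
    apply Real.one_le_exp
    have : ∑ e ∈ U ×ˢ inBlocks B K x j, lbl σ e.1 * lbl σ e.2 * pairLlr p q φ n x G e.1 e.2 ≤
        U.card * T := by
      rw [Finset.sum_product, ← nsmul_eq_mul, ← Finset.sum_const]
      refine Finset.sum_le_sum fun u hu => le_trans (le_of_eq ?_) (Finset.mem_filter.1 hu).2.2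
      rw [Finset.mul_sum]
      exact Finset.sum_congr rfl fun v _ => by ring
    linarith
  · rw [graphExp_sum]
    calc _ ≤ ∑ _j ∈ J, Real.exp (c - μ * (h₀ * δ / 2)) := Finset.sum_le_sum fun j hj => ?_
      _ = J.card * Real.exp (c - μ * (h₀ * δ / 2)) := by rw [Finset.sum_const, nsmul_eq_mul]
      _ ≤ _ := by
        have : J.card ≤ B := (Finset.card_filter_le _ _).trans (by simp)
        gcongr
    have hjB : j + K < B := (Finset.mem_filter.1 hj).2
    rw [graphExp_sum]
    calc _ ≤ ∑ _U ∈ 𝒰 j, Real.exp (-(μ * (h₀ * δ / 2))) := Finset.sum_le_sum fun U hU => ?_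
      _ = (𝒰 j).card * Real.exp (-(μ * (h₀ * δ / 2))) := by rw [Finset.sum_const, nsmul_eq_mul]
      _ ≤ Real.exp c * Real.exp (-(μ * (h₀ * δ / 2))) := by
        gcongr
        calc ((𝒰 j).card : ℝ) ≤ (2 : ℝ) ^ (inBlocks B 1 x (j + K)).card := by
              exact_mod_cast (Finset.card_filter_le _ _).trans (Finset.card_powerset _).le
          _ ≤ (Real.exp 1) ^ (inBlocks B 1 x (j + K)).card := by
              gcongr
              linarith [Real.add_one_le_exp (1 : ℝ)]
          _ = Real.exp (inBlocks B 1 x (j + K)).card := by rw [← Real.exp_nat_mul, mul_one]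
          _ ≤ Real.exp c := Real.exp_le_exp.2 (h.card_lt _ hjB).le
      _ = _ := by rw [← Real.exp_add, sub_eq_add_neg]
    obtain ⟨hsub, hμ⟩ := Finset.mem_filter.1 hU
    rw [graphExp_mul_left]
    refine (mul_le_mul_of_nonneg_left (graphExp_propagate_le hq hqp hp h hn hvis hjB (fun u hu => ?_)
      hh₀ hh) (Real.exp_pos _).le).trans ?_
    · have := mem_inBlocks.1 (Finset.mem_powerset.1 hsub hu)
      omega
    · rw [← Real.exp_add, Real.exp_le_exp]
      have h1 : (U.card : ℝ) * T ≤ U.card * (h₀ * δ / 2) :=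
        mul_le_mul_of_nonneg_left hT (Nat.cast_nonneg _)
      have h2 : μ * (h₀ * δ / 2) ≤ U.card * (h₀ * δ / 2) :=
        mul_le_mul_of_nonneg_right hμ.le (by positivity)
      nlinarith

/-! #### The initial labels -/

/-- For each `w` the two links are independent, and the product of the means has sign `σ s σ u` and
modulus at least `4 h₀²`, unless the kernel value to `s` or to `u` is low. Each of these exceptions
concerns fewer than `δ / 4` nodes. For small `θ` the quadratic error of the exponential costs at
most half of this gain. -/
theorem graphExp_seed_le (hq : 0 < q) (hqp : q < p) (hp : p < 1)
    (h : LocGood φ n B K ε δ c a x) (hn : 0 < (n : ℝ) / Real.log n)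
    (hvis : (n : ℝ) / Real.log n * (K + 1) ≤ (interactionRange φ).toReal * B) (hB : 0 < B)
    (hKB : K ≤ B) {h₀ θ : ℝ} (hh₀ : 0 ≤ h₀) (hh : ∀ s, ε ≤ s → s ≤ 1 → h₀ ≤ hell p q s)
    (hθ : 0 ≤ θ) (hθC : θ * llrBound p q ^ 2 ≤ 1)
    (hθδ : θ * llrBound p q ^ 4 * (K * c) ≤ h₀ ^ 2 * δ) {s u : Fin N}
    (hs : s ∈ inBlocks B K x 0) (hu : u ∈ inBlocks B K x 0) (hus : u ≠ s) :
    graphExp (linkProb p q φ n σ x) (fun G => Real.exp (-θ * (lbl σ s * lbl σ u *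
      ∑ w ∈ ((inBlocks B K x 0).erase u).erase s,
        pairLlr p q φ n x G s w * pairLlr p q φ n x G u w))) ≤
      Real.exp (8 * θ * h₀ ^ 2 - θ * h₀ ^ 2 * δ) := by
  set W := ((inBlocks B K x 0).erase u).erase s with hW
  set C := llrBound p q
  set τ := lbl σ s * lbl σ u with hτ
  have hτ1 : |τ| = 1 := by
    rcases lbl_eq σ s with h1 | h1 <;> rcases lbl_eq σ u with h2 | h2 <;> simp [hτ, h1, h2]
  have hsW : s ∉ W := by simp [hW]
  have huW : u ∉ W := by simp [hW]
  have hWsub : W ⊆ inBlocks B K x 0 := (Finset.erase_subset _ _).trans (Finset.erase_subset _ _)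
  have hmean := graphExp_prod_pairs (linkProb_comm φ n σ x (p := p) (q := q)) hus.symm hsW huW
    (fun w b b' => Real.exp (-θ * (τ * (llr p q (psi φ n (x s) (x w)) b *
      llr p q (psi φ n (x u) (x w)) b'))))
  have hexp : (fun G : SimpleGraph (Fin N) => Real.exp (-θ * (τ *
      ∑ w ∈ W, pairLlr p q φ n x G s w * pairLlr p q φ n x G u w))) = fun G => ∏ w ∈ W,
      Real.exp (-θ * (τ * (llr p q (psi φ n (x s) (x w)) (decide (G.Adj s w)) *
      llr p q (psi φ n (x u) (x w)) (decide (G.Adj u w))))) := by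
    funext G
    rw [Finset.mul_sum, Finset.mul_sum, Real.exp_sum]
    rfl
  rw [hexp, hmean]
  have h01 : ∀ v w, 0 ≤ psi φ n (x v) (x w) ∧ psi φ n (x v) (x w) ≤ 1 := fun v w =>
    ⟨psi_nonneg φ n _ _, psi_le_one φ n _ _⟩
  set m : Fin N → Fin N → ℝ := fun v w => linkProb p q φ n σ x v w * llr p q (psi φ n (x v) (x w)) true +
    (1 - linkProb p q φ n σ x v w) * llr p q (psi φ n (x v) (x w)) false with hm
  have hstep : ∀ w ∈ W, _ ≤ Real.exp (-θ * (τ * (m s w * m u w)) + θ ^ 2 * C ^ 4) := fun w _ =>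
    exp_product_le (C := C) (τ := τ)
      (linkProb_nonneg φ n σ x (hq.trans hqp).le hq.le s w)
      (linkProb_le_one φ n σ x hp.le (hqp.trans hp).le s w)
      (linkProb_nonneg φ n σ x (hq.trans hqp).le hq.le u w)
      (linkProb_le_one φ n σ x hp.le (hqp.trans hp).le u w)
      (abs_llr_le hq hqp hp (h01 s w).1 (h01 s w).2 true)
      (abs_llr_le hq hqp hp (h01 s w).1 (h01 s w).2 false)
      (abs_llr_le hq hqp hp (h01 u w).1 (h01 u w).2 true)
      (abs_llr_le hq hqp hp (h01 u w).1 (h01 u w).2 false) hθ hθC hτ1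
  refine (Finset.prod_le_prod (fun w _ => ?_) hstep).trans ?_
  · have a1 := linkProb_nonneg φ n σ x (hq.trans hqp).le hq.le s w
    have a2 := linkProb_le_one φ n σ x hp.le (hqp.trans hp).le s w
    have a3 := linkProb_nonneg φ n σ x (hq.trans hqp).le hq.le u w
    have a4 := linkProb_le_one φ n σ x hp.le (hqp.trans hp).le u w
    have a5 := sub_nonneg.2 a2
    have a6 := sub_nonneg.2 a4
    positivity
  rw [← Real.exp_sum, Real.exp_le_exp, Finset.sum_add_distrib, Finset.sum_const, nsmul_eq_mul,
    ← Finset.mul_sum]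
  set k : Fin N → ℝ := fun w => hell p q (psi φ n (x s) (x w)) * hell p q (psi φ n (x u) (x w)) with hk
  have hell0 : ∀ v w, 0 ≤ hell p q (psi φ n (x v) (x w)) := fun v w =>
    hell_nonneg hq hqp hp (h01 v w).1 (h01 v w).2
  have hkm : ∀ w ∈ W, 4 * k w ≤ τ * (m s w * m u w) := by
    intro w _
    have e1 := llr_mean_lower hq hqp hp (h01 s w).1 (h01 s w).2 (σ s) (σ w)
    have e2 := llr_mean_lower hq hqp hp (h01 u w).1 (h01 u w).2 (σ u) (σ w)
    rw [← lbl_mul_lbl] at e1 e2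
    have e3 := mul_le_mul e1 e2 (by linarith [hell0 u w]) (le_trans (by linarith [hell0 s w]) e1)
    have hw : lbl σ w * lbl σ w = 1 := by rcases lbl_eq σ w with h1 | h1 <;> simp [h1]
    calc 4 * k w = 2 * hell p q (psi φ n (x s) (x w)) * (2 * hell p q (psi φ n (x u) (x w))) := by
          simp only [hk]; ring
      _ ≤ _ := e3
      _ = (lbl σ w * lbl σ w) * (τ * (m s w * m u w)) := by
          simp only [hτ, hm, linkProb_eq_pairProb]; ring
      _ = _ := by rw [hw, one_mul]
  have hnear : ∀ v ∈ inBlocks B K x 0, ∀ w ∈ inBlocks B K x 0,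
      blk B (x w) ≤ blk B (x v) + K ∧ blk B (x v) ≤ blk B (x w) + K := by
    intro v hv w hw
    rw [mem_inBlocks] at hv hw
    omega
  -- The exceptions are removed twice, first those of `s` and then those of `u`; together they are
  -- fewer than `δ / 2`.
  set W' := W.filter fun w => ¬ psi φ n (x s) (x w) < ε with hW'
  have hksum : h₀ ^ 2 * (W.card - δ / 2) ≤ ∑ w ∈ W, k w := by
    have c1 := h.card_low_lt hB hn hvis hsW fun w hw => hnear s hs w (hWsub hw)
    have c2 : ((W.filter fun w => psi φ n (x s) (x w) < ε).card : ℝ) + W'.card = W.card := by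
      exact_mod_cast Finset.card_filter_add_card_filter_not (s := W) _
    have c3 := h.sum_ge hB hn hvis (u := u) (R := W')
      (fun hu' => huW (Finset.filter_subset _ _ hu'))
      (fun w hw => hnear u hu w (hWsub (Finset.filter_subset _ _ hw))) (g := k) (g₀ := h₀ ^ 2)
      (fun w _ => mul_nonneg (hell0 s w) (hell0 u w)) (by positivity) (fun w hw hε => ?_)
    · refine le_trans ?_ (c3.trans (Finset.sum_le_sum_of_subset_of_nonneg (Finset.filter_subset _ _)
        fun w _ _ => mul_nonneg (hell0 s w) (hell0 u w)))
      exact mul_le_mul_of_nonneg_left (by linarith) (by positivity)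
    · rw [sq]
      exact mul_le_mul (hh _ (not_lt.1 (Finset.mem_filter.1 hw).2) (h01 s w).2)
        (hh _ hε (h01 u w).2) hh₀ (hell0 s w)
  have hcardW : ((inBlocks B K x 0).card : ℝ) = W.card + 2 := by
    have h1 := Finset.card_erase_add_one hu
    have h2 := Finset.card_erase_add_one (Finset.mem_erase.2 ⟨hus.symm, hs⟩)
    have : (inBlocks B K x 0).card = W.card + 2 := by rw [hW]; omega
    exact_mod_cast this
  have hwin := h.window 0 (by omega)
  have hup := h.card_inBlocks_le (j := 0) K (by omega)
  have hsum : 4 * (h₀ ^ 2 * (δ / 2 - 2)) ≤ ∑ w ∈ W, τ * (m s w * m u w) := by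
    have h1 : h₀ ^ 2 * (δ / 2 - 2) ≤ h₀ ^ 2 * (W.card - δ / 2) :=
      mul_le_mul_of_nonneg_left (by linarith) (by positivity)
    have h2 := Finset.sum_le_sum hkm
    rw [← Finset.mul_sum] at h2
    linarith
  -- The second-order terms: `hθδ` was chosen so that they eat up half of the main term `2 * θ * h₀
  -- ^ 2 * δ`.
  have hsq : (W.card : ℝ) * (θ ^ 2 * C ^ 4) ≤ θ * (h₀ ^ 2 * δ) := by
    have : (W.card : ℝ) * (θ * (θ * C ^ 4)) ≤ (K * c) * (θ * (θ * C ^ 4)) :=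
      mul_le_mul_of_nonneg_right (by linarith) (by positivity)
    have h2 := mul_le_mul_of_nonneg_left hθδ hθ
    nlinarith
  have := mul_le_mul_of_nonneg_left hsum hθ
  linarith

/-- The union bound runs over all ordered pairs of nodes of the first blocks, so it does not matter
how the reference node was chosen. -/
theorem law_seed_le (hφ : Measurable φ) (hq : 0 < q) (hqp : q < p) (hp : p < 1) (hlam : 0 ≤ lam)
    (hn : 0 < (n : ℝ) / Real.log n)
    (hvis : (n : ℝ) / Real.log n * (K + 1) ≤ (interactionRange φ).toReal * B) (hB : 0 < B)
    (hKB : K ≤ B) {h₀ θ T : ℝ} (hh₀ : 0 ≤ h₀) (hh : ∀ s, ε ≤ s → s ≤ 1 → h₀ ≤ hell p q s)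
    (hθ : 0 ≤ θ) (hθC : θ * llrBound p q ^ 2 ≤ 1)
    (hθδ : θ * llrBound p q ^ 4 * (K * c) ≤ h₀ ^ 2 * δ) :
    law lam p q φ n {ω | LocGood φ n B K ε δ c a ω.X ∧ ∃ s u, (s ∈ inBlocks B K ω.X 0 ∧
      u ∈ inBlocks B K ω.X 0 ∧ u ≠ s) ∧ lbl ω.σ s * lbl ω.σ u *
        ∑ w ∈ ((inBlocks B K ω.X 0).erase u).erase s,
          pairLlr p q φ n ω.X ω.G s w * pairLlr p q φ n ω.X ω.G u w ≤ T} ≤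
      ENNReal.ofReal ((K * c) ^ 2 * Real.exp (θ * T + 8 * θ * h₀ ^ 2 - θ * h₀ ^ 2 * δ)) := by
  have hp0 : 0 ≤ p := (hq.trans hqp).le
  have hq1 : q ≤ 1 := (hqp.trans hp).le
  have hS : MeasurableSet {ω : Sample | LocGood φ n B K ε δ c a ω.X ∧
      ∃ s u, (s ∈ inBlocks B K ω.X 0 ∧ u ∈ inBlocks B K ω.X 0 ∧ u ≠ s) ∧ lbl ω.σ s * lbl ω.σ u *
        ∑ w ∈ ((inBlocks B K ω.X 0).erase u).erase s,
          pairLlr p q φ n ω.X ω.G s w * pairLlr p q φ n ω.X ω.G u w ≤ T} := by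
    refine measurableSet_sample_iff.2 fun cf => (measurableSet_locGood hφ n B K ε δ c a _).inter ?_
    refine measurableSet_of_blocks (N := cf.N) B (P := fun b x => ∃ s u, (s ∈ blockRange b K 0 ∧
      u ∈ blockRange b K 0 ∧ u ≠ s) ∧ lbl cf.σ s * lbl cf.σ u *
        ∑ w ∈ ((blockRange b K 0).erase u).erase s,
          pairLlr p q φ n x cf.G s w * pairLlr p q φ n x cf.G u w ≤ T) fun b => ?_
    refine measurableSet_exists fun s => measurableSet_exists fun u => measurableSet_const_and
      (measurableSet_le ((Finset.measurable_fun_sum _ fun w _ => ?_).const_mul _) measurable_const)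
    exact (measurable_pairLlr hφ _ s w).mul (measurable_pairLlr hφ _ u w)
  refine law_le_of_condProb_le hφ hp0 hq.le hp.le hq1 hlam hS fun N σ x _ => ?_
  by_cases h : LocGood φ n B K ε δ c a x
  swap
  · rw [condProb_eq_zero fun G hG => h hG.1]
    positivity
  set Z := (inBlocks B K x 0 ×ˢ inBlocks B K x 0).filter fun e => e.2 ≠ e.1 with hZ
  refine (condProb_le_graphExp hp0 hq.le hp.le hq1 (F := fun G => ∑ e ∈ Z,
    Real.exp (θ * T) * Real.exp (-θ * (lbl σ e.1 * lbl σ e.2 *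
      ∑ w ∈ ((inBlocks B K x 0).erase e.2).erase e.1,
        pairLlr p q φ n x G e.1 w * pairLlr p q φ n x G e.2 w))) ?_ ?_).trans ?_
  · exact fun G => Finset.sum_nonneg fun e _ => by positivity
  · rintro G ⟨-, s, u, ⟨hs, hu, hus⟩, hle⟩
    have hmem : (s, u) ∈ Z := Finset.mem_filter.2 ⟨Finset.mem_product.2 ⟨hs, hu⟩, hus⟩
    refine le_trans ?_ (Finset.single_le_sum (fun e _ => by positivity) hmem)
    rw [← Real.exp_add]
    apply Real.one_le_exp
    have := mul_le_mul_of_nonneg_left hle hθ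
    linarith
  · rw [graphExp_sum]
    have hcard := h.card_inBlocks_le (j := 0) K (by omega)
    calc _ ≤ ∑ _e ∈ Z, Real.exp (θ * T + 8 * θ * h₀ ^ 2 - θ * h₀ ^ 2 * δ) :=
          Finset.sum_le_sum fun e he => ?_
      _ = Z.card * Real.exp (θ * T + 8 * θ * h₀ ^ 2 - θ * h₀ ^ 2 * δ) := by
          rw [Finset.sum_const, nsmul_eq_mul]
      _ ≤ _ := by
          gcongr
          calc (Z.card : ℝ) ≤ (inBlocks B K x 0).card ^ 2 := by
                rw [sq]
                exact_mod_cast (Finset.card_filter_le _ _).trans (Finset.card_product _ _).le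
            _ ≤ _ := by gcongr
    obtain ⟨h1, h2⟩ := Finset.mem_filter.1 he
    rw [Finset.mem_product] at h1
    rw [graphExp_mul_left]
    refine (mul_le_mul_of_nonneg_left (graphExp_seed_le hq hqp hp h hn hvis hB hKB hh₀ hh hθ hθC hθδ
      h1.1 h1.2 h2) (Real.exp_pos _).le).trans ?_
    rw [← Real.exp_add, ← add_sub_assoc]

/-! #### The number of edges -/

theorem exp_neg_one_le : Real.exp (-1) ≤ 1 / 2 := by
  rw [Real.exp_neg, ← one_div]
  exact one_div_le_one_div_of_le two_pos (by linarith [Real.add_one_le_exp (1 : ℝ)])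

theorem card_adj_le_numEdges {G : SimpleGraph (Fin N)} {Q : Finset (Fin N × Fin N)}
    (hQ : Oriented Q) :
    (Q.filter fun e => G.Adj e.1 e.2).card ≤ G.edgeSet.ncard := by
  rw [← Set.ncard_coe_finset]
  refine Set.ncard_le_ncard_of_injOn (fun e => s(e.1, e.2)) ?_ ?_ (Set.toFinite _)
  · intro e he
    exact (Finset.mem_filter.1 he).2
  · rintro ⟨a, b⟩ he ⟨a', b'⟩ he' heq
    have h1 : (a, b) ∈ Q := (Finset.mem_filter.1 he).1
    have h2 : (a', b') ∈ Q := (Finset.mem_filter.1 he').1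
    rcases Sym2.eq_iff.1 heq with ⟨h3, h4⟩ | ⟨h3, h4⟩
    · exact Prod.ext h3 h4
    · simp only at h3 h4
      subst h3 h4
      exact absurd h2 (hQ _ _ h1).2

/-- Only links from a node to the `K` blocks before its own are counted: they are independent, and
each node beyond the first `K` blocks has an expected number of at least `q ε · 3/4 δ`. The tilt `1`
gives the factor `1 - (1 - e⁻¹) P ≤ 1 - P / 2` per link. -/
theorem law_numEdges_le (hφ : Measurable φ) (hq : 0 < q) (hqp : q < p) (hp : p < 1) (hlam : 0 ≤ lam)
    (hn : 0 < (n : ℝ) / Real.log n)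
    (hvis : (n : ℝ) / Real.log n * (K + 1) ≤ (interactionRange φ).toReal * B) (hB : 0 < B)
    (hKB : K ≤ B) (hε : 0 ≤ ε) (hδ : 0 ≤ δ) (T : ℝ) :
    law lam p q φ n {ω | LocGood φ n B K ε δ c a ω.X ∧ (ω.numEdges : ℝ) ≤ T} ≤
      ENNReal.ofReal (Real.exp (T - 1 / 2 * ((a - K * c) * (q * ε * (3 / 4 * δ))))) := by
  have hp0 : 0 ≤ p := (hq.trans hqp).le
  have hq1 : q ≤ 1 := (hqp.trans hp).le
  have hS : MeasurableSet {ω : Sample | LocGood φ n B K ε δ c a ω.X ∧ (ω.numEdges : ℝ) ≤ T} := by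
    refine measurableSet_sample_iff.2 fun cf => (measurableSet_locGood hφ n B K ε δ c a _).inter ?_
    exact MeasurableSet.const ((cf.G.edgeSet.ncard : ℝ) ≤ T)
  refine law_le_of_condProb_le hφ hp0 hq.le hp.le hq1 hlam hS fun N σ x _ => ?_
  by_cases h : LocGood φ n B K ε δ c a x
  swap
  · rw [condProb_eq_zero fun G hG => h hG.1]
    positivity
  set R : Fin N → Finset (Fin N) := fun u => inBlocks B K x (blk B (x u) - K) with hR
  set U : Finset (Fin N) := Finset.univ.filter fun u => K ≤ blk B (x u) with hU
  set Q : Finset (Fin N × Fin N) := Finset.univ.filter fun e => e.1 ∈ U ∧ e.2 ∈ R e.1 with hQdef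
  have hmemR : ∀ u ∈ U, ∀ v ∈ R u, blk B (x u) ≤ blk B (x v) + K ∧ blk B (x v) < blk B (x u) := by
    intro u hu v hv
    have h1 : K ≤ blk B (x u) := (Finset.mem_filter.1 hu).2
    have h2 := mem_inBlocks.1 hv
    omega
  have hQ : Oriented Q := by
    intro u v huv
    have h1 := (Finset.mem_filter.1 huv).2
    have h2 := hmemR u h1.1 v h1.2
    refine ⟨fun e => ?_, fun h' => ?_⟩
    · rw [e] at h2
      omega
    · have h3 := (Finset.mem_filter.1 h').2
      have h4 := hmemR v h3.1 u h3.2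
      omega
  have hsumQ : ∀ f : Fin N × Fin N → ℝ, ∑ e ∈ Q, f e = ∑ u ∈ U, ∑ v ∈ R u, f (u, v) := by
    intro f
    rw [Finset.sum_sigma']
    refine Finset.sum_bij' (fun e _ => ⟨e.1, e.2⟩) (fun e _ => (e.1, e.2)) ?_ ?_ ?_ ?_ ?_ <;>
      simp [hQdef]
  refine (condProb_le_graphExp hp0 hq.le hp.le hq1 (F := fun G => Real.exp T *
    ∏ e ∈ Q, if G.Adj e.1 e.2 then Real.exp (-1) else 1) ?_ ?_).trans ?_
  · exact fun G => mul_nonneg (Real.exp_pos _).le (Finset.prod_nonneg fun e _ => by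
      split_ifs <;> positivity)
  · rintro G ⟨-, hT⟩
    rw [Finset.prod_ite, Finset.prod_const_one, mul_one, Finset.prod_const, ← Real.exp_nat_mul,
      ← Real.exp_add]
    apply Real.one_le_exp
    have h1 : ((Q.filter fun e => G.Adj e.1 e.2).card : ℝ) ≤ G.edgeSet.ncard := by
      exact_mod_cast card_adj_le_numEdges hQ
    have h2 : (G.edgeSet.ncard : ℝ) ≤ T := hT
    linarith
  · rw [graphExp_mul_left, graphExp_prod (linkProb_comm φ n σ x (p := p) (q := q)) hQ
      (fun _ _ => Real.exp (-1)) (fun _ _ => 1), sub_eq_add_neg, Real.exp_add]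
    refine mul_le_mul_of_nonneg_left ?_ (Real.exp_pos _).le
    have hP0 := linkProb_nonneg φ n σ x hp0 hq.le
    have hP1 := linkProb_le_one φ n σ x hp.le hq1
    calc _ ≤ ∏ e ∈ Q, (1 - 1 / 2 * linkProb p q φ n σ x e.1 e.2) := by
          refine Finset.prod_le_prod (fun e _ => ?_) fun e _ => ?_
          · have := sub_nonneg.2 (hP1 e.1 e.2)
            have := hP0 e.1 e.2
            positivity
          · nlinarith [hP0 e.1 e.2, exp_neg_one_le]
      _ ≤ _ := prod_one_sub_le_exp _ _ fun e _ => by linarith [hP1 e.1 e.2]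
      _ ≤ _ := by
          rw [Real.exp_le_exp, neg_le_neg_iff, ← Finset.mul_sum, hsumQ]
          refine mul_le_mul_of_nonneg_left ?_ (by norm_num)
          -- All nodes count except those of the first `K` blocks, which have no full window before
          -- them.
          have hcard : a - K * c ≤ U.card := by
            have h1 := h.card_inBlocks_le (j := 0) K (by omega)
            have h2 : (inBlocks B B x 0).card ≤ (inBlocks B K x 0).card + U.card := by
              refine (Finset.card_le_card fun u _ => ?_).trans (Finset.card_union_le _ _)
              rw [Finset.mem_union, mem_inBlocks, hU, Finset.mem_filter]
              rcases lt_or_ge (blk B (x u)) K with hlt | hge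
              · exact Or.inl ⟨Nat.zero_le _, by omega⟩
              · exact Or.inr ⟨Finset.mem_univ u, hge⟩
            have h3 : ((inBlocks B B x 0).card : ℝ) ≤ (inBlocks B K x 0).card + U.card := by
              exact_mod_cast h2
            linarith [h.many]
          refine (mul_le_mul_of_nonneg_right hcard (by positivity)).trans ?_
          rw [← nsmul_eq_mul, ← Finset.sum_const]
          refine Finset.sum_le_sum fun u hu => ?_
          have hKu : K ≤ blk B (x u) := (Finset.mem_filter.1 hu).2
          have hlt := blk_lt hB (h.mem_torus u)
          have := h.sum_ge hB hn hvis (u := u) (R := R u) (fun hu' => by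
              have := hmemR u hu u hu'
              omega) (fun v hv => by
              have := hmemR u hu v hv
              omega) (g := fun v => linkProb p q φ n σ x u v) (g₀ := q * ε) (fun v _ => hP0 u v)
            (by positivity) (fun v _ hv => (mul_le_mul_of_nonneg_left hv hq.le).trans
              (le_pairProb hqp (psi_nonneg φ n _ _) (σ u) (σ v)))
          refine le_trans (mul_le_mul_of_nonneg_left ?_ (by positivity)) this
          linarith [h.window (blk B (x u) - K) (by omega)]

end LinkBounds

/-! ### Union bound over all bad events -/

section Union

variable {lam p q : ℝ} {φ : ℝ≥0 → unitInterval} {n B K D : ℕ} {ε δ c a : ℝ}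

/-- All the conditions on a sample that hold with high probability. -/
structure Typical (p q : ℝ) (φ : ℝ≥0 → unitInterval) (n B K D : ℕ) (ε δ c a μ T : ℝ) (ω : Sample) :
    Prop where
  good : Good p q φ n B K D ⌊c⌋₊ μ ω
  loc : LocGood φ n B K ε δ c a ω.X
  edges : T < ω.numEdges

theorem LocGood.card_inBlock_le {N : ℕ} {x : Fin N → ℝ} (h : LocGood φ n B K ε δ c a x) (hB : 0 < B)
    (b : ℕ) : (inBlock B x b).card ≤ ⌊c⌋₊ := by
  rcases lt_or_ge b B with hb | hb
  · have h1 : inBlock B x b = inBlocks B 1 x b := by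
      ext u
      rw [mem_inBlocks, inBlock, Finset.mem_filter]
      simp only [Finset.mem_univ, true_and]
      omega
    exact Nat.le_floor (h1 ▸ (h.card_lt b hb).le)
  · have h1 : inBlock B x b = ∅ := by
      ext u
      have := blk_lt hB (h.mem_torus u)
      simp only [inBlock, Finset.mem_filter, Finset.mem_univ, true_and, Finset.notMem_empty,
        iff_false]
      omega
    simp [h1]

/-- The first four terms are failures of the locations; then come seeding, propagation, the number
of edges and refinement. Links at kernel value zero have probability zero and contribute nothing. -/
theorem law_not_typical_le (hφ : Measurable φ) (hq : 0 < q) (hqp : q < p) (hp : p < 1)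
    (hκ_fin : interactionRange φ < ⊤) (hlam : 0 ≤ lam) (hn : 0 < (n : ℝ) / Real.log n)
    (hκ : (interactionRange φ).toReal / ((n : ℝ) / Real.log n) < 1 / 2)
    (hz : infoMetric φ p q / ((n : ℝ) / Real.log n) ≤ 1)
    (hvis : (n : ℝ) / Real.log n * (K + 1) ≤ (interactionRange φ).toReal * B)
    (hB : 0 < B) (hKB : K ≤ B) {h₀ θ s ϑ μ : ℝ} (T : ℝ) (hh₀ : 0 ≤ h₀) (hδ : 0 ≤ δ) (hε : 0 ≤ ε)
    (hh : ∀ s, ε ≤ s → s ≤ 1 → h₀ ≤ hell p q s) (hs : 0 ≤ s) (hϑ : 0 ≤ ϑ)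
    (hμ : 2 * llrBound p q * (K * μ) ≤ h₀ * δ / 2)
    (hθ : 0 ≤ θ) (hθC : θ * llrBound p q ^ 2 ≤ 1)
    (hθδ : θ * llrBound p q ^ 4 * (K * c) ≤ h₀ ^ 2 * δ) :
    law lam p q φ n {ω | ¬ Typical p q φ n B K D ε δ c a μ T ω} ≤
      (ENNReal.ofReal ((B + 1) * (Real.exp (s * δ) *
        Real.exp (lam * n * (K / B * (Real.exp (-s) - 1))))) +
      ENNReal.ofReal (B * (Real.exp (-c) * Real.exp (lam * n * (1 / B * (Real.exp 1 - 1))))) +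
      ENNReal.ofReal (Real.exp (-(ϑ * (δ / 4))) * (lam * n * Real.exp (lam * n *
        (2 / ((n : ℝ) / Real.log n) * ((Real.exp ϑ - 1) *
          ∫ t in Set.Ici (0 : ℝ), lowKernel φ ε t))))) +
      ENNReal.ofReal (Real.exp a * Real.exp (lam * n * (Real.exp (-1) - 1)))) +
      ENNReal.ofReal ((K * c) ^ 2 *
        Real.exp (θ * (2 * llrBound p q ^ 2) + 8 * θ * h₀ ^ 2 - θ * h₀ ^ 2 * δ)) +
      ENNReal.ofReal (B * Real.exp (c - μ * (h₀ * δ / 2))) +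
      ENNReal.ofReal (Real.exp (T - 1 / 2 * ((a - K * c) * (q * ε * (3 / 4 * δ))))) +
      ENNReal.ofReal (Real.exp ((llrBound p q + 2 * llrBound p q * ((2 * D + 1) * μ)) / 2) *
        (lam * n * Real.exp (lam * n * -(infoMetric φ p q / ((n : ℝ) / Real.log n))))) := by
  have hp0 : 0 ≤ p := (hq.trans hqp).le
  have hq1 : q ≤ 1 := (hqp.trans hp).le
  have hloc := law_not_locGood_le (lam := lam) (p := p) (q := q) (K := K) (δ := δ) (c := c) (a := a)
    hφ hp0 hq.le hp.le hq1 hlam hn hκ hB ε hs hϑ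
  have hadj := law_adj_zero (lam := lam) (n := n) hφ hp0 hq.le hp.le hq1 hlam
  have hseed := law_seed_le (lam := lam) (a := a) hφ hq hqp hp hlam hn hvis hB hKB hh₀ hh hθ hθC hθδ
    (T := 2 * llrBound p q ^ 2)
  have hprop := law_propagate_le (lam := lam) (a := a) (c := c) (μ := μ) hφ hq hqp hp hlam hn hvis
    hh₀ hδ hh hμ
  have hedge := law_numEdges_le (lam := lam) (a := a) (c := c) hφ hq hqp hp hlam hn hvis hB hKB hε hδ T
  have href := law_refine_le hφ hq hqp hp hκ_fin hlam hn hκ hz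
    (llrBound p q + 2 * llrBound p q * ((2 * D + 1) * μ))
  refine le_trans (measure_mono ?_) ((measure_union_le _ _).trans (add_le_add
    ((measure_union_le _ _).trans (add_le_add ((measure_union_le _ _).trans (add_le_add
      ((measure_union_le _ _).trans (add_le_add ((measure_union_le _ _).trans
        ((add_le_add hloc hadj.le).trans (add_zero _).le)) hseed)) hprop)) hedge)) href))
  intro ω hω
  by_contra hcon
  simp only [Set.mem_union, not_or] at hcon
  obtain ⟨⟨⟨⟨⟨h1, h2⟩, h3⟩, h4⟩, h5⟩, h6⟩ := hcon
  have hl : LocGood φ n B K ε δ c a ω.X := not_not.1 h1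
  refine hω ⟨⟨hl.mem_torus, ?_, hl.card_inBlock_le hB, fun u v huv hpsi => h2 ⟨u, v, huv, hpsi⟩,
    fun s hs u hu hus => ?_, fun j hj => ?_, fun u => ?_⟩, hl, ?_⟩
  · have := hl.window 0 (by omega)
    rw [← Finset.card_pos]
    exact_mod_cast hδ.trans_lt this
  · by_contra hle
    exact h3 ⟨hl, s, u, ⟨hs, hu, hus⟩, not_lt.1 hle⟩
  · by_contra hle
    exact h4 ⟨hl, j, hj, not_le.1 hle⟩
  · by_contra hle
    exact h6 ⟨u, not_lt.1 hle⟩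
  · by_contra hle
    exact h5 ⟨hl, not_lt.1 hle⟩

/-! ### The running time -/

/-- The number of binary digits is at most `1 + log B / log 2`, and `log 2 > 1/2`. -/
theorem nat_size_le {B M : ℕ} (hM : 0 < M) {L : ℝ} (hL : 0 ≤ L) (hB : (B : ℝ) ≤ M * Real.exp L) :
    (Nat.size B : ℝ) ≤ 1 + 2 * (Real.log M + L) := by
  have hM' : (1 : ℝ) ≤ M := by exact_mod_cast hM
  have hlogM := Real.log_nonneg hM'
  rcases Nat.eq_zero_or_pos (Nat.size B) with h | h
  · rw [h]
    push_cast
    linarith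
  have h1 : 2 ^ (Nat.size B - 1) ≤ B := Nat.lt_size.1 (by omega)
  have h2 : ((2 : ℝ) ^ (Nat.size B - 1)) ≤ B := by exact_mod_cast h1
  have h3 := Real.log_le_log (by positivity) (h2.trans hB)
  rw [Real.log_pow, Real.log_mul (by positivity) (Real.exp_pos _).ne', Real.log_exp] at h3
  have h4 : ((Nat.size B - 1 : ℕ) : ℝ) = Nat.size B - 1 := by
    rw [Nat.cast_sub (by omega), Nat.cast_one]
  rw [h4] at h3
  have h5 : (0 : ℝ) ≤ Nat.size B - 1 := by
    rw [← h4]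
    exact Nat.cast_nonneg _
  nlinarith [Real.log_two_gt_d9]

/-- The bound for the number of steps is of order `n log n`. -/
theorem step_bound {M K D N n : ℕ} {c₀ L : ℝ} (hM : 0 < M) (hc₀ : 0 ≤ c₀) (hL : 1 ≤ L)
    (hn : (n : ℝ) = Real.exp L) (hB : (B : ℝ) ≤ M * (n / L)) (hN : (N : ℝ) ≤ B * (c₀ * L)) :
    ((300 * (N + B * ((2 * D + 1) * ⌊c₀ * L⌋₊ + 1) + 1) *
      (Nat.size B + scoreCost (K + 2 * D + 1) ((2 * D + 1) * ⌊c₀ * L⌋₊)) : ℕ) : ℝ) ≤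
      300 * (M * c₀ + M * ((2 * D + 1) * c₀ + 1) + 1) *
        (1 + 2 * (Real.log M + 1) + 100 * (K + 2 * D + 2) * ((2 * D + 1) * c₀ + 1)) * (n * L) := by
  have hM' : (1 : ℝ) ≤ M := by exact_mod_cast hM
  have hlogM := Real.log_nonneg hM'
  have hL0 : 0 < L := by linarith
  have hn1 : (1 : ℝ) ≤ n := by
    rw [hn]
    exact Real.one_le_exp hL0.le
  have hd : ((⌊c₀ * L⌋₊ : ℕ) : ℝ) ≤ c₀ * L := Nat.floor_le (by positivity)
  have hBn : (B : ℝ) * L ≤ M * n := by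
    have := mul_le_mul_of_nonneg_right hB hL0.le
    rwa [mul_assoc, div_mul_cancel₀ _ hL0.ne'] at this
  have hBn' : (B : ℝ) ≤ M * n := by
    have : (B : ℝ) * 1 ≤ B * L := mul_le_mul_of_nonneg_left hL (Nat.cast_nonneg _)
    linarith
  have hsize := nat_size_le hM hL0.le (hn ▸ hBn')
  -- The first factor, the number of scores and cells, is of order `n`; the second, the cost of a
  -- score, is of order `log n`.
  have e1 : ((N + B * ((2 * D + 1) * ⌊c₀ * L⌋₊ + 1) + 1 : ℕ) : ℝ) ≤
      (M * c₀ + M * ((2 * D + 1) * c₀ + 1) + 1) * n := by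
    push_cast
    have h1 : (N : ℝ) ≤ M * c₀ * n := by nlinarith [mul_le_mul_of_nonneg_left hBn hc₀]
    have h2 : (B : ℝ) * ((2 * D + 1) * ⌊c₀ * L⌋₊ + 1) ≤ B * (((2 * D + 1) * c₀ + 1) * L) := by
      refine mul_le_mul_of_nonneg_left ?_ (Nat.cast_nonneg _)
      have : (2 * (D : ℝ) + 1) * ⌊c₀ * L⌋₊ ≤ (2 * D + 1) * (c₀ * L) :=
        mul_le_mul_of_nonneg_left hd (by positivity)
      linarith
    have h3 : (B : ℝ) * (((2 * D + 1) * c₀ + 1) * L) ≤ ((2 * D + 1) * c₀ + 1) * (M * n) := by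
      have := mul_le_mul_of_nonneg_left hBn (show 0 ≤ (2 * (D : ℝ) + 1) * c₀ + 1 by positivity)
      linarith
    linarith
  have e2 : ((Nat.size B + scoreCost (K + 2 * D + 1) ((2 * D + 1) * ⌊c₀ * L⌋₊) : ℕ) : ℝ) ≤
      (1 + 2 * (Real.log M + 1) + 100 * (K + 2 * D + 2) * ((2 * D + 1) * c₀ + 1)) * L := by
    unfold scoreCost
    push_cast
    have h1 : (2 * (D : ℝ) + 1) * ⌊c₀ * L⌋₊ + 1 ≤ ((2 * D + 1) * c₀ + 1) * L := by
      have : (2 * (D : ℝ) + 1) * ⌊c₀ * L⌋₊ ≤ (2 * D + 1) * (c₀ * L) :=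
        mul_le_mul_of_nonneg_left hd (by positivity)
      linarith
    have h2 := mul_le_mul_of_nonneg_left h1 (show 0 ≤ 100 * ((K : ℝ) + 2 * D + 2) by positivity)
    have h3 : 1 + 2 * (Real.log M + L) ≤ (1 + 2 * (Real.log M + 1)) * L := by nlinarith
    linarith
  rw [Nat.cast_mul, Nat.cast_mul]
  calc ((300 : ℕ) : ℝ) * _ * _ ≤ ((300 : ℕ) : ℝ) * ((M * c₀ + M * ((2 * D + 1) * c₀ + 1) + 1) * n) *
        ((1 + 2 * (Real.log M + 1) + 100 * (K + 2 * D + 2) * ((2 * D + 1) * c₀ + 1)) * L) := by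
        gcongr
    _ = _ := by push_cast; ring

end Union

/-! ### Limits -/

section Limits

variable {lam p q : ℝ} {φ : ℝ≥0 → unitInterval} {n M K D : ℕ}

theorem tendsto_log_natCast : Tendsto (fun n : ℕ => Real.log n) atTop atTop :=
  Real.tendsto_log_atTop.comp tendsto_natCast_atTop_atTop

theorem eventually_le_div_log (R : ℝ) : ∀ᶠ n : ℕ in atTop, R ≤ (n : ℝ) / Real.log n := by
  have h : ∀ᶠ y : ℝ in atTop, ‖Real.log y‖ ≤ (max R 1)⁻¹ * ‖y‖ :=
    Real.isLittleO_log_id_atTop.bound (by positivity)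
  filter_upwards [tendsto_natCast_atTop_atTop.eventually h,
    tendsto_log_natCast.eventually_ge_atTop 1] with n hn hL
  have hn' : Real.log n ≤ (max R 1)⁻¹ * n := by
    have := (le_abs_self _).trans hn
    rwa [Real.norm_of_nonneg (Nat.cast_nonneg n)] at this
  rw [le_div_iff₀ (by linarith)]
  have h1 : max R 1 * Real.log n ≤ n := by
    rwa [← inv_mul_le_iff₀ (by positivity), inv_inv] at hn'
  exact (mul_le_mul_of_nonneg_right (le_max_left _ _) (by linarith)).trans h1

/-- A common majorant for all error terms; the square of the logarithm is needed for the pairs in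
the seeding. -/
theorem tendsto_ofReal_zero {b : ℕ → ℝ} {A g : ℝ} (hg : 0 < g)
    (h : ∀ᶠ n : ℕ in atTop, b n ≤ A * (Real.log n ^ 2 * Real.exp (-(g * Real.log n)))) :
    Tendsto (fun n => ENNReal.ofReal (b n)) atTop (𝓝 0) := by
  have h1 : Tendsto (fun L : ℝ => L ^ 2 * Real.exp (-(g * L))) atTop (𝓝 0) := by
    have := Real.tendsto_pow_mul_exp_neg_atTop_nhds_zero 2
    have h2 := (this.comp (tendsto_id.const_mul_atTop hg)).const_mul (g⁻¹ ^ 2)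
    rw [mul_zero] at h2
    refine h2.congr fun L => ?_
    simp only [Function.comp, id]
    field_simp
  have h2 : Tendsto (fun n : ℕ => ENNReal.ofReal (A * (Real.log n ^ 2 *
      Real.exp (-(g * Real.log n))))) atTop (𝓝 0) := by
    have := ENNReal.tendsto_ofReal ((h1.comp tendsto_log_natCast).const_mul A)
    rwa [mul_zero, ENNReal.ofReal_zero] at this
  exact tendsto_of_tendsto_of_tendsto_of_le_of_le' tendsto_const_nhds h2
    (Eventually.of_forall fun _ => zero_le) (h.mono fun n hn => ENNReal.ofReal_le_ofReal hn)

/-- The number of blocks. -/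
def numBlocks (M n : ℕ) : ℕ := ⌊(M : ℝ) * n / Real.log n⌋₊

/-- Elementary facts about large scales. -/
structure LargeScale (M n : ℕ) : Prop where
  one_le_log : 1 ≤ Real.log n
  exp_log : Real.exp (Real.log n) = n
  log_le : Real.log n ≤ n
  one_le : (1 : ℝ) ≤ n
  blocks_pos : (0 : ℝ) < numBlocks M n
  blocks_le : (numBlocks M n : ℝ) ≤ M * (n / Real.log n)
  blocks_le_mul : (numBlocks M n : ℝ) ≤ M * n
  lt_blocks : (M : ℝ) * (n / Real.log n) - 1 < numBlocks M n
  log_div_le : Real.log n / M ≤ n / numBlocks M n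
  div_blocks_le : n / (numBlocks M n : ℝ) ≤ 2 * Real.log n / M

theorem eventually_largeScale (hM : 0 < M) : ∀ᶠ n : ℕ in atTop, LargeScale M n := by
  filter_upwards [tendsto_log_natCast.eventually_ge_atTop 1, eventually_le_div_log 2] with n hL hy
  have hL0 : 0 < Real.log n := by linarith
  have hM' : (1 : ℝ) ≤ M := by exact_mod_cast hM
  have hn0 : (0 : ℝ) < n := by
    rcases Nat.eq_zero_or_pos n with h | h
    · simp [h] at hL
      linarith
    · exact_mod_cast h
  have hexp := Real.exp_log hn0
  have hn1 : (1 : ℝ) ≤ n := hexp ▸ Real.one_le_exp hL0.le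
  have hMy : (2 : ℝ) ≤ M * (n / Real.log n) := by nlinarith
  have hle : (numBlocks M n : ℝ) ≤ M * (n / Real.log n) := by
    rw [numBlocks, mul_div_assoc]
    exact Nat.floor_le (by linarith)
  have hlt : (M : ℝ) * (n / Real.log n) - 1 < numBlocks M n := by
    rw [numBlocks, mul_div_assoc]
    linarith [Nat.lt_floor_add_one ((M : ℝ) * (n / Real.log n))]
  have hpos : (0 : ℝ) < numBlocks M n := by linarith
  have hyn : (n : ℝ) / Real.log n * Real.log n = n := div_mul_cancel₀ _ hL0.ne'
  refine ⟨hL, hexp, by linarith [Real.add_one_le_exp (Real.log n)], hn1, hpos, hle, ?_, hlt, ?_, ?_⟩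
  · refine hle.trans (mul_le_mul_of_nonneg_left (div_le_self hn0.le hL) (by positivity))
  · rw [div_le_div_iff₀ (by positivity) hpos]
    have := mul_le_mul_of_nonneg_right hle hL0.le
    nlinarith
  · rw [div_le_div_iff₀ hpos (by positivity)]
    have : (M : ℝ) * (n / Real.log n) ≤ 2 * numBlocks M n := by linarith
    have := mul_le_mul_of_nonneg_right this hL0.le
    nlinarith

theorem mul_exp_le {A E g L : ℝ} (hA : 0 ≤ A) (hL : 1 ≤ L) (hE : E ≤ -(g * L)) :
    A * Real.exp E ≤ A * (L ^ 2 * Real.exp (-(g * L))) := by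
  refine mul_le_mul_of_nonneg_left ?_ hA
  have h1 : (1 : ℝ) ≤ L ^ 2 := one_le_pow₀ hL
  calc Real.exp E ≤ Real.exp (-(g * L)) := Real.exp_le_exp.2 hE
    _ ≤ _ := le_mul_of_one_le_left (Real.exp_pos _).le h1

/-- There are order `n` windows, and each is too sparse with probability at most `n` to the power `s
δ - λ (K/M) (1 - e⁻ˢ)`; by `hg` this power is below `-1`. -/
theorem tendsto_window_bound (hM : 0 < M) (hlam : 0 < lam) {s δ : ℝ} (hs : 0 ≤ s)
    (hg : 1 + s * δ < lam * (K / M) * (1 - Real.exp (-s))) :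
    Tendsto (fun n : ℕ => ENNReal.ofReal ((numBlocks M n + 1) * (Real.exp (s * (δ * Real.log n)) *
      Real.exp (lam * n * (K / numBlocks M n * (Real.exp (-s) - 1)))))) atTop (𝓝 0) := by
  refine tendsto_ofReal_zero (A := 2 * M) (sub_pos.2 hg) ?_
  filter_upwards [eventually_largeScale hM] with n h
  have hM' : (1 : ℝ) ≤ M := by exact_mod_cast hM
  have hes : 0 ≤ 1 - Real.exp (-s) := by
    have := Real.exp_le_one_iff.2 (neg_nonpos.2 hs)
    linarith
  have h1 : (numBlocks M n : ℝ) + 1 ≤ 2 * M * Real.exp (Real.log n) := by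
    rw [h.exp_log]
    nlinarith [h.blocks_le_mul, h.one_le]
  have h2 : lam * n * (K / numBlocks M n * (Real.exp (-s) - 1)) ≤
      -(lam * (K / M) * (1 - Real.exp (-s)) * Real.log n) := by
    have := mul_le_mul_of_nonneg_left h.log_div_le
      (show 0 ≤ lam * K * (1 - Real.exp (-s)) by positivity)
    calc _ = -(lam * K * (1 - Real.exp (-s)) * (n / numBlocks M n)) := by ring
      _ ≤ -(lam * K * (1 - Real.exp (-s)) * (Real.log n / M)) := neg_le_neg this
      _ = _ := by ring
  calc _ ≤ 2 * M * Real.exp (Real.log n) * (Real.exp (s * (δ * Real.log n)) *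
        Real.exp (-(lam * (K / M) * (1 - Real.exp (-s)) * Real.log n))) := by gcongr
    _ = 2 * M * Real.exp (Real.log n + (s * (δ * Real.log n) +
        -(lam * (K / M) * (1 - Real.exp (-s)) * Real.log n))) := by
        rw [Real.exp_add, Real.exp_add, mul_assoc]
    _ ≤ _ := mul_exp_le (by positivity) h.one_le_log (le_of_eq (by ring))

/-- The exponential moment of a block costs at most `4 λ / M · log n`, since `e - 1 ≤ 2` and a block
has expected size at most `2 λ log n / M`. The remaining `2` in `c` pays for the number of blocks
and leaves `1 / n`. -/
theorem tendsto_block_bound (hM : 0 < M) (hlam : 0 < lam) {c : ℝ} (hc : 2 + 4 * lam / M ≤ c) :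
    Tendsto (fun n : ℕ => ENNReal.ofReal (numBlocks M n * (Real.exp (-(c * Real.log n)) *
      Real.exp (lam * n * (1 / numBlocks M n * (Real.exp 1 - 1)))))) atTop (𝓝 0) := by
  refine tendsto_ofReal_zero (A := M) one_pos ?_
  filter_upwards [eventually_largeScale hM] with n h
  have hM' : (1 : ℝ) ≤ M := by exact_mod_cast hM
  have he : Real.exp 1 - 1 ≤ 2 := by linarith [Real.exp_one_lt_d9]
  have he0 : 0 ≤ Real.exp 1 - 1 := by linarith [Real.add_one_le_exp (1 : ℝ)]
  have h1 : (numBlocks M n : ℝ) ≤ M * Real.exp (Real.log n) := by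
    rw [h.exp_log]
    exact h.blocks_le_mul
  have h2 : lam * n * (1 / numBlocks M n * (Real.exp 1 - 1)) ≤ 4 * lam / M * Real.log n := by
    calc _ = lam * (Real.exp 1 - 1) * (n / numBlocks M n) := by ring
      _ ≤ lam * 2 * (2 * Real.log n / M) := by
        have := h.div_blocks_le
        gcongr
      _ = _ := by ring
  calc _ ≤ M * Real.exp (Real.log n) * (Real.exp (-(c * Real.log n)) *
        Real.exp (4 * lam / M * Real.log n)) := by gcongr
    _ = M * Real.exp (Real.log n + (-(c * Real.log n) + 4 * lam / M * Real.log n)) := by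
        rw [Real.exp_add, Real.exp_add, mul_assoc]
    _ ≤ _ := mul_exp_le (by positivity) h.one_le_log (by
        have := h.one_le_log
        nlinarith)

/-- With `ϑ δ = 12` the tilt gains `n⁻³`; the choice of the node and the moment cost a factor `n`
each. -/
theorem tendsto_low_bound (hlam : 0 < lam) {δ ϑ I : ℝ} (hδ : ϑ * δ = 12)
    (hI : 2 * lam * ((Real.exp ϑ - 1) * I) ≤ 1) :
    Tendsto (fun n : ℕ => ENNReal.ofReal (Real.exp (-(ϑ * (δ * Real.log n / 4))) * (lam * n *
      Real.exp (lam * n * (2 / ((n : ℝ) / Real.log n) * ((Real.exp ϑ - 1) * I)))))) atTop (𝓝 0) := by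
  refine tendsto_ofReal_zero (A := lam) one_pos ?_
  filter_upwards [eventually_largeScale one_pos] with n h
  have hn0 : (n : ℝ) ≠ 0 := by linarith [h.one_le]
  have h2 : lam * n * (2 / ((n : ℝ) / Real.log n) * ((Real.exp ϑ - 1) * I)) ≤ Real.log n := by
    calc _ = 2 * lam * ((Real.exp ϑ - 1) * I) * Real.log n := by field_simp
      _ ≤ 1 * Real.log n := mul_le_mul_of_nonneg_right hI (by linarith [h.one_le_log])
      _ = _ := one_mul _
  calc _ ≤ Real.exp (-(ϑ * (δ * Real.log n / 4))) * (lam * Real.exp (Real.log n) *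
        Real.exp (Real.log n)) := by
        rw [h.exp_log]
        have := Real.exp_le_exp.2 h2
        rw [h.exp_log] at this
        gcongr
    _ = lam * Real.exp (-(ϑ * (δ * Real.log n / 4)) + Real.log n + Real.log n) := by
        rw [Real.exp_add, Real.exp_add]
        ring
    _ ≤ _ := mul_exp_le hlam.le h.one_le_log (le_of_eq (by
        rw [show ϑ * (δ * Real.log n / 4) = ϑ * δ * Real.log n / 4 by ring, hδ]
        ring))

theorem tendsto_many_bound (hlam : 0 < lam) :
    Tendsto (fun n : ℕ => ENNReal.ofReal (Real.exp (lam * n / 4) *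
      Real.exp (lam * n * (Real.exp (-1) - 1)))) atTop (𝓝 0) := by
  refine tendsto_ofReal_zero (A := 1) (g := lam / 4) (by positivity) ?_
  filter_upwards [eventually_largeScale one_pos] with n h
  rw [← Real.exp_add, ← one_mul (Real.exp (_ + _))]
  refine mul_exp_le zero_le_one h.one_le_log ?_
  have h1 : lam * Real.log n ≤ lam * n := mul_le_mul_of_nonneg_left h.log_le hlam.le
  have h2 : lam * n * (Real.exp (-1) - 1) ≤ lam * n * (1 / 2 - 1) :=
    mul_le_mul_of_nonneg_left (by linarith [exp_neg_one_le]) (by positivity)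
  linarith

theorem tendsto_seed_bound (k E : ℝ) {g δ : ℝ} (hg : 0 < g) (hδ : 0 < δ) :
    Tendsto (fun n : ℕ => ENNReal.ofReal ((K * (k * Real.log n)) ^ 2 *
      Real.exp (E - g * (δ * Real.log n)))) atTop (𝓝 0) := by
  refine tendsto_ofReal_zero (A := (K * k) ^ 2 * Real.exp E) (mul_pos hg hδ) ?_
  refine Eventually.of_forall fun n => le_of_eq ?_
  rw [sub_eq_add_neg, Real.exp_add, mul_assoc g]
  ring

/-- The gain is quadratic in `log n` and beats the number of blocks and of their subsets, for any `η
> 0`. -/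
theorem tendsto_propagate_bound (hM : 0 < M) (c : ℝ) {η g : ℝ} (hη : 0 < η) (hg : 0 < g) :
    Tendsto (fun n : ℕ => ENNReal.ofReal (numBlocks M n *
      Real.exp (c * Real.log n - η * Real.log n * (g * Real.log n)))) atTop (𝓝 0) := by
  refine tendsto_ofReal_zero (A := M) one_pos ?_
  filter_upwards [eventually_largeScale hM,
    tendsto_log_natCast.eventually_ge_atTop ((c + 2) / (η * g))] with n h hL
  have h1 : (numBlocks M n : ℝ) ≤ M * Real.exp (Real.log n) := by
    rw [h.exp_log]
    exact h.blocks_le_mul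
  rw [div_le_iff₀ (by positivity)] at hL
  calc _ ≤ M * Real.exp (Real.log n) *
        Real.exp (c * Real.log n - η * Real.log n * (g * Real.log n)) := by gcongr
    _ = M * Real.exp (Real.log n + (c * Real.log n - η * Real.log n * (g * Real.log n))) := by
        rw [Real.exp_add, mul_assoc (M : ℝ)]
    _ ≤ _ := mul_exp_le (by positivity) h.one_le_log (by
        have := mul_le_mul_of_nonneg_right hL (show 0 ≤ Real.log n by linarith [h.one_le_log])
        nlinarith)

/-- For large `n` the first `K` blocks hold at most half of the `λ n / 4` nodes. The tilt then gains
`3/64 · λ e δ n log n`, three times what the threshold costs. -/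
theorem tendsto_edges_bound (hlam : 0 < lam) {c e δ : ℝ} (he : 0 < e) (hδ : 0 < δ) :
    Tendsto (fun n : ℕ => ENNReal.ofReal (Real.exp (lam * e * δ / 64 * (n * Real.log n) -
      1 / 2 * ((lam * n / 4 - K * (c * Real.log n)) * (e * (3 / 4 * (δ * Real.log n)))))))
      atTop (𝓝 0) := by
  refine tendsto_ofReal_zero (A := 1) (g := lam * e * δ / 64) (by positivity) ?_
  filter_upwards [eventually_largeScale one_pos, eventually_le_div_log (8 * K * c / lam)] with n h hy
  have hL0 : 0 < Real.log n := by linarith [h.one_le_log]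
  have h1 : K * (c * Real.log n) ≤ lam * n / 8 := by
    rw [div_le_div_iff₀ hlam hL0] at hy
    linarith
  rw [← one_mul (Real.exp _)]
  refine mul_exp_le zero_le_one h.one_le_log ?_
  have h2 : lam * n / 8 * (e * (3 / 4 * (δ * Real.log n))) ≤
      (lam * n / 4 - K * (c * Real.log n)) * (e * (3 / 4 * (δ * Real.log n))) :=
    mul_le_mul_of_nonneg_right (by linarith) (by positivity)
  have h3 : lam * e * δ * Real.log n ≤ lam * e * δ * (n * Real.log n) :=
    mul_le_mul_of_nonneg_left (le_mul_of_one_le_left hL0.le h.one_le) (by positivity)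
  have h4 : 0 ≤ lam * e * δ * Real.log n := by positivity
  linarith

/-- Powers of `n`: `1` from the choice of the node, `C k η` from the tolerated mistakes, and `-λ I`
from the Chernoff bound. -/
theorem tendsto_refine_bound (hlam : 0 < lam) {C k η I : ℝ} (hg : C * (k * η) + 1 < lam * I) :
    Tendsto (fun n : ℕ => ENNReal.ofReal (Real.exp ((C + 2 * C * (k * (η * Real.log n))) / 2) *
      (lam * n * Real.exp (lam * n * -(I / ((n : ℝ) / Real.log n)))))) atTop (𝓝 0) := by
  refine tendsto_ofReal_zero (A := lam * Real.exp (C / 2)) (sub_pos.2 hg) ?_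
  filter_upwards [eventually_largeScale one_pos] with n h
  have hn0 : (n : ℝ) ≠ 0 := by linarith [h.one_le]
  have h2 : lam * n * -(I / ((n : ℝ) / Real.log n)) = -(lam * I * Real.log n) := by field_simp
  rw [h2]
  calc _ = Real.exp ((C + 2 * C * (k * (η * Real.log n))) / 2) * (lam * Real.exp (Real.log n) *
        Real.exp (-(lam * I * Real.log n))) := by rw [h.exp_log]
    _ = lam * Real.exp (C / 2) * Real.exp (C * (k * η) * Real.log n + Real.log n +
        -(lam * I * Real.log n)) := by
        rw [show (C + 2 * C * (k * (η * Real.log n))) / 2 = C / 2 + C * (k * η) * Real.log n by ring,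
          Real.exp_add, Real.exp_add, Real.exp_add]
        ring
    _ ≤ _ := mul_exp_le (by positivity) h.one_le_log (le_of_eq (by ring))

end Limits

/-! ### Exact recovery in linear time -/

section Recovery

variable {lam p q : ℝ} {φ : ℝ≥0 → unitInterval}

/-- For large `M` the interval from `M / λ` to `κ M` has length more than `2`, so that it has room
for `K = ⌊M / λ⌋ + 1` and for `K + 1`. -/
theorem exists_block_constants {κ : ℝ} (hlam : 0 < lam) (h : 1 < lam * κ) :
    ∃ M K : ℕ, 0 < M ∧ 1 < lam * (K / M) ∧ (K : ℝ) + 1 < κ * M := by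
  have hpos : 0 < κ - 1 / lam := by
    rw [sub_pos, div_lt_iff₀ hlam]
    linarith
  obtain ⟨M, hM⟩ := exists_nat_gt (2 / (κ - 1 / lam))
  have hM0 : (0 : ℝ) < M := (by positivity : 0 < 2 / (κ - 1 / lam)).trans hM
  rw [div_lt_iff₀ hpos] at hM
  have hfl := Nat.lt_floor_add_one ((M : ℝ) / lam)
  have hfl' := Nat.floor_le (show 0 ≤ (M : ℝ) / lam by positivity)
  refine ⟨M, ⌊(M : ℝ) / lam⌋₊ + 1, by exact_mod_cast hM0, ?_, ?_⟩
  · push_cast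
    rw [← mul_div_assoc, lt_div_iff₀ hM0, one_mul, mul_comm, ← div_lt_iff₀ hlam]
    exact hfl
  · push_cast
    have : (M : ℝ) * (κ - 1 / lam) = κ * M - M / lam := by ring
    linarith

theorem exists_rate_constants {r : ℝ} (hr : 1 < r) :
    ∃ s δ : ℝ, 0 < s ∧ 0 < δ ∧ 1 + s * δ < r * (1 - Real.exp (-s)) := by
  have h1 : 0 < r - 1 := by linarith
  have h2 : 1 < 2 * r / (r - 1) := by
    rw [lt_div_iff₀ h1]
    linarith
  have hs := Real.log_pos h2
  -- With this `s` one has `r (1 - e⁻ˢ) = (r + 1) / 2`, which exceeds `1` by `(r - 1) / 2`; the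
  -- product `s δ` uses up half of this.
  refine ⟨Real.log (2 * r / (r - 1)), (r - 1) / 4 / Real.log (2 * r / (r - 1)), hs, by positivity, ?_⟩
  rw [mul_div_cancel₀ _ hs.ne', Real.exp_neg, Real.exp_log (by linarith), inv_div]
  have : r * (1 - (r - 1) / (2 * r)) = (r + 1) / 2 := by
    field_simp
    ring
  rw [this]
  linarith

theorem exists_pos_mul_lt {a b a' b' : ℝ} (ha : 0 ≤ a) (hb : 0 < b) (ha' : 0 ≤ a') (hb' : 0 < b') :
    ∃ x : ℝ, 0 < x ∧ x * a < b ∧ x * a' < b' := by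
  refine ⟨min (b / (a + 1)) (b' / (a' + 1)), by positivity, ?_, ?_⟩
  · calc _ ≤ b / (a + 1) * a := mul_le_mul_of_nonneg_right (min_le_left _ _) ha
      _ < b := by rw [div_mul_eq_mul_div, div_lt_iff₀ (by positivity)]; linarith
  · calc _ ≤ b' / (a' + 1) * a' := mul_le_mul_of_nonneg_right (min_le_right _ _) ha'
      _ < b' := by rw [div_mul_eq_mul_div, div_lt_iff₀ (by positivity)]; linarith

/-- With high probability a sample is typical. -/
theorem exists_typical (hφ : Measurable φ) (hlam : 0 < lam) (hq : 0 < q) (hqp : q < p) (hp : p < 1)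
    (hκ_fin : interactionRange φ < ⊤)
    (hφ_pos : ∀ x : ℝ≥0, (x : ℝ≥0∞) ≤ interactionRange φ → 0 < φ x)
    (hconn : 1 < lam * (interactionRange φ).toReal) (hinfo : 1 < lam * infoMetric φ p q) :
    ∃ (M K D : ℕ) (ε δ c η T : ℝ), 0 < M ∧ 0 ≤ c ∧ 0 < η ∧ 0 < T ∧
      (interactionRange φ).toReal * M + 1 ≤ D ∧
      Tendsto (fun n : ℕ => law lam p q φ n {ω | ¬ Typical p q φ n (numBlocks M n) K D ε
        (δ * Real.log n) (c * Real.log n) (lam * n / 4) (η * Real.log n) (T * (n * Real.log n)) ω})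
        atTop (𝓝 0) := by
  set κ := (interactionRange φ).toReal with hκ
  obtain ⟨M, K, hM, hMK, hKκ⟩ := exists_block_constants hlam hconn
  obtain ⟨s, δ, hs, hδ, hrate⟩ := exists_rate_constants hMK
  have hM' : (1 : ℝ) ≤ M := by exact_mod_cast hM
  set D := ⌈κ * M + 1⌉₊ with hD
  set c := 2 + 4 * lam / M with hc
  have hc0 : 0 ≤ c := by positivity
  -- The tilt depends on `δ` and is fixed before `ε`, which then makes the low-kernel integral small
  -- enough for it.
  set ϑ := 12 / δ with hϑ
  have hexpϑ : 0 ≤ Real.exp ϑ - 1 := by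
    have := Real.one_le_exp (show 0 ≤ ϑ by positivity)
    linarith
  obtain ⟨ε, hε, hlow⟩ := exists_integral_lowKernel_lt hφ hκ_fin hφ_pos
    (show 0 < 1 / (2 * lam * (Real.exp ϑ - 1) + 1) by positivity)
  set C := llrBound p q with hC
  have hC0 : 0 < C := llrBound_pos hq hqp hp
  set h₀ := 1 / 2 * (√p - √q) ^ 2 * ε with hh₀
  have hh₀pos : 0 < h₀ := by
    have : 0 < √p - √q := sub_pos.2 (Real.sqrt_lt_sqrt hq.le hqp)
    positivity
  have hhell : ∀ t, ε ≤ t → t ≤ 1 → h₀ ≤ hell p q t := fun t ht ht1 =>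
    (mul_le_mul_of_nonneg_left ht (by positivity)).trans (hell_lower hq hqp hp ht1)
  -- Small enough for the expansion of the exponential, and for its error to stay below half of the
  -- main term.
  obtain ⟨θ, hθ, hθ1, hθ2⟩ := exists_pos_mul_lt (a := C ^ 2) (b := 1) (a' := C ^ 4 * (K * c))
    (b' := h₀ ^ 2 * δ) (by positivity) one_pos (by positivity) (by positivity)
  -- The density of tolerated mistakes: the first condition keeps the propagation stable, the second
  -- keeps the refinement below the gap `λ I - 1`.
  obtain ⟨η, hη, hη1, hη2⟩ := exists_pos_mul_lt (a := 2 * C * K) (b := h₀ * δ / 2)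
    (a' := C * (2 * D + 1)) (b' := lam * infoMetric φ p q - 1) (by positivity) (by positivity)
    (by positivity) (by linarith)
  refine ⟨M, K, D, ε, δ, c, η, lam * (q * ε) * δ / 64, hM, hc0, hη, by positivity, Nat.le_ceil _, ?_⟩
  have t1 := tendsto_window_bound (K := K) hM hlam hs.le hrate
  have t2 := tendsto_block_bound hM hlam (c := c) le_rfl
  have t3 := tendsto_low_bound hlam (δ := δ) (ϑ := ϑ)
    (I := ∫ t in Set.Ici (0 : ℝ), lowKernel φ ε t) (div_mul_cancel₀ _ hδ.ne') (by
      have h1 := mul_le_mul_of_nonneg_left hlow.le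
        (show 0 ≤ 2 * lam * (Real.exp ϑ - 1) by positivity)
      rw [← mul_assoc]
      refine h1.trans ?_
      rw [mul_one_div, div_le_one (by positivity)]
      linarith)
  have t4 := tendsto_many_bound hlam
  have t5 := tendsto_seed_bound (K := K) c (θ * (2 * C ^ 2) + 8 * θ * h₀ ^ 2)
    (g := θ * h₀ ^ 2) (by positivity) hδ
  have t6 := tendsto_propagate_bound hM c hη (g := h₀ * δ / 2) (by positivity)
  have t7 := tendsto_edges_bound (K := K) (c := c) hlam (mul_pos hq hε) hδ
  have t8 := tendsto_refine_bound hlam (C := C) (k := 2 * D + 1) (η := η) (I := infoMetric φ p q)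
    (by linarith)
  have t := (((((((t1.add t2).add t3).add t4).add t5).add t6).add t7).add t8)
  simp only [add_zero] at t
  refine tendsto_of_tendsto_of_tendsto_of_le_of_le' tendsto_const_nhds t
    (Eventually.of_forall fun _ => zero_le) ?_
  filter_upwards [eventually_largeScale hM, eventually_le_div_log (2 * κ + 1),
    eventually_le_div_log (infoMetric φ p q), eventually_le_div_log (κ / (κ * M - (K + 1))),
    eventually_le_div_log (K + 2)] with n h hy1 hy2 hy3 hy4
  have hκ0 : 0 ≤ κ := ENNReal.toReal_nonneg
  have hL0 : 0 < Real.log n := by linarith [h.one_le_log]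
  have hy : 0 < (n : ℝ) / Real.log n := by linarith
  have hB : 0 < numBlocks M n := by exact_mod_cast h.blocks_pos
  have hMy : (n : ℝ) / Real.log n ≤ M * (n / Real.log n) := le_mul_of_one_le_left hy.le hM'
  have hKB : K ≤ numBlocks M n := by
    have : (K : ℝ) ≤ numBlocks M n := by linarith [h.lt_blocks]
    exact_mod_cast this
  -- `numBlocks` loses less than `1` to rounding; the gap `κ M - (K + 1) > 0` absorbs this for large
  -- `n`.
  have hvis : (n : ℝ) / Real.log n * (K + 1) ≤ κ * numBlocks M n := by
    rw [div_le_iff₀ (by linarith)] at hy3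
    have := mul_le_mul_of_nonneg_left h.lt_blocks.le hκ0
    linarith
  have key := law_not_typical_le (lam := lam) (K := K) (D := D) (a := lam * n / 4)
    (c := c * Real.log n) (δ := δ * Real.log n) (μ := η * Real.log n) (ε := ε) (h₀ := h₀) (θ := θ)
    (s := s) (ϑ := ϑ) hφ hq hqp hp hκ_fin hlam.le hy
    (by rw [div_lt_iff₀ hy]; linarith) (by rw [div_le_one hy]; exact hy2) hvis hB hKB
    (lam * (q * ε) * δ / 64 * (n * Real.log n)) hh₀pos.le (by positivity) hε.le hhell hs.le
    (by positivity) ?_ hθ.le hθ1.le ?_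
  · refine key.trans (le_of_eq ?_)
    congr 6
    ring
  · have := mul_le_mul_of_nonneg_right hη1.le hL0.le
    linarith
  · have := mul_le_mul_of_nonneg_right hθ2.le hL0.le
    linarith

/-- Only monotonicity and subadditivity of the law are used, so the sets `S n`, which speak of runs
of a program, need not be shown to be measurable. -/
theorem tendsto_law_one (hφ : Measurable φ) (hq : 0 < q) (hqp : q < p) (hp : p < 1)
    {S : ℕ → Set Sample} {P : ℕ → Sample → Prop}
    (hP : Tendsto (fun n : ℕ => law lam p q φ n {ω | ¬ P n ω}) atTop (𝓝 0))
    (hS : ∀ᶠ n in atTop, ∀ ω, P n ω → ω ∈ S n) :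
    Tendsto (fun n : ℕ => law lam p q φ n (S n)) atTop (𝓝 1) := by
  have huniv : ∀ n : ℕ, law lam p q φ n Set.univ = 1 := fun n =>
    law_univ hφ (hq.trans hqp).le hq.le hp.le (hqp.trans hp).le
  have hsub : Tendsto (fun n : ℕ => 1 - law lam p q φ n {ω | ¬ P n ω}) atTop (𝓝 1) := by
    have := ENNReal.Tendsto.sub (tendsto_const_nhds (x := (1 : ℝ≥0∞))) hP (Or.inl ENNReal.one_ne_top)
    rwa [tsub_zero] at this
  refine tendsto_of_tendsto_of_tendsto_of_le_of_le' hsub tendsto_const_nhds ?_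
    (Eventually.of_forall fun n => (huniv n) ▸ measure_mono (Set.subset_univ _))
  filter_upwards [hS] with n hn
  rw [tsub_le_iff_right, ← huniv n]
  refine (measure_mono fun ω _ => ?_).trans (measure_union_le _ _)
  by_cases h : P n ω
  · exact Or.inl (hn ω h)
  · exact Or.inr h

theorem exists_linear_time_recovery (hφ : Measurable φ) (hlam : 0 < lam) (hq : 0 < q) (hqp : q < p)
    (hp : p < 1) (hκ_fin : interactionRange φ < ⊤)
    (hφ_pos : ∀ x : ℝ≥0, (x : ℝ≥0∞) ≤ interactionRange φ → 0 < φ x)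
    (hconn : 1 < lam * (interactionRange φ).toReal) (hinfo : 1 < lam * infoMetric φ p q) :
    ∃ P : Program, RecoversExactly P lam p q φ ∧ RunsInLinearTime P lam p q φ := by
  obtain ⟨M, K, D, ε, δ, c, η, T, hM, hc, hη, hT, hD, hlim⟩ :=
    exists_typical hφ hlam hq hqp hp hκ_fin hφ_pos hconn hinfo
  have hM' : (1 : ℝ) ≤ M := by exact_mod_cast hM
  have hlogM := Real.log_nonneg hM'
  set A : ℝ := 300 * (M * c + M * ((2 * D + 1) * c + 1) + 1) *
    (1 + 2 * (Real.log M + 1) + 100 * (K + 2 * D + 2) * ((2 * D + 1) * c + 1)) with hA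
  have hA0 : 0 ≤ A := by positivity
  have hmain : ∀ᶠ n : ℕ in atTop, ∀ ω, Typical p q φ n (numBlocks M n) K D ε
      (δ * Real.log n) (c * Real.log n) (lam * n / 4) (η * Real.log n) (T * (n * Real.log n)) ω →
      ((recoveryProg M K D).output (toInput lam p q φ n ω) = ω.σ ∨
        (recoveryProg M K D).output (toInput lam p q φ n ω) = -ω.σ) ∧
      ((recoveryProg M K D).steps (toInput lam p q φ n ω) : ℝ) ≤ A * (n * Real.log n) := by
    filter_upwards [eventually_largeScale hM, eventually_le_div_log (K + 2 * D + 2)] with n h hy ω hω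
    have hL0 : 0 < Real.log n := by linarith [h.one_le_log]
    have hB0 : 0 < numBlocks M n := by exact_mod_cast h.blocks_pos
    have hy0 : 0 < (n : ℝ) / Real.log n := lt_of_lt_of_le (by positivity) hy
    have hB : K + 2 * D + 1 ≤ numBlocks M n := by
      have h1 : (n : ℝ) / Real.log n ≤ M * (n / Real.log n) := le_mul_of_one_le_left hy0.le hM'
      have h2 : (K : ℝ) + 2 * D + 1 ≤ numBlocks M n := by linarith [h.lt_blocks]
      exact_mod_cast h2
    obtain ⟨hout, hsteps⟩ := hω.good.spec (lam := lam) (M := M) hq hqp hp hκ_fin hφ_pos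
      (by positivity) hy0 rfl (by omega) (by omega) hD
    refine ⟨hout, (Nat.cast_le.2 hsteps).trans (step_bound hM hc h.one_le_log h.exp_log.symm
      h.blocks_le ?_)⟩
    have h1 := hω.loc.card_inBlocks_le (j := 0) (numBlocks M n) (by omega)
    have h2 : inBlocks (numBlocks M n) (numBlocks M n) ω.X 0 = Finset.univ := by
      ext u
      have := blk_lt hB0 (hω.loc.mem_torus u)
      rw [mem_inBlocks]
      simpa using this
    rwa [h2, Finset.card_univ, Fintype.card_fin] at h1
  -- A typical sample has more than `T n log n` edges, so `A n log n` steps are at most `A / T`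
  -- times the number of edges. The sum of the two constants serves for both bounds.
  refine ⟨recoveryProg M K D, ?_, A / T + A, ?_⟩
  · exact tendsto_law_one hφ hq hqp hp hlim (hmain.mono fun n hn ω hω => (hn ω hω).1)
  · refine tendsto_law_one hφ hq hqp hp hlim ?_
    filter_upwards [hmain, eventually_largeScale hM] with n hn h ω hω
    have hL0 : 0 < Real.log n := by linarith [h.one_le_log]
    have h1 := (hn ω hω).2
    have h2 : A / T * (T * (n * Real.log n)) ≤ A / T * ω.numEdges :=
      mul_le_mul_of_nonneg_left hω.edges.le (by positivity)
    have h3 : A / T * (T * (n * Real.log n)) = A * (n * Real.log n) := by field_simp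
    have h4 : 0 ≤ A * ω.numEdges := by positivity
    have h5 : 0 ≤ A / T * (n * Real.log n) := by positivity
    constructor <;> rw [add_mul] <;> linarith

end Recovery

end GKBM

end

theorem theorem2 (lam p q : ℝ) (φ : ℝ≥0 → unitInterval) (hφ : Measurable φ)
    (hlam : 0 < lam) (hq : 0 < q) (hqp : q < p) (hp : p < 1)
    (hκ_pos : 0 < GKBM.interactionRange φ) (hκ_fin : GKBM.interactionRange φ < ⊤)
    (hφ_pos : ∀ x : ℝ≥0, (x : ℝ≥0∞) ≤ GKBM.interactionRange φ → 0 < φ x)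
    (hconn : 1 < lam * (GKBM.interactionRange φ).toReal)
    (hinfo : 1 < lam * GKBM.infoMetric φ p q) :
    ∃ P : GKBM.Program,
      GKBM.RecoversExactly P lam p q φ ∧ GKBM.RunsInLinearTime P lam p q φ := by
  exact GKBM.exists_linear_time_recovery hφ hlam hq hqp hp hκ_fin hφ_pos hconn hinfo
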